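/- Let $p$ be an odd prime and let $\mathbb{K}\subset\overline{\mathbb{Q}}\subset\mathbb{C}$ be a CM number field that is Galois over $\mathbb{Q}$ and contains the $p$-th roots of unity. Let $\mathbb{B}_\infty=\bigcup_n\mathbb{B}_n$ be the cyclotomic $\mathbb{Z}_p$-extension of $\mathbb{Q}$, where $\mathbb{B}_0=\mathbb{Q}$ and, for $n\ge 1$, $\mathbb{B}_n\subset\mathbb{Q}(\zeta_{p^n})$ has degree $p^{n-1}$ over $\mathbb{Q}$. Put $\mathbb{K}_n=\mathbb{K}\cdot\mathbb{B}_n$ and $\mathbb{K}_\infty=\bigcup_n\mathbb{K}_n$. Let $m\ge 0$ and let $\mathfrak{q}$ be a prime of $\mathbb{K}_m$ above a rational prime $q\equiv 1 \bmod p$ which is totally split in $\mathbb{K}_m/\mathbb{Q}$, and assume that $\mathfrak{q}$ is inert in $\mathbb{K}_\infty/\mathbb{K}_m$ (i.e. $\mathfrak{q}$ generates a prime ideal of $\mathbb{K}_n$ for every $n\ge m$). Let $\mathbb{F}\subset\mathbb{Q}(\zeta_q)$ be the subfield of degree $p$ over $\mathbb{Q}$, and let $\mathbb{L}_n=\mathbb{K}_n\cdot\mathbb{F}$,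 $\mathbb{L}_\infty=\mathbb{K}_\infty\cdot\mathbb{F}$ (the inert Thaine shift of degree $p$ induced by $\mathfrak{q}$). Let $\nu$ be an automorphism of $\overline{\mathbb{Q}}$ that fixes $\mathbb{K}_\infty$ pointwise and whose restriction to $\mathbb{F}$ generates $F=\mathrm{Gal}(\mathbb{F}/\mathbb{Q})\cong\mathrm{Gal}(\mathbb{L}_n/\mathbb{K}_n)$. For a CM field $\mathbb{M}$ write $A^-(\mathbb{M})$ for the minus part (complex conjugation acts as $-1$) of the $p$-Sylow subgroup of the ideal class group of $\mathbb{M}$, and put $\mathcal{A}(\mathbb{K})=\varprojlim_n A^-(\mathbb{K}_n)$, $\mathcal{A}(\mathbb{L})=\varprojlim_n A^-(\mathbb{L}_n)$, the limits being taken along the norm maps. Let $\iota$ be the levelwise map $A^-(\mathbb{K}_n)\to A^-(\mathbb{L}_n)$ induced by extension of ideals, let $s=\nu-1$ and $\mathcal{N}=\sum_{i=0}^{p-1}\nu^i$, and for a $\mathbb{Z}[F]$-module $C$ let $\hat H^0(F,C)=\mathrm{Ker}(s:C\to C)/\mathcal{N}C$. Then $\nu$ maps $\mathcal{A}(\mathbb{L})$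 onto itself, $$\mathrm{Ker}\bigl(s:\mathcal{A}(\mathbb{L})\to\mathcal{A}(\mathbb{L})\bigr)=\iota(\mathcal{A}(\mathbb{K})),$$ and $\hat H^0(F,\mathcal{A}(\mathbb{L}))=0$. -/

import Mathlib

open NumberField
open scoped nonZeroDivisors

noncomputable section

namespace IwasawaThaine

/-! ### Class groups: norm, lift and Galois action -/

section ClassGroups

variable (R S : Type*) [CommRing R] [CommRing S] [IsDedekindDomain R] [IsDedekindDomain S]
  [Algebra R S] [Module.Finite R S] [Module.IsTorsionFree R S]

/-- The relative norm on the monoid of nonzero integral ideals. -/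
def idealNorm : (Ideal S)⁰ →* (Ideal R)⁰ where
  toFun I := ⟨Ideal.relNorm R I.1, mem_nonZeroDivisors_iff_ne_zero.mpr fun h =>
    nonZeroDivisors.coe_ne_zero I (Ideal.relNorm_eq_bot_iff.mp h)⟩
  map_one' := Subtype.ext (map_one _)
  map_mul' I J := Subtype.ext (map_mul _ I.1 J.1)

theorem mk0_idealNorm_eq {I J : (Ideal S)⁰} (h : ClassGroup.mk0 I = ClassGroup.mk0 J) :
    ClassGroup.mk0 (idealNorm R S I) = ClassGroup.mk0 (idealNorm R S J) := by
  obtain ⟨x, y, hx, hy, hxy⟩ := ClassGroup.mk0_eq_mk0_iff.mp h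
  refine ClassGroup.mk0_eq_mk0_iff.mpr
    ⟨Algebra.intNorm R S x, Algebra.intNorm R S y, ?_, ?_, ?_⟩
  · exact Algebra.intNorm_ne_zero.mpr hx
  · exact Algebra.intNorm_ne_zero.mpr hy
  · have := congrArg (Ideal.relNorm R) hxy
    simpa only [map_mul, Ideal.relNorm_singleton] using! this

/-- The norm map on ideal class groups, `[I] ↦ [N_{S/R} I]`. -/
def classGroupNorm : ClassGroup S →* ClassGroup R where
  toFun c := ClassGroup.mk0 (idealNorm R S (ClassGroup.mk0_surjective c).choose)
  map_one' := by
    rw [mk0_idealNorm_eq R S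
      ((ClassGroup.mk0_surjective (1 : ClassGroup S)).choose_spec.trans (map_one _).symm)]
    simp
  map_mul' c d := by
    rw [← map_mul, ← map_mul]
    apply mk0_idealNorm_eq
    rw [map_mul, (ClassGroup.mk0_surjective (c * d)).choose_spec,
      (ClassGroup.mk0_surjective c).choose_spec, (ClassGroup.mk0_surjective d).choose_spec]

theorem classGroupNorm_mk0 (I : (Ideal S)⁰) :
    classGroupNorm R S (ClassGroup.mk0 I) = ClassGroup.mk0 (idealNorm R S I) :=
  mk0_idealNorm_eq R S (ClassGroup.mk0_surjective (ClassGroup.mk0 I)).choose_spec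

end ClassGroups

/-! ### Number fields inside the field of algebraic numbers -/

/-- The field `ℚ̄ ⊆ ℂ` of algebraic numbers. -/
abbrev QBar : Type := algebraicClosure ℚ ℂ

instance : IsAlgClosure ℚ QBar := algebraicClosure.isAlgClosure ℚ ℂ

instance : IsAlgClosed QBar := IsAlgClosure.isAlgClosed ℚ

instance : Normal ℚ QBar := IsAlgClosure.normal ℚ QBar

/-- Complex conjugation on `ℚ̄`. -/
def conjugation : QBar ≃ₐ[ℚ] QBar :=
  (Complex.conjAe.restrictScalars ℚ).restrictNormal QBar

theorem coe_conjugation (x : QBar) : (conjugation x : ℂ) = starRingEnd ℂ (x : ℂ) :=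
  AlgEquiv.restrictNormal_commutes (Complex.conjAe.restrictScalars ℚ) QBar x

/-- Number fields `E ⊆ ℚ̄` that are Galois over `ℚ`. -/
abbrev GaloisNF : Type := FiniteGaloisIntermediateField ℚ QBar

instance (E : GaloisNF) : IsGalois ℚ E := E.isGalois

instance (E : GaloisNF) : NumberField E where

/-- The inclusion of number fields `E ⊆ E'`. -/
def incl {E E' : GaloisNF} (h : E ≤ E') : E →+* E' :=
  (IntermediateField.inclusion h).toRingHom

/-- The norm `N_{E'/E} : Cl(E') → Cl(E)`. -/
def normCl {E E' : GaloisNF} (h : E ≤ E') : ClassGroup (𝓞 E') →* ClassGroup (𝓞 E) :=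
  letI : Algebra E E' := (incl h).toAlgebra
  classGroupNorm (𝓞 E) (𝓞 E')

/-- The lift `ι_{E,E'} : Cl(E) → Cl(E')` induced by extension of ideals. -/
def liftCl {E E' : GaloisNF} (h : E ≤ E') : ClassGroup (𝓞 E) →* ClassGroup (𝓞 E') :=
  letI : Algebra E E' := (incl h).toAlgebra
  ClassGroup.extendedHom (𝓞 E) (𝓞 E')

/-- The action on `Cl(E)` of (the restriction to `E` of) an automorphism of `ℚ̄`. -/
def galCl (σ : QBar ≃ₐ[ℚ] QBar) (E : GaloisNF) : ClassGroup (𝓞 E) →* ClassGroup (𝓞 E) :=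
  (ClassGroup.mulEquiv
    (RingOfIntegers.mapRingEquiv (σ.restrictNormal E).toRingEquiv)).toMonoidHom

/-- The minus part `A⁻(E)` of the `p`-Sylow subgroup of `Cl(E)`: the classes of `p`-power order
on which complex conjugation acts by inversion. -/
def minusPart (p : ℕ) [Fact p.Prime] (E : GaloisNF) : Subgroup (ClassGroup (𝓞 E)) where
  carrier := {a | a ∈ CommGroup.primaryComponent (ClassGroup (𝓞 E)) p ∧
    galCl conjugation E a = a⁻¹}
  one_mem' := ⟨one_mem _, by simp⟩
  mul_mem' := fun {a b} ha hb => ⟨mul_mem ha.1 hb.1, by rw [map_mul, ha.2, hb.2, mul_inv]⟩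
  inv_mem' := fun {a} ha => ⟨inv_mem ha.1, by rw [map_inv, ha.2]⟩

/-- The projective limit of the groups `A⁻(E n)` along the norm maps of a tower `E`: the group of
norm coherent sequences. -/
def limMinus (p : ℕ) [Fact p.Prime] (E : ℕ → GaloisNF) (hE : Monotone E) :
    Subgroup (∀ n, ClassGroup (𝓞 (E n))) where
  carrier := {a | (∀ n, a n ∈ minusPart p (E n)) ∧
    ∀ (i j : ℕ) (h : i ≤ j), normCl (hE h) (a j) = a i}
  one_mem' := ⟨fun _ => one_mem _, fun _ _ _ => map_one _⟩
  mul_mem' := fun {a b} ha hb => ⟨fun n => mul_mem (ha.1 n) (hb.1 n), fun i j h => by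
    rw [Pi.mul_apply, map_mul, ha.2 i j h, hb.2 i j h, Pi.mul_apply]⟩
  inv_mem' := fun {a} ha => ⟨fun n => inv_mem (ha.1 n), fun i j h => by
    rw [Pi.inv_apply, map_inv, ha.2 i j h, Pi.inv_apply]⟩

/-- The levelwise action of an automorphism of `ℚ̄` on sequences of classes. -/
def galSeq (σ : QBar ≃ₐ[ℚ] QBar) (E : ℕ → GaloisNF) :
    (∀ n, ClassGroup (𝓞 (E n))) →* (∀ n, ClassGroup (𝓞 (E n))) where
  toFun a n := galCl σ (E n) (a n)
  map_one' := funext fun _ => map_one _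
  map_mul' _ _ := funext fun _ => map_mul _ _ _

/-- The levelwise lift `ι` of sequences of classes. -/
def liftSeq {E E' : ℕ → GaloisNF} (h : ∀ n, E n ≤ E' n) :
    (∀ n, ClassGroup (𝓞 (E n))) →* (∀ n, ClassGroup (𝓞 (E' n))) where
  toFun a n := liftCl (h n) (a n)
  map_one' := funext fun _ => map_one _
  map_mul' _ _ := funext fun _ => map_mul _ _ _

/-! ### Tate cohomology of a cyclic group of order `p` -/

section Tate

variable {M : Type*} [CommGroup M]

/-- `s = ν - 1` (in multiplicative notation, `x ↦ ν(x) / x`). -/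
def sMap (ν : M →* M) : M →* M := ν / MonoidHom.id M

/-- The algebraic norm `1 + ν + ⋯ + ν ^ (p - 1)` (in multiplicative notation). -/
def algNorm (p : ℕ) (ν : M →* M) : M →* M where
  toFun x := ∏ i ∈ Finset.range p, (ν^[i]) x
  map_one' := by simp
  map_mul' x y := by simp [Finset.prod_mul_distrib]

/-- `Ker (s : C → C)` for a subgroup `C` stable under `ν`. -/
def kerS (ν : M →* M) (C : Subgroup M) : Subgroup M := C ⊓ (sMap ν).ker

/-- `Ĥ⁰(⟨ν⟩, C) = Ker (s : C → C) / (N C)` for a subgroup `C` stable under `ν`, where `ν` acts on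
`C` with order dividing `p`. -/
abbrev TateH0 (p : ℕ) (ν : M →* M) (C : Subgroup M) : Type _ :=
  kerS ν C ⧸ (C.map (algNorm p ν)).subgroupOf (kerS ν C)

end Tate

/-! ### Cyclotomic towers and the field `𝔽` -/

/-- The cyclotomic field `ℚ(ζ_N)`. -/
def cyclo (N : ℕ) : IntermediateField ℚ QBar := IntermediateField.adjoin ℚ {x | x ^ N = 1}

theorem exists_isPrimitiveRoot (N : ℕ) [NeZero N] : ∃ ζ : QBar, IsPrimitiveRoot ζ N :=
  HasEnoughRootsOfUnity.exists_primitiveRoot QBar N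

instance cyclo_isCyclotomic (N : ℕ) [NeZero N] : IsCyclotomicExtension {N} ℚ (cyclo N) := by
  have h := IntermediateField.isCyclotomicExtension_adjoin_of_exists_isPrimitiveRoot
    (K := ℚ) (L := QBar) (S := {N}) (fun n hn _ => by
      rw [Set.mem_singleton_iff] at hn
      subst hn
      exact exists_isPrimitiveRoot n)
  have e : {b : QBar | ∃ n ∈ ({N} : Set ℕ), n ≠ 0 ∧ b ^ n = 1} = {x | x ^ N = 1} := by
    ext x
    simp [NeZero.ne N]
  rw [e] at h
  exact h

/-- The compositum of all subfields of `ℚ(ζ_N)` whose degree over `ℚ` lies in `D`. -/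
def cycloSub (N : ℕ) [NeZero N] (D : Set ℕ) : GaloisNF :=
  have hle : sSup {E : IntermediateField ℚ QBar | E ≤ cyclo N ∧ Module.finrank ℚ E ∈ D}
      ≤ cyclo N := sSup_le fun _ hE => hE.1
  have : FiniteDimensional ℚ (cyclo N) := IsCyclotomicExtension.finiteDimensional {N} ℚ _
  have : IsAbelianGalois ℚ (cyclo N) := IsCyclotomicExtension.isAbelianGalois {N} ℚ _
  { toIntermediateField :=
      sSup {E : IntermediateField ℚ QBar | E ≤ cyclo N ∧ Module.finrank ℚ E ∈ D}
    finiteDimensional := FiniteDimensional.of_injective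
      (IntermediateField.inclusion hle).toLinearMap (IntermediateField.inclusion hle).injective
    isGalois := (@IsAbelianGalois.of_algHom ℚ _ _ _ _ _ _ _
      (IntermediateField.inclusion hle) this).toIsGalois }

variable (p : ℕ) [Fact p.Prime]

/-- `𝔹_n`, the `n`-th layer of the cyclotomic `ℤ_p`-extension of `ℚ`, numbered so that
`[𝔹_n : ℚ] = p ^ (n - 1)` for `n ≥ 1` (and `𝔹_0 = ℚ`): the largest subfield of `ℚ(ζ_{p^n})` of
`p`-power degree (for odd `p` the group `Gal(ℚ(ζ_{p^n})/ℚ)` is cyclic). -/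
def layerB (n : ℕ) : GaloisNF := cycloSub (p ^ n) {d | ∃ k : ℕ, d = p ^ k}

/-- `𝔽`, the subfield of degree `p` of `ℚ(ζ_q)` for a prime `q ≡ 1 mod p`. -/
def fieldF (q : ℕ) [Fact q.Prime] : GaloisNF := cycloSub q {p}

theorem layerB_mono : Monotone (layerB p) := by
  intro m n h
  change sSup {E : IntermediateField ℚ QBar | _} ≤ sSup {E : IntermediateField ℚ QBar | _}
  refine sSup_le_sSup fun E hE => ⟨hE.1.trans ?_, hE.2⟩
  refine IntermediateField.adjoin.mono _ _ _ fun x (hx : x ^ p ^ m = 1) => ?_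
  obtain ⟨k, rfl⟩ := Nat.exists_eq_add_of_le h
  change x ^ p ^ (m + k) = 1
  rw [pow_add, pow_mul, hx, one_pow]

/-- `𝕂_n = 𝕂 · 𝔹_n`. -/
def towerK (K : GaloisNF) (n : ℕ) : GaloisNF := K ⊔ layerB p n

theorem towerK_mono (K : GaloisNF) : Monotone (towerK p K) :=
  fun _ _ h => sup_le_sup_left (layerB_mono p h) K

/-- `𝕃_n = 𝕂_n · 𝔽`. -/
def towerL (K : GaloisNF) (q : ℕ) [Fact q.Prime] (n : ℕ) : GaloisNF :=
  towerK p K n ⊔ fieldF p q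

theorem towerL_mono (K : GaloisNF) (q : ℕ) [Fact q.Prime] : Monotone (towerL p K q) :=
  fun _ _ h => sup_le_sup_right (towerK_mono p K h) _

theorem towerK_le_towerL (K : GaloisNF) (q : ℕ) [Fact q.Prime] (n : ℕ) :
    towerK p K n ≤ towerL p K q n := le_sup_left

/-- The rational prime `q` is totally split in `E`: there are `[E : ℚ]` primes of `E` above it. -/
def TotallySplit (q : ℕ) (E : GaloisNF) : Prop :=
  ((Ideal.span {(q : ℤ)}).primesOver (𝓞 E)).ncard = Module.finrank ℚ E

/-- The prime `P` of `E` is inert in `E'/E`: it generates a prime ideal of `E'`. -/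
def Inert {E E' : GaloisNF} (h : E ≤ E') (P : Ideal (𝓞 E)) : Prop :=
  (P.map (RingOfIntegers.mapRingHom (incl h))).IsPrime

/-- The prime `Q` of `𝕂_m` induces an inert Thaine shift of degree `p` of `𝕂_∞/𝕂`: it is a totally
split prime above the rational prime `q ≡ 1 mod p`, and it is inert in `𝕂_∞/𝕂_m`, that is, in
every `𝕂_n/𝕂_m`. -/
structure InducesInertThaineShift (K : GaloisNF) (m q : ℕ) (Q : Ideal (𝓞 (towerK p K m))) :
    Prop where
  isPrime : Q.IsPrime
  above : Q.LiesOver (Ideal.span {(q : ℤ)})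
  split : TotallySplit q (towerK p K m)
  modEq : q ≡ 1 [MOD p]
  inert : ∀ (n : ℕ) (h : m ≤ n), Inert (towerK_mono p K h) Q

end IwasawaThaine

end

/-! That `ν` maps the limit onto itself is formal: complex conjugation commutes with every
automorphism on the fields 𝕃_n, so `ν` and its inverse both act on the limit. Lifted sequences are
fixed because `ν` is trivial on 𝕂_∞. The content lies in two assertions: every fixed coherent
sequence is lifted from 𝕂, and the norm 𝒜(𝕃) → 𝒜(𝕂) is onto. Together they give Ĥ⁰ = 0, since a
fixed sequence is ι(c), c is a norm N(b), and ι∘N is the algebraic norm. Class groups are finite, so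
by compactness (`exists_norm_coherent`) it suffices to solve each problem level by level.

Fixed classes. Let b be a fixed minus class of 𝕃_n with νJ = (y/x)J for some J in b. Passing to b² =
b/b̄ replaces y/x by a number γ with γγ̄ = 1, whose norm to 𝕂_n is a unit of absolute value 1 in all
embeddings, hence a root of unity ε. If ε, after raising everything to an exponent prime to p, is a
p-th power η^p in 𝕂_n, then Hilbert 90 for γ/η produces an invariant ideal
(`exists_invariant_ideal`). Now 𝕃_n/𝕂_n is totally ramified above q, so ε is a p-th power modulo the
primes above q. The prime 𝔮 stays inert when the next root of unity of p-power order is adjoined, so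
a local p-th power among such roots of unity is a global one (`exists_pow_eq_of_congr`).

Invariant ideals. For an invariant ideal J of 𝕃_j, J^p is extended from NJ. Away from q nothing
ramifies, so NJ has valuations divisible by p there; the primes above q come from any lower level i
≥ m by inertness. Thus NJ = d^p·r with r extended from 𝕂_i. Under the norm to 𝕃_i, r is raised to
the power [𝕂_j : 𝕂_i], a multiple of p, and extracting p-th roots shows that the norm of J is
extended from 𝕂_i (`exists_liftCl_eq_normCl`).

Surjectivity of the norm on class groups is proved analytically
(`NumberField.classGroupNorm_surjective`). Let χ be a nontrivial character of Cl(𝕂_n) that kills all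
norms and θ a Dirichlet character modulo q cutting out 𝔽. Comparing Euler factors gives ζ_𝕃(s) ≤
c·∏_{j<p} |L(s, χθ^j)| for s > 1. The factors with j ≥ 1 stay bounded near 1 because θ is nontrivial
on norms of integers (`exists_norm_eq`), and (s - 1)L(s, χ) → 0; this contradicts the pole of ζ_𝕃.
For the boundedness, a sum over the ideals of a class is written as a sum over a lattice with a
Lipschitz weight whose unit translates form a partition of unity. The coefficients are periodic with
sum zero, so only differences of neighbouring terms remain, and these converge uniformly up to s =
1. -/

/-! ### A Lipschitz partition of unity for the action of the units -/

namespace NumberField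

open mixedEmbedding NumberField.Units dirichletUnitTheorem InfinitePlace Module

/-- The tent function. -/
noncomputable def tent (t : ℝ) : ℝ := max 0 (1 - |t|)

theorem tent_nonneg (t : ℝ) : 0 ≤ tent t := le_max_left _ _

theorem tent_le_one (t : ℝ) : tent t ≤ 1 := max_le zero_le_one (by linarith [abs_nonneg t])

theorem tent_eq_zero {t : ℝ} (h : 1 ≤ |t|) : tent t = 0 := max_eq_left (by linarith)

theorem abs_tent_sub_le (a b : ℝ) : |tent a - tent b| ≤ |a - b| := by
  refine (abs_max_sub_max_le_max _ _ _ _).trans ?_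
  rw [sub_self, abs_zero, max_eq_right (abs_nonneg _), sub_sub_sub_cancel_left, abs_sub_comm]
  exact abs_abs_sub_abs_le a b

/-- Only two integer translates can be nonzero at `t`: with `u = ⌈t⌉ - t` they take the values `1 -
u` and `u`. -/
theorem sum_tent (t : ℝ) : ∑ n ∈ Finset.Icc (-⌈t⌉) (-⌈t⌉ + 1), tent (t + n) = 1 := by
  have h : Finset.Icc (-⌈t⌉) (-⌈t⌉ + 1) = {-⌈t⌉, -⌈t⌉ + 1} := by
    ext n; simp; omega
  rw [h, Finset.sum_pair (by omega)]
  have h1 := Int.le_ceil t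
  have h2 := Int.ceil_lt_add_one t
  push_cast
  rw [tent, tent, abs_of_nonpos (by linarith), abs_of_nonneg (by linarith),
    max_eq_right (by linarith), max_eq_right (by linarith)]
  ring

theorem tent_add_eq_zero {t : ℝ} {n : ℤ} (hn : n ∉ Finset.Icc (-⌈t⌉) (-⌈t⌉ + 1)) :
    tent (t + n) = 0 := by
  apply tent_eq_zero
  have h1 := Int.le_ceil t
  have h2 := Int.ceil_lt_add_one t
  rw [Finset.mem_Icc, not_and_or, not_le, not_le] at hn
  rcases hn with hn | hn
  · have : (n : ℝ) ≤ -⌈t⌉ - 1 := by exact_mod_cast (by omega : n ≤ -⌈t⌉ - 1)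
    rw [le_abs]; right; linarith
  · have : (-⌈t⌉ + 2 : ℝ) ≤ n := by exact_mod_cast (by omega : -⌈t⌉ + 2 ≤ n)
    rw [le_abs]; left; linarith

theorem hasSum_prod_tent {ι : Type*} [Fintype ι] (t : ι → ℝ) :
    HasSum (fun e : ι → ℤ => ∏ i, tent (t i + e i)) 1 := by
  classical
  have h := hasSum_sum_of_ne_finset_zero (L := SummationFilter.unconditional _)
    (f := fun e : ι → ℤ => ∏ i, tent (t i + e i))
    (s := Fintype.piFinset fun i => Finset.Icc (-⌈t i⌉) (-⌈t i⌉ + 1)) fun e he => by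
      rw [Fintype.mem_piFinset, not_forall] at he
      obtain ⟨i, hi⟩ := he
      exact Finset.prod_eq_zero (Finset.mem_univ i) (tent_add_eq_zero hi)
  rwa [← Finset.prod_univ_sum (fun i => Finset.Icc (-⌈t i⌉) (-⌈t i⌉ + 1))
    (fun i n => tent (t i + n)), Finset.prod_congr rfl fun i _ => sum_tent (t i),
    Finset.prod_const_one] at h

theorem abs_prod_sub_prod_le {ι : Type*} (s : Finset ι) (f g : ι → ℝ)
    (hf : ∀ i, 0 ≤ f i ∧ f i ≤ 1) (hg : ∀ i, 0 ≤ g i ∧ g i ≤ 1) :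
    |∏ i ∈ s, f i - ∏ i ∈ s, g i| ≤ ∑ i ∈ s, |f i - g i| := by
  classical
  induction s using Finset.induction_on with
  | empty => simp
  | insert i s hi ih =>
    rw [Finset.prod_insert hi, Finset.prod_insert hi, Finset.sum_insert hi]
    have e : f i * ∏ j ∈ s, f j - g i * ∏ j ∈ s, g j =
      (f i - g i) * ∏ j ∈ s, f j + g i * (∏ j ∈ s, f j - ∏ j ∈ s, g j) := by ring
    rw [e]
    refine (abs_add_le _ _).trans (add_le_add ?_ ?_)
    · rw [abs_mul]
      refine mul_le_of_le_one_right (abs_nonneg _) ?_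
      rw [abs_of_nonneg (Finset.prod_nonneg fun j _ => (hf j).1)]
      exact Finset.prod_le_one (fun j _ => (hf j).1) fun j _ => (hf j).2
    · rw [abs_mul, abs_of_nonneg (hg i).1]
      exact (mul_le_of_le_one_left (abs_nonneg _) (hg i).2).trans ih

variable (K : Type*) [Field K] [NumberField K]

open scoped Classical in
/-- The basis of the logarithmic space given by a fundamental system of units. -/
noncomputable def logBasis : Basis (Fin (rank K)) ℝ (logSpace K) :=
  (basisUnitLattice K).ofZLatticeBasis ℝ _

open scoped Classical in
theorem logBasis_apply (i : Fin (rank K)) :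
    logBasis K i = logEmbedding K (Additive.ofMul (fundSystem K i)) := by
  rw [logBasis, Basis.ofZLatticeBasis_apply, logEmbedding_fundSystem]

variable {K}

/-- A weight function on the mixed space which is homogeneous of degree zero and whose
translates by the units modulo torsion form a partition of unity. -/
noncomputable def coneWeight (x : mixedSpace K) : ℝ := ∏ i, tent ((logBasis K).repr (logMap x) i)

theorem coneWeight_nonneg (x : mixedSpace K) : 0 ≤ coneWeight x :=
  Finset.prod_nonneg fun _ _ => tent_nonneg _

theorem coneWeight_le_one (x : mixedSpace K) : coneWeight x ≤ 1 :=
  Finset.prod_le_one (fun _ _ => tent_nonneg _) fun _ _ => tent_le_one _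

open scoped Classical in
variable (K) in
theorem exists_abs_repr_logBasis_le :
    ∃ C : ℝ, 0 ≤ C ∧ ∀ (z : logSpace K) (i : Fin (rank K)), |(logBasis K).repr z i| ≤ C * ‖z‖ := by
  let f := (logBasis K).equivFun.toLinearMap.toContinuousLinearMap
  refine ⟨‖f‖, norm_nonneg _, fun z i => ?_⟩
  exact (norm_le_pi_norm (f z) i).trans (f.le_opNorm z)

open scoped Classical in
variable (K) in
-- This is the reason for using tents instead of the indicator of a fundamental cone: the weight has
-- no boundary that would need a separate count.
theorem exists_abs_coneWeight_sub_le :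
    ∃ C : ℝ, 0 ≤ C ∧ ∀ x y : mixedSpace K,
      |coneWeight x - coneWeight y| ≤ C * ‖logMap x - logMap y‖ := by
  obtain ⟨C, hC, h⟩ := exists_abs_repr_logBasis_le K
  refine ⟨rank K * C, by positivity, fun x y => ?_⟩
  refine (abs_prod_sub_prod_le _ _ _ (fun _ => ⟨tent_nonneg _, tent_le_one _⟩)
    (fun _ => ⟨tent_nonneg _, tent_le_one _⟩)).trans ?_
  refine (Finset.sum_le_card_nsmul _ _ (C * ‖logMap x - logMap y‖) fun i _ => ?_).trans_eq ?_
  · refine (abs_tent_sub_le _ _).trans ?_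
    rw [← Finsupp.sub_apply, ← map_sub]
    exact h _ i
  · simp [mul_assoc]

open scoped Classical in
variable (K) in
-- A tent vanishes outside `[-1, 1]`, so all coordinates with respect to the unit lattice are
-- bounded on the support.
theorem exists_norm_logMap_le :
    ∃ R : ℝ, 0 ≤ R ∧ ∀ x : mixedSpace K, coneWeight x ≠ 0 → ‖logMap x‖ ≤ R := by
  refine ⟨∑ i, ‖logBasis K i‖, by positivity, fun x hx => ?_⟩
  rw [coneWeight, Finset.prod_ne_zero_iff] at hx
  rw [← (logBasis K).sum_repr (logMap x)]
  refine norm_sum_le_of_le _ fun i hi => ?_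
  rw [_root_.norm_smul]
  refine mul_le_of_le_one_left (norm_nonneg _) ?_
  by_contra h
  exact hx i hi (tent_eq_zero (not_le.mp h).le)

theorem sum_mult_log_normAtPlace {x : mixedSpace K} (hx : mixedEmbedding.norm x ≠ 0) :
    ∑ w : InfinitePlace K, (mult w : ℝ) * Real.log (normAtPlace w x) =
      Real.log (mixedEmbedding.norm x) := by
  rw [mixedEmbedding.norm_apply, Real.log_prod]
  · simp
  · intro w _
    exact pow_ne_zero _ (mixedEmbedding.norm_ne_zero_iff.mp hx w)

variable (K) in
-- `logMap` sees only the places different from `w₀`. The remaining one is recovered because the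
-- deviations from the mean, weighted by multiplicity, sum to zero.
theorem exists_abs_log_normAtPlace_le :
    ∃ R : ℝ, 0 ≤ R ∧ ∀ x : mixedSpace K, mixedEmbedding.norm x ≠ 0 → coneWeight x ≠ 0 →
      ∀ w, |Real.log (normAtPlace w x) - Real.log (mixedEmbedding.norm x) * (finrank ℚ K : ℝ)⁻¹|
        ≤ R := by
  classical
  obtain ⟨R, hR, h⟩ := exists_norm_logMap_le K
  refine ⟨(Fintype.card (InfinitePlace K) + 1) * R, by positivity, fun x hx hw => ?_⟩
  set a : InfinitePlace K → ℝ := fun w => Real.log (normAtPlace w x) -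
    Real.log (mixedEmbedding.norm x) * (finrank ℚ K : ℝ)⁻¹ with ha
  have h1 : ∀ w : InfinitePlace K, w ≠ w₀ → |mult w * a w| ≤ R := fun w hw0 =>
    (norm_le_pi_norm (logMap x) ⟨w, hw0⟩).trans (h x hw)
  have hm : ∀ w : InfinitePlace K, |a w| ≤ |mult w * a w| := fun w => by
    rw [abs_mul]
    refine le_mul_of_one_le_left (abs_nonneg _) ?_
    rw [Nat.abs_cast]
    exact_mod_cast mult_pos
  have hsum : ∑ w : InfinitePlace K, mult w * a w = 0 := by
    simp_rw [ha, mul_sub, Finset.sum_sub_distrib, sum_mult_log_normAtPlace hx]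
    rw [← Finset.sum_mul, ← Nat.cast_sum, sum_mult_eq]
    have : (finrank ℚ K : ℝ) ≠ 0 := Nat.cast_ne_zero.mpr finrank_pos.ne'
    field_simp
    ring
  intro w
  by_cases hw0 : w = w₀
  · subst hw0
    refine (hm _).trans ?_
    rw [← Finset.add_sum_erase _ _ (Finset.mem_univ (w₀ : InfinitePlace K))] at hsum
    rw [eq_neg_of_add_eq_zero_left hsum, abs_neg]
    refine (Finset.abs_sum_le_sum_abs _ _).trans ?_
    refine (Finset.sum_le_card_nsmul _ _ R fun v hv => h1 v (Finset.ne_of_mem_erase hv)).trans ?_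
    rw [nsmul_eq_mul]
    refine mul_le_mul_of_nonneg_right ?_ hR
    have : (Finset.univ.erase (w₀ : InfinitePlace K)).card ≤ Fintype.card (InfinitePlace K) :=
      Finset.card_le_univ _
    have : ((Finset.univ.erase (w₀ : InfinitePlace K)).card : ℝ) ≤
      Fintype.card (InfinitePlace K) := by exact_mod_cast this
    linarith
  · refine ((hm w).trans (h1 w hw0)).trans ?_
    exact le_mul_of_one_le_left hR (by linarith [Nat.cast_nonneg (α := ℝ) (Fintype.card (InfinitePlace K))])

variable (K) in
/-- Units as products of a root of unity and a product of fundamental units. -/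
noncomputable def unitsEquivTorsionProd : torsion K × (Fin (rank K) → ℤ) ≃ (𝓞 K)ˣ :=
  Equiv.ofBijective (fun ζe => ζe.1 * ∏ i, (fundSystem K i) ^ (ζe.2 i))
    ⟨fun _ _ hab => (exist_unique_eq_mul_prod K _).unique rfl hab,
      fun x => (exist_unique_eq_mul_prod K x).exists.imp fun _ h => h.symm⟩

theorem unitsEquivTorsionProd_apply (ζe : torsion K × (Fin (rank K) → ℤ)) :
    unitsEquivTorsionProd K ζe = ζe.1 * ∏ i, (fundSystem K i) ^ (ζe.2 i) := rfl

theorem repr_logEmbedding (ζe : torsion K × (Fin (rank K) → ℤ)) (i : Fin (rank K)) :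
    (logBasis K).repr (logEmbedding K (Additive.ofMul (unitsEquivTorsionProd K ζe))) i =
      ζe.2 i := by
  have h2 : logEmbedding K (Additive.ofMul (unitsEquivTorsionProd K ζe)) =
      ∑ i, (ζe.2 i : ℝ) • logBasis K i := by
    rw [unitsEquivTorsionProd_apply, ofMul_mul, map_add,
      (logEmbedding_eq_zero_iff (K := K)).mpr ζe.1.2, zero_add, ofMul_prod, map_sum]
    refine Finset.sum_congr rfl fun j _ => ?_
    rw [ofMul_zpow, map_zsmul, logBasis_apply, Int.cast_smul_eq_zsmul]
  rw [h2, Basis.repr_sum_self]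

/-- A unit translates the logarithmic coordinates by its integer exponents; its torsion part is
invisible. -/
theorem coneWeight_unit_mul {x : K} (hx : x ≠ 0) (ζe : torsion K × (Fin (rank K) → ℤ)) :
    coneWeight (mixedEmbedding K ((unitsEquivTorsionProd K ζe : (𝓞 K)ˣ) * x)) =
      ∏ i, tent ((logBasis K).repr (logMap (mixedEmbedding K x)) i + ζe.2 i) := by
  have hx' : mixedEmbedding.norm (mixedEmbedding K x) ≠ 0 := by
    simpa [norm_eq_norm] using hx
  rw [coneWeight]
  refine Finset.prod_congr rfl fun i _ => ?_
  have h := logMap_unit_smul (unitsEquivTorsionProd K ζe) hx'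
  rw [unitSMul_smul, ← map_mul] at h
  rw [h, map_add, Finsupp.add_apply, add_comm, repr_logEmbedding]

theorem hasSum_const_one_finite {T : Type*} [Finite T] :
    HasSum (fun _ : T => (1 : ℝ)) (Nat.card T : ℝ) := by
  have : Fintype T := Fintype.ofFinite _
  have := hasSum_fintype (fun _ : T => (1 : ℝ))
  simpa [Nat.card_eq_fintype_card] using this

theorem hasSum_comp_snd {T S : Type*} [Finite T] (f : S → ℝ) (hf : HasSum f 1)
    (hf0 : ∀ s, 0 ≤ f s) : HasSum (fun ζe : T × S => f ζe.2) (Nat.card T : ℝ) := by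
  have h4 : Summable fun ζe : T × S => (1 : ℝ) * f ζe.2 :=
    Summable.mul_of_nonneg (f := fun _ : T => (1 : ℝ)) hasSum_const_one_finite.summable hf.summable
      (fun _ => by simp) hf0
  have h3 := HasSum.mul hasSum_const_one_finite hf h4
  simpa only [one_mul, mul_one] using h3

/-- Integer translates of the product of tents sum to one, and each is met once for every root of
unity. -/
theorem hasSum_coneWeight_unit {x : K} (hx : x ≠ 0) :
    HasSum (fun u : (𝓞 K)ˣ => coneWeight (mixedEmbedding K (u * x))) (torsionOrder K : ℝ) := by
  obtain ⟨t, ht⟩ : ∃ t : Fin (rank K) → ℝ, ∀ ζe : torsion K × (Fin (rank K) → ℤ),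
      coneWeight (mixedEmbedding K ((unitsEquivTorsionProd K ζe : (𝓞 K)ˣ) * x)) =
        ∏ i, tent (t i + ζe.2 i) := ⟨_, coneWeight_unit_mul hx⟩
  refine (unitsEquivTorsionProd K).hasSum_iff.mp ?_
  have h := hasSum_comp_snd (T := torsion K) _ (hasSum_prod_tent t)
    fun _ => Finset.prod_nonneg fun _ _ => tent_nonneg _
  simp_rw [← ht] at h
  exact h

end NumberField

/-! ### Variation of the weighted zeta terms. -/

namespace NumberField

open mixedEmbedding NumberField.Units dirichletUnitTheorem InfinitePlace Module

open scoped Classical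

variable {K : Type*} [Field K] [NumberField K]

theorem abs_log_sub_log_le {a b η : ℝ} (ha : 0 < a) (hη : η ≤ 1 / 2) (h : |b - a| ≤ η * a) :
    |Real.log b - Real.log a| ≤ 2 * η := by
  have hη0 : 0 ≤ η := by
    by_contra h0
    have := (abs_nonneg _).trans h
    nlinarith
  have hb1 : (1 - η) * a ≤ b := by linarith [(abs_le.mp h).1]
  have hb2 : b ≤ (1 + η) * a := by linarith [(abs_le.mp h).2]
  have hb : 0 < b := lt_of_lt_of_le (by nlinarith) hb1
  rw [← Real.log_div hb.ne' ha.ne', abs_le]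
  constructor
  · have h1 := Real.one_sub_inv_le_log_of_pos (div_pos hb ha)
    rw [inv_div] at h1
    have : a / b ≤ 1 + 2 * η := by
      rw [div_le_iff₀ hb]
      nlinarith
    linarith
  · have h1 := Real.log_le_sub_one_of_pos (div_pos hb ha)
    have : b / a ≤ 1 + η := by rwa [div_le_iff₀ ha]
    linarith

theorem normAtPlace_le_norm (w : InfinitePlace K) (x : mixedSpace K) : normAtPlace w x ≤ ‖x‖ := by
  rw [norm_eq_sup'_normAtPlace]
  exact Finset.le_sup' (fun w => normAtPlace w x) (Finset.mem_univ w)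

theorem exists_normAtPlace_eq_norm (x : mixedSpace K) : ∃ w : InfinitePlace K,
    normAtPlace w x = ‖x‖ := by
  rw [norm_eq_sup'_normAtPlace]
  obtain ⟨w, -, hw⟩ := Finset.exists_mem_eq_sup' Finset.univ_nonempty fun w => normAtPlace w x
  exact ⟨w, hw.symm⟩

variable (K) in
-- On the support of the weight all archimedean absolute values are comparable, so the norm of a
-- point there is of the order of the `d`-th power of its length, `d` being the degree.
theorem exists_norm_le_mul_normAtPlace :
    ∃ ρ : ℝ, 1 ≤ ρ ∧ ∀ x : mixedSpace K, mixedEmbedding.norm x ≠ 0 → coneWeight x ≠ 0 →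
      ∀ w, ‖x‖ ≤ ρ * normAtPlace w x := by
  obtain ⟨R, hR, h⟩ := exists_abs_log_normAtPlace_le K
  refine ⟨Real.exp (2 * R), Real.one_le_exp (by positivity), fun x hx hc w => ?_⟩
  obtain ⟨v, hv⟩ := exists_normAtPlace_eq_norm x
  have hpos : ∀ w : InfinitePlace K, 0 < normAtPlace w x := fun w =>
    lt_of_le_of_ne (normAtPlace_nonneg w x) (mixedEmbedding.norm_ne_zero_iff.mp hx w).symm
  rw [← hv, ← Real.log_le_log_iff (hpos v) (mul_pos (Real.exp_pos _) (hpos w)),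
    Real.log_mul (Real.exp_pos _).ne' (hpos w).ne', Real.log_exp]
  have h1 := abs_le.mp (h x hx hc v)
  have h2 := abs_le.mp (h x hx hc w)
  linarith

theorem abs_log_norm_sub_le {x y : mixedSpace K} {δ : ℝ} (hx : mixedEmbedding.norm x ≠ 0)
    (hy : mixedEmbedding.norm y ≠ 0)
    (h : ∀ w, |Real.log (normAtPlace w x) - Real.log (normAtPlace w y)| ≤ δ) :
    |Real.log (mixedEmbedding.norm x) - Real.log (mixedEmbedding.norm y)| ≤ finrank ℚ K * δ := by
  rw [← sum_mult_log_normAtPlace hx, ← sum_mult_log_normAtPlace hy, ← Finset.sum_sub_distrib]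
  refine (Finset.abs_sum_le_sum_abs _ _).trans ?_
  rw [← sum_mult_eq (K := K), Nat.cast_sum, Finset.sum_mul]
  refine Finset.sum_le_sum fun w _ => ?_
  rw [← mul_sub, abs_mul, Nat.abs_cast]
  exact mul_le_mul_of_nonneg_left (h w) (Nat.cast_nonneg _)

theorem norm_logMap_sub_le {x y : mixedSpace K} {δ : ℝ} (hx : mixedEmbedding.norm x ≠ 0)
    (hy : mixedEmbedding.norm y ≠ 0)
    (h : ∀ w, |Real.log (normAtPlace w x) - Real.log (normAtPlace w y)| ≤ δ) :
    ‖logMap x - logMap y‖ ≤ 4 * δ := by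
  have hδ : 0 ≤ δ := (abs_nonneg _).trans (h w₀)
  rw [pi_norm_le_iff_of_nonneg (by positivity)]
  intro w
  have h1 := abs_log_norm_sub_le hx hy h
  have hd : (0 : ℝ) < finrank ℚ K := Nat.cast_pos.mpr finrank_pos
  have h2 : |(Real.log (mixedEmbedding.norm x) - Real.log (mixedEmbedding.norm y)) *
      (finrank ℚ K : ℝ)⁻¹| ≤ δ := by
    rw [abs_mul, abs_of_pos (inv_pos.mpr hd), ← div_eq_mul_inv, div_le_iff₀ hd, mul_comm]
    exact h1
  have hm : (mult w.1 : ℝ) ≤ 2 := by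
    rw [mult]; split_ifs <;> norm_num
  rw [Pi.sub_apply, logMap_apply, logMap_apply, Real.norm_eq_abs, ← mul_sub, abs_mul,
    Nat.abs_cast]
  have h3 := h w.1
  have h4 : |Real.log (normAtPlace w.1 x) - Real.log (mixedEmbedding.norm x) *
      (finrank ℚ K : ℝ)⁻¹ - (Real.log (normAtPlace w.1 y) - Real.log (mixedEmbedding.norm y) *
      (finrank ℚ K : ℝ)⁻¹)| ≤ 2 * δ := by
    rw [abs_le] at h2 h3 ⊢
    constructor <;> linarith
  calc _ ≤ 2 * (2 * δ) := mul_le_mul hm h4 (abs_nonneg _) (by norm_num)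
    _ = _ := by ring

theorem abs_rpow_neg_sub_rpow_neg_le {a b s m : ℝ} (ha : 0 < a) (hb : 0 < b) (hs : 0 ≤ s)
    (hma : a ^ (-s) ≤ m) (hmb : b ^ (-s) ≤ m) :
    |a ^ (-s) - b ^ (-s)| ≤ s * |Real.log a - Real.log b| * m := by
  wlog hab : b ^ (-s) ≤ a ^ (-s) generalizing a b
  · rw [abs_sub_comm, abs_sub_comm (Real.log a)]
    exact this hb ha hmb hma (not_le.mp hab).le
  rw [abs_of_nonneg (sub_nonneg.mpr hab)]
  have h0 : 0 < a ^ (-s) := Real.rpow_pos_of_pos ha _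
  have e : b ^ (-s) = a ^ (-s) * Real.exp (s * (Real.log a - Real.log b)) := by
    rw [Real.rpow_def_of_pos hb, Real.rpow_def_of_pos ha, ← Real.exp_add]
    ring_nf
  have h1 := Real.add_one_le_exp (s * (Real.log a - Real.log b))
  calc a ^ (-s) - b ^ (-s) = a ^ (-s) * (1 - Real.exp (s * (Real.log a - Real.log b))) := by
        rw [e]; ring
    _ ≤ a ^ (-s) * (s * |Real.log a - Real.log b|) := by
        refine mul_le_mul_of_nonneg_left ?_ h0.le
        have := mul_le_mul_of_nonneg_left (neg_le_abs (Real.log a - Real.log b)) hs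
        linarith
    _ ≤ m * (s * |Real.log a - Real.log b|) :=
        mul_le_mul_of_nonneg_right hma (by positivity)
    _ = _ := by ring

/-- The term of the weighted zeta series attached to a point of the mixed space. -/
noncomputable def coneTerm (s : ℝ) (x : mixedSpace K) : ℝ :=
  coneWeight x * mixedEmbedding.norm x ^ (-s)

theorem coneTerm_nonneg (s : ℝ) (x : mixedSpace K) : 0 ≤ coneTerm s x :=
  mul_nonneg (coneWeight_nonneg x) (Real.rpow_nonneg (mixedEmbedding.norm_nonneg x) _)

theorem pow_finrank_le_norm {x : mixedSpace K} {c : ℝ} (hc : 0 ≤ c)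
    (h : ∀ w, c ≤ normAtPlace w x) : c ^ finrank ℚ K ≤ mixedEmbedding.norm x := by
  rw [mixedEmbedding.norm_apply, ← sum_mult_eq (K := K), ← Finset.prod_pow_eq_pow_sum]
  exact Finset.prod_le_prod (fun w _ => pow_nonneg hc _) fun w _ => pow_le_pow_left₀ hc (h w) _

theorem rpow_neg_le_inv {N c s : ℝ} (hc : 0 < c) (h : c ≤ N) (hN : 1 ≤ N) (hs : 1 ≤ s) :
    N ^ (-s) ≤ c⁻¹ := by
  refine (Real.rpow_le_rpow_of_exponent_le hN (neg_le_neg hs)).trans ?_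
  rw [Real.rpow_neg_one]
  exact inv_anti₀ hc h

variable (K) in
-- A displacement `Λ` at distance `r` changes every absolute value by a relative amount O(Λ/r). The
-- weight and the logarithm of the norm are Lipschitz in the logarithms, and the term itself is
-- O(r^(-d)), which gives one extra power of `r⁻¹`. The lower bound 1 for the norms gives `N ^ (-s)
-- ≤ N⁻¹`, so the constant is uniform in `s ∈ [1, 2]`. The slack in `r ≤ 2 * ‖x‖` allows either of
-- two neighbouring points to play the role of `x`.
theorem exists_abs_coneTerm_sub_le :
    ∃ ρ C : ℝ, 1 ≤ ρ ∧ 0 ≤ C ∧ ∀ (x y : mixedSpace K) (r Λ s : ℝ), 1 ≤ s → s ≤ 2 →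
      1 ≤ mixedEmbedding.norm x → (mixedEmbedding.norm y ≠ 0 → 1 ≤ mixedEmbedding.norm y) →
      coneWeight x ≠ 0 → 0 < r → r ≤ 2 * ‖x‖ → 4 * ρ * Λ ≤ r → 0 ≤ Λ →
      (∀ w, |normAtPlace w y - normAtPlace w x| ≤ Λ) →
      |coneTerm s x - coneTerm s y| ≤ C * Λ * r⁻¹ ^ (finrank ℚ K + 1) := by
  classical
  obtain ⟨ρ, hρ, h⟩ := exists_norm_le_mul_normAtPlace K
  obtain ⟨D, hD, hH⟩ := exists_abs_coneWeight_sub_le K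
  have hρ0 : 0 < ρ := by linarith
  refine ⟨ρ, (8 * D + 4 * finrank ℚ K) * (2 * ρ) * (4 * ρ) ^ finrank ℚ K, hρ, by positivity,
    fun x y r Λ s hs1 hs2 hNx hNy hcx hr hrx hrΛ hΛ hw => ?_⟩
  have hNx0 : mixedEmbedding.norm x ≠ 0 := by linarith
  have hxw : ∀ w, r / (2 * ρ) ≤ normAtPlace w x := fun w => by
    have := h x hNx0 hcx w
    rw [div_le_iff₀ (by positivity)]
    nlinarith
  -- The relative displacement at every place. It is at most one half, so the absolute values of `y`
  -- stay away from zero.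
  set η : ℝ := 2 * ρ * Λ / r with hη
  have hη2 : η ≤ 1 / 2 := by
    rw [hη, div_le_iff₀ hr]; linarith
  have hη0 : 0 ≤ η := by positivity
  have hxpos : ∀ w, 0 < normAtPlace w x := fun w => lt_of_lt_of_le (by positivity) (hxw w)
  have hΛη : ∀ w, Λ ≤ η * normAtPlace w x := fun w => by
    refine le_trans (le_of_eq ?_) (mul_le_mul_of_nonneg_left (hxw w) hη0)
    rw [hη]; field_simp
  have hlog : ∀ w, |Real.log (normAtPlace w x) - Real.log (normAtPlace w y)| ≤ 2 * η := fun w => by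
    rw [abs_sub_comm]
    exact abs_log_sub_log_le (hxpos w) hη2 ((hw w).trans (hΛη w))
  have hyw : ∀ w, r / (4 * ρ) ≤ normAtPlace w y := fun w => by
    have h1 := (abs_le.mp ((hw w).trans (hΛη w))).1
    have h2 : η * normAtPlace w x ≤ 1 / 2 * normAtPlace w x :=
      mul_le_mul_of_nonneg_right hη2 (hxpos w).le
    have h3 := hxw w
    have : r / (4 * ρ) = 1 / 2 * (r / (2 * ρ)) := by field_simp; norm_num
    rw [this]; linarith
  have hxw' : ∀ w, r / (4 * ρ) ≤ normAtPlace w x := fun w => by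
    refine le_trans ?_ (hxw w)
    gcongr; norm_num
  have hc0 : 0 < r / (4 * ρ) := by positivity
  have hNyc := pow_finrank_le_norm hc0.le hyw
  have hNxc := pow_finrank_le_norm hc0.le hxw'
  have hNy0 : mixedEmbedding.norm y ≠ 0 := (lt_of_lt_of_le (by positivity) hNyc).ne'
  have hNy1 := hNy hNy0
  set m : ℝ := ((r / (4 * ρ)) ^ finrank ℚ K)⁻¹ with hm
  have hm0 : 0 < m := by positivity
  have hmx := rpow_neg_le_inv (by positivity) hNxc hNx hs1
  have hmy := rpow_neg_le_inv (by positivity) hNyc hNy1 hs1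
  have e : coneTerm s x - coneTerm s y = (coneWeight x - coneWeight y) *
      mixedEmbedding.norm x ^ (-s) + coneWeight y * (mixedEmbedding.norm x ^ (-s) -
        mixedEmbedding.norm y ^ (-s)) := by
    rw [coneTerm, coneTerm]; ring
  have h1 : |coneWeight x - coneWeight y| ≤ 8 * D * η := by
    refine (hH x y).trans ?_
    have := mul_le_mul_of_nonneg_left (norm_logMap_sub_le hNx0 hNy0 hlog) hD
    linarith
  have h2 : |mixedEmbedding.norm x ^ (-s) - mixedEmbedding.norm y ^ (-s)| ≤
      4 * finrank ℚ K * η * m := by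
    refine (abs_rpow_neg_sub_rpow_neg_le (by linarith) (by linarith) (by linarith) hmx hmy).trans ?_
    refine mul_le_mul_of_nonneg_right ?_ hm0.le
    have := abs_log_norm_sub_le hNx0 hNy0 hlog
    calc _ ≤ 2 * (finrank ℚ K * (2 * η)) := mul_le_mul hs2 this (abs_nonneg _) (by norm_num)
      _ = _ := by ring
  have hbound : |coneTerm s x - coneTerm s y| ≤ 8 * D * η * m + 4 * finrank ℚ K * η * m := by
    rw [e]
    refine (abs_add_le _ _).trans (add_le_add ?_ ?_)
    · rw [abs_mul]
      refine mul_le_mul h1 ?_ (abs_nonneg _) (by positivity)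
      rwa [abs_of_nonneg (Real.rpow_nonneg (by linarith) _)]
    · rw [abs_mul, abs_of_nonneg (coneWeight_nonneg y)]
      exact (mul_le_of_le_one_left (abs_nonneg _) (coneWeight_le_one y)).trans h2
  refine hbound.trans (le_of_eq ?_)
  rw [hm, hη, pow_succ, div_pow, inv_div, inv_pow]
  field_simp

/-! ### Summation over the ring of integers -/

theorem norm_mixedEmbedding_coe (α : 𝓞 K) :
    mixedEmbedding.norm (mixedEmbedding K (α : K)) = Ideal.absNorm (Ideal.span {α}) := by
  rw [norm_eq_norm, Ideal.absNorm_span_singleton, ← Algebra.coe_norm_int, Nat.cast_natAbs]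
  push_cast
  rfl

theorem one_le_norm_mixedEmbedding {α : 𝓞 K} (h : α ≠ 0) :
    1 ≤ mixedEmbedding.norm (mixedEmbedding K (α : K)) := by
  rw [norm_mixedEmbedding_coe]
  have : Ideal.absNorm (Ideal.span {α}) ≠ 0 := by
    rw [Ne, Ideal.absNorm_eq_zero_iff, Ideal.span_singleton_eq_bot]
    exact h
  exact_mod_cast Nat.one_le_iff_ne_zero.mpr this

variable (K) in
/-- The ring of integers as a lattice of the mixed space. -/
noncomputable def ringOfIntegersEquivLattice : 𝓞 K ≃ mixedEmbedding.integerLattice K :=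
  (LinearEquiv.ofInjective ((mixedEmbedding K).comp (algebraMap (𝓞 K) K)).toIntAlgHom.toLinearMap
    (fun _ _ h => RingOfIntegers.ext (mixedEmbedding_injective K h))).toEquiv

variable (K) in
theorem summable_norm_rpow_ringOfIntegers {r : ℝ} (hr : r < -finrank ℚ K) :
    Summable fun α : 𝓞 K => ‖mixedEmbedding K (α : K)‖ ^ r := by
  have h := ZLattice.summable_norm_rpow (mixedEmbedding.integerLattice K) r (by
    rwa [ZLattice.rank ℝ, mixedEmbedding.finrank])
  exact (ringOfIntegersEquivLattice K).summable_iff.mpr h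
end NumberField

namespace NumberField

open mixedEmbedding NumberField.Units dirichletUnitTheorem InfinitePlace Module

open scoped Classical

variable {K : Type*} [Field K] [NumberField K]

theorem coneTerm_zero {s : ℝ} (hs : s ≠ 0) : coneTerm s (0 : mixedSpace K) = 0 := by
  rw [coneTerm, map_zero, Real.zero_rpow (neg_ne_zero.mpr hs), mul_zero]

theorem mixedEmbedding_coe_zero : mixedEmbedding K ((0 : 𝓞 K) : K) = 0 :=
  map_zero ((mixedEmbedding K).comp (algebraMap (𝓞 K) K))

theorem mixedEmbedding_coe_add (α β : 𝓞 K) : mixedEmbedding K ((α + β : 𝓞 K) : K) =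
    mixedEmbedding K (α : K) + mixedEmbedding K (β : K) :=
  map_add ((mixedEmbedding K).comp (algebraMap (𝓞 K) K)) α β

theorem coneTerm_le_one {s : ℝ} (hs : 0 < s) (α : 𝓞 K) :
    coneTerm s (mixedEmbedding K (α : K)) ≤ 1 := by
  by_cases h : α = 0
  · subst h
    rw [mixedEmbedding_coe_zero, coneTerm_zero hs.ne']
    exact zero_le_one
  · refine mul_le_one₀ (coneWeight_le_one _) (Real.rpow_nonneg (mixedEmbedding.norm_nonneg _) _) ?_
    exact Real.rpow_le_one_of_one_le_of_nonpos (one_le_norm_mixedEmbedding h) (by linarith)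

theorem norm_ne_zero_imp_one_le (α : 𝓞 K)
    (h : mixedEmbedding.norm (mixedEmbedding K (α : K)) ≠ 0) :
    1 ≤ mixedEmbedding.norm (mixedEmbedding K (α : K)) := by
  refine one_le_norm_mixedEmbedding fun h0 => h ?_
  rw [h0, mixedEmbedding_coe_zero, map_zero]

theorem abs_normAtPlace_sub_le (w : InfinitePlace K) (x y : mixedSpace K) :
    |normAtPlace w y - normAtPlace w x| ≤ ‖y - x‖ := by
  rw [abs_le]
  have h1 := normAtPlace_add_le w (y - x) x
  have h2 := normAtPlace_add_le w (x - y) y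
  rw [sub_add_cancel] at h1 h2
  have h3 := normAtPlace_le_norm w (y - x)
  have h4 := normAtPlace_le_norm w (x - y)
  rw [norm_sub_rev] at h4
  constructor <;> linarith

/-- The comparison of neighbouring terms wants one of the two points in the support of the weight;
if neither is, both terms vanish. -/
theorem exists_coneTerm_add_sub_le (l : 𝓞 K) :
    ∃ T C : ℝ, 0 < T ∧ 0 ≤ C ∧ ∀ s : ℝ, 1 ≤ s → s ≤ 2 → ∀ α : 𝓞 K,
      T ≤ ‖mixedEmbedding K (α : K)‖ →
      |coneTerm s (mixedEmbedding K ((α + l : 𝓞 K) : K)) - coneTerm s (mixedEmbedding K (α : K))| ≤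
        C * ‖mixedEmbedding K (α : K)‖⁻¹ ^ (finrank ℚ K + 1) := by
  obtain ⟨ρ, C, hρ, hC, h⟩ := exists_abs_coneTerm_sub_le K
  set Λ : ℝ := ‖mixedEmbedding K (l : K)‖ with hΛ
  have hΛ0 : 0 ≤ Λ := norm_nonneg _
  refine ⟨4 * ρ * Λ + 1, C * Λ, by positivity, by positivity, fun s hs1 hs2 α hα => ?_⟩
  set a := mixedEmbedding K (α : K) with ha
  set b := mixedEmbedding K ((α + l : 𝓞 K) : K) with hb
  have hba : b = a + mixedEmbedding K (l : K) := mixedEmbedding_coe_add α l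
  have hΛr : 4 * ρ * Λ ≤ ‖a‖ := by linarith
  have h0 : 0 < ‖a‖ := by nlinarith [mul_nonneg (by linarith : (0 : ℝ) ≤ ρ) hΛ0]
  have hw : ∀ w, |normAtPlace w b - normAtPlace w a| ≤ Λ := fun w => by
    refine (abs_normAtPlace_sub_le w a b).trans_eq ?_
    rw [hba, add_sub_cancel_left]
  have hw' : ∀ w, |normAtPlace w a - normAtPlace w b| ≤ Λ := fun w => by
    rw [abs_sub_comm]; exact hw w
  have hNb : mixedEmbedding.norm b ≠ 0 → 1 ≤ mixedEmbedding.norm b :=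
    norm_ne_zero_imp_one_le (α + l)
  have hNa : mixedEmbedding.norm a ≠ 0 → 1 ≤ mixedEmbedding.norm a :=
    norm_ne_zero_imp_one_le α
  have hbn : ‖a‖ ≤ 2 * ‖b‖ := by
    have h1 : ‖a‖ ≤ ‖b‖ + Λ := by
      have : a = b - mixedEmbedding K (l : K) := by rw [hba, add_sub_cancel_right]
      rw [this]; exact norm_sub_le _ _
    have : Λ ≤ ρ * Λ := le_mul_of_one_le_left hΛ0 hρ
    linarith
  have hs0 : -s ≠ 0 := by linarith
  have hz : ∀ x : mixedSpace K, ¬(mixedEmbedding.norm x ≠ 0 ∧ coneWeight x ≠ 0) →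
      coneTerm s x = 0 := fun x hx => by
    rw [not_and_or, not_not, not_not] at hx
    rcases hx with hx | hx
    · rw [coneTerm, hx, Real.zero_rpow hs0, mul_zero]
    · rw [coneTerm, hx, zero_mul]
  by_cases hA : mixedEmbedding.norm a ≠ 0 ∧ coneWeight a ≠ 0
  · rw [abs_sub_comm]
    exact h a b ‖a‖ Λ s hs1 hs2 (hNa hA.1) hNb hA.2 h0 (by linarith) hΛr hΛ0 hw
  · by_cases hB : mixedEmbedding.norm b ≠ 0 ∧ coneWeight b ≠ 0
    · exact h b a ‖a‖ Λ s hs1 hs2 (hNb hB.1) hNa hB.2 h0 hbn hΛr hΛ0 hw'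
    · rw [hz a hA, hz b hB, sub_zero, abs_zero]
      positivity

/-- The exponent `d + 1` exceeds the rank of the lattice, so the majorant is summable, and it does
not depend on `s`. -/
theorem exists_summable_coneTerm_add_sub_le (l : 𝓞 K) :
    ∃ B : 𝓞 K → ℝ, Summable B ∧ ∀ s : ℝ, 1 ≤ s → s ≤ 2 → ∀ α : 𝓞 K,
      |coneTerm s (mixedEmbedding K ((α + l : 𝓞 K) : K)) - coneTerm s (mixedEmbedding K (α : K))| ≤
        B α := by
  obtain ⟨T, C, hT, hC, h⟩ := exists_coneTerm_add_sub_le l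
  set d := finrank ℚ K
  have hsum : Summable fun α : 𝓞 K => ‖mixedEmbedding K (α : K)‖⁻¹ ^ (d + 1) := by
    refine (summable_norm_rpow_ringOfIntegers K (r := -((d + 1 : ℕ) : ℝ)) ?_).congr fun α => ?_
    · push_cast; linarith
    · rw [Real.rpow_neg (norm_nonneg _), Real.rpow_natCast, inv_pow]
  -- `T ^ (d + 1)` takes care of the nonzero short vectors, where the difference is at most 1. The
  -- last summand takes care of `0`, where the inverse length has the default value `0`.
  refine ⟨fun α => (C + T ^ (d + 1)) * ‖mixedEmbedding K (α : K)‖⁻¹ ^ (d + 1) +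
    if α = 0 then 1 else 0, (hsum.mul_left _).add (summable_of_ne_finset_zero (s := {0})
      fun α hα => if_neg (by simpa using hα)), fun s hs1 hs2 α => ?_⟩
  have hpos : 0 ≤ ‖mixedEmbedding K (α : K)‖⁻¹ ^ (d + 1) := by positivity
  by_cases hα : T ≤ ‖mixedEmbedding K (α : K)‖
  · refine (h s hs1 hs2 α hα).trans ?_
    have h1 : (0 : ℝ) ≤ if α = 0 then 1 else 0 := by split_ifs <;> norm_num
    have h2 : 0 ≤ T ^ (d + 1) * ‖mixedEmbedding K (α : K)‖⁻¹ ^ (d + 1) := by positivity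
    linarith
  · have h1 : |coneTerm s (mixedEmbedding K ((α + l : 𝓞 K) : K)) -
        coneTerm s (mixedEmbedding K (α : K))| ≤ 1 := by
      have := coneTerm_le_one (by linarith : 0 < s) (α + l)
      have := coneTerm_le_one (by linarith : 0 < s) α
      have := coneTerm_nonneg s (mixedEmbedding K ((α + l : 𝓞 K) : K))
      have := coneTerm_nonneg s (mixedEmbedding K (α : K))
      rw [abs_le]; constructor <;> linarith
    refine h1.trans ?_
    beta_reduce
    by_cases h0 : α = 0
    · rw [if_pos h0]
      have : 0 ≤ (C + T ^ (d + 1)) * ‖mixedEmbedding K (α : K)‖⁻¹ ^ (d + 1) := by positivity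
      linarith
    · rw [if_neg h0, add_zero]
      have hn : 0 < ‖mixedEmbedding K (α : K)‖ := by
        rw [norm_pos_iff]
        simpa using h0
      have h2 : 1 ≤ T ^ (d + 1) * ‖mixedEmbedding K (α : K)‖⁻¹ ^ (d + 1) := by
        rw [← mul_pow]
        refine one_le_pow₀ ?_
        rw [← div_eq_mul_inv, one_le_div hn]
        exact (not_le.mp hα).le
      have h3 : 0 ≤ C * ‖mixedEmbedding K (α : K)‖⁻¹ ^ (d + 1) := by positivity
      linarith

theorem summable_coneTerm {s : ℝ} (hs : 1 < s) :
    Summable fun α : 𝓞 K => coneTerm s (mixedEmbedding K (α : K)) := by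
  obtain ⟨ρ, hρ, h⟩ := exists_norm_le_mul_normAtPlace K
  have hd : (0 : ℝ) < finrank ℚ K := Nat.cast_pos.mpr finrank_pos
  have h1 := summable_norm_rpow_ringOfIntegers K (r := -(finrank ℚ K * s)) (by nlinarith)
  refine (h1.mul_left (ρ ^ (finrank ℚ K * s))).of_nonneg_of_le (fun α => coneTerm_nonneg _ _)
    fun α => ?_
  set x := mixedEmbedding K (α : K)
  by_cases h0 : mixedEmbedding.norm x = 0
  · rw [coneTerm, h0, Real.zero_rpow (by linarith), mul_zero]
    positivity
  by_cases hc : coneWeight x = 0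
  · rw [coneTerm, hc, zero_mul]
    positivity
  have hx : 0 < ‖x‖ := by
    rw [norm_pos_iff]
    rintro hx
    rw [hx, map_zero] at h0
    exact h0 rfl
  have hρ0 : 0 < ρ := by linarith
  have h2 : (‖x‖ / ρ) ^ finrank ℚ K ≤ mixedEmbedding.norm x :=
    pow_finrank_le_norm (by positivity) fun w => by
      rw [div_le_iff₀ hρ0, mul_comm]
      exact h x h0 hc w
  refine (mul_le_of_le_one_left (Real.rpow_nonneg (mixedEmbedding.norm_nonneg _) _)
    (coneWeight_le_one _)).trans ?_
  refine (Real.rpow_le_rpow_of_nonpos (by positivity) h2 (by linarith)).trans_eq ?_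
  rw [← Real.rpow_natCast, ← Real.rpow_mul (by positivity), Real.div_rpow hx.le hρ0.le,
    mul_neg, Real.rpow_neg hρ0.le, div_inv_eq_mul, mul_comm]

/-! ### Sums with periodic coefficients -/

/-- An integer is determined by its class modulo `M` and a multiple of `M`. -/
noncomputable def quotientProdEquiv {M : 𝓞 K} (hM : M ≠ 0) :
    (𝓞 K ⧸ Ideal.span {M}) × 𝓞 K ≃ 𝓞 K :=
  Equiv.ofBijective (fun x => M * x.2 + Quotient.out x.1) <| by
    have hmk : ∀ x : (𝓞 K ⧸ Ideal.span {M}) × 𝓞 K,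
        Ideal.Quotient.mk (Ideal.span {M}) (M * x.2 + Quotient.out x.1) = x.1 := fun x => by
      rw [map_add, Ideal.Quotient.eq_zero_iff_mem.mpr
        (Ideal.mul_mem_right _ _ (Ideal.mem_span_singleton_self M)), zero_add]
      exact Quotient.out_eq' x.1
    constructor
    · intro x y hxy
      have h1 : x.1 = y.1 := by rw [← hmk x, ← hmk y]; exact congrArg _ hxy
      refine Prod.ext h1 ?_
      simp only [h1, add_left_inj] at hxy
      exact mul_left_cancel₀ hM hxy
    · intro a
      have : a - Quotient.out (Ideal.Quotient.mk (Ideal.span {M}) a) ∈ Ideal.span {M} := by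
        rw [← Ideal.Quotient.eq_zero_iff_mem, map_sub, sub_eq_zero]
        exact (Quotient.out_eq' (Ideal.Quotient.mk (Ideal.span {M}) a)).symm
      obtain ⟨b, hb⟩ := Ideal.mem_span_singleton'.mp this
      refine ⟨(Ideal.Quotient.mk (Ideal.span {M}) a, b), ?_⟩
      simp only
      rw [mul_comm, hb, sub_add_cancel]

theorem quotientProdEquiv_apply {M : 𝓞 K} (hM : M ≠ 0) (x : (𝓞 K ⧸ Ideal.span {M}) × 𝓞 K) :
    quotientProdEquiv hM x = M * x.2 + Quotient.out x.1 := rfl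

/-- A weighted zeta sum whose coefficients are periodic and sum to zero over a period stays bounded
near `s = 1`. -/
theorem exists_norm_tsum_coneTerm_le {M : 𝓞 K} (hM : M ≠ 0) (c : 𝓞 K ⧸ Ideal.span {M} → ℂ)
    [Fintype (𝓞 K ⧸ Ideal.span {M})] (hc : ∑ x, c x = 0) :
    ∃ B : ℝ, ∀ s : ℝ, 1 < s → s ≤ 2 →
      ‖∑' α : 𝓞 K, c (Ideal.Quotient.mk _ α) * coneTerm s (mixedEmbedding K (α : K))‖ ≤ B := by
  choose B hB hBle using fun x : 𝓞 K ⧸ Ideal.span {M} =>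
    exists_summable_coneTerm_add_sub_le (Quotient.out x : 𝓞 K)
  have hinj : Function.Injective fun β : 𝓞 K => M * β := mul_right_injective₀ hM
  refine ⟨∑ x, ‖c x‖ * ∑' β : 𝓞 K, B x (M * β), fun s hs1 hs2 => ?_⟩
  have hS := summable_coneTerm (K := K) hs1
  have hsc : Summable fun α : 𝓞 K => c (Ideal.Quotient.mk _ α) *
      (coneTerm s (mixedEmbedding K (α : K)) : ℂ) := by
    obtain ⟨A, hA⟩ := (Set.finite_range fun x => ‖c x‖).bddAbove
    refine Summable.of_norm_bounded (hS.mul_left A) fun α => ?_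
    rw [norm_mul, Complex.norm_real, Real.norm_of_nonneg (coneTerm_nonneg _ _)]
    exact mul_le_mul_of_nonneg_right (hA ⟨_, rfl⟩) (coneTerm_nonneg _ _)
  have hmk : ∀ x : (𝓞 K ⧸ Ideal.span {M}) × 𝓞 K,
      Ideal.Quotient.mk (Ideal.span {M}) (M * x.2 + Quotient.out x.1) = x.1 := fun x => by
    rw [map_add, Ideal.Quotient.eq_zero_iff_mem.mpr
      (Ideal.mul_mem_right _ _ (Ideal.mem_span_singleton_self M)), zero_add]
    exact Quotient.out_eq' x.1
  rw [← (quotientProdEquiv hM).tsum_eq]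
  have hs' := (quotientProdEquiv hM).summable_iff.mpr hsc
  simp only [quotientProdEquiv_apply, Function.comp_def, hmk] at hs' ⊢
  rw [hs'.tsum_prod, tsum_fintype]
  have h1 : ∀ x : 𝓞 K ⧸ Ideal.span {M}, Summable fun β : 𝓞 K =>
      (coneTerm s (mixedEmbedding K ((M * β + Quotient.out x : 𝓞 K) : K)) : ℂ) := fun x => by
    refine Complex.ofRealCLM.summable (f := fun β : 𝓞 K =>
      coneTerm s (mixedEmbedding K ((M * β + Quotient.out x : 𝓞 K) : K))) ?_
    exact hS.comp_injective ((add_left_injective (Quotient.out x : 𝓞 K)).comp hinj)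
  have h0 : Summable fun β : 𝓞 K => (coneTerm s (mixedEmbedding K ((M * β : 𝓞 K) : K)) : ℂ) :=
    Complex.ofRealCLM.summable (f := fun β : 𝓞 K =>
      coneTerm s (mixedEmbedding K ((M * β : 𝓞 K) : K))) (hS.comp_injective hinj)
  -- As the coefficients sum to zero, the sum over the multiples of `M` may be subtracted in every
  -- residue class. What is left are differences under a shift by a fixed representative.
  have h2 : ∑ x, ∑' β : 𝓞 K, c x *
      (coneTerm s (mixedEmbedding K ((M * β + Quotient.out x : 𝓞 K) : K)) : ℂ) =
      ∑ x, c x * ∑' β : 𝓞 K, ((coneTerm s (mixedEmbedding K ((M * β + Quotient.out x : 𝓞 K) : K))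
        - coneTerm s (mixedEmbedding K ((M * β : 𝓞 K) : K)) : ℝ) : ℂ) := by
    rw [← sub_zero (∑ x, ∑' β : 𝓞 K, _), ← zero_mul (∑' β : 𝓞 K,
      (coneTerm s (mixedEmbedding K ((M * β : 𝓞 K) : K)) : ℂ)), ← hc, Finset.sum_mul,
      ← Finset.sum_sub_distrib]
    refine Finset.sum_congr rfl fun x _ => ?_
    rw [tsum_mul_left, ← mul_sub, ← (h1 x).tsum_sub h0]
    simp only [Complex.ofReal_sub]
  rw [h2]
  refine norm_sum_le_of_le _ fun x _ => ?_
  rw [norm_mul]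
  refine mul_le_mul_of_nonneg_left ?_ (norm_nonneg _)
  refine tsum_of_norm_bounded ((hB x).comp_injective hinj).hasSum fun β => ?_
  rw [Complex.norm_real]
  exact hBle x s hs1.le hs2 (M * β)

end NumberField

namespace NumberField

open mixedEmbedding NumberField.Units dirichletUnitTheorem InfinitePlace Module

variable {K : Type*} [Field K] [NumberField K]

/-! ### Sums over the ideals of a class -/

theorem hasSum_iff_of_forall_eq {ι : Type*} {E : Type*} [AddCommMonoid E] [TopologicalSpace E]
    {f g : ι → E} {a : E} (h : ∀ x, f x = g x) : HasSum f a ↔ HasSum g a := by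
  rw [funext h]

/-- The ideals in the class inverse to that of `J` correspond to the nonzero elements of `J` up to
units. -/
theorem exists_ideal_mul_eq_span {J : (Ideal (𝓞 K))⁰} {C : ClassGroup (𝓞 K)}
    (hJ : ClassGroup.mk0 J = C⁻¹) (α : 𝓞 K) (h0 : α ≠ 0) (hα : α ∈ J.1) :
    ∃ I : {I : (Ideal (𝓞 K))⁰ // ClassGroup.mk0 I = C}, I.1.1 * J.1 = Ideal.span {α} := by
  obtain ⟨I, hI⟩ := Ideal.dvd_span_singleton.mpr hα
  have hI0 : I ≠ 0 := by
    rintro rfl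
    rw [mul_zero, Submodule.zero_eq_bot, Ideal.span_singleton_eq_bot] at hI
    exact h0 hI
  let I' : (Ideal (𝓞 K))⁰ := ⟨I, mem_nonZeroDivisors_of_ne_zero hI0⟩
  refine ⟨⟨I', ?_⟩, by rw [mul_comm]; exact hI.symm⟩
  have h1 : ClassGroup.mk0 (I' * J) = 1 := by
    rw [ClassGroup.mk0_eq_one_iff (I' * J).2]
    exact ⟨⟨α, by rw [mul_comm] at hI; exact hI.symm⟩⟩
  rw [map_mul, hJ, mul_inv_eq_one] at h1
  exact h1

/-- The ideal `I` with `I * J = (α)`. -/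
noncomputable def idealOfMem {J : (Ideal (𝓞 K))⁰} {C : ClassGroup (𝓞 K)}
    (hJ : ClassGroup.mk0 J = C⁻¹) (α : {α : 𝓞 K // α ≠ 0 ∧ α ∈ J.1}) :
    {I : (Ideal (𝓞 K))⁰ // ClassGroup.mk0 I = C} :=
  (exists_ideal_mul_eq_span hJ α.1 α.2.1 α.2.2).choose

theorem idealOfMem_mul {J : (Ideal (𝓞 K))⁰} {C : ClassGroup (𝓞 K)}
    (hJ : ClassGroup.mk0 J = C⁻¹) (α : {α : 𝓞 K // α ≠ 0 ∧ α ∈ J.1}) :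
    (idealOfMem hJ α).1.1 * J.1 = Ideal.span {α.1} :=
  (exists_ideal_mul_eq_span hJ α.1 α.2.1 α.2.2).choose_spec

theorem idealOfMem_eq_iff {J : (Ideal (𝓞 K))⁰} {C : ClassGroup (𝓞 K)}
    (hJ : ClassGroup.mk0 J = C⁻¹) (α : {α : 𝓞 K // α ≠ 0 ∧ α ∈ J.1})
    (I : {I : (Ideal (𝓞 K))⁰ // ClassGroup.mk0 I = C}) :
    idealOfMem hJ α = I ↔ I.1.1 * J.1 = Ideal.span {α.1} := by
  rw [← idealOfMem_mul hJ α, mul_left_inj' (nonZeroDivisors.coe_ne_zero J), Subtype.ext_iff,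
    Subtype.ext_iff, eq_comm]

theorem exists_generator {J : (Ideal (𝓞 K))⁰} {C : ClassGroup (𝓞 K)}
    (hJ : ClassGroup.mk0 J = C⁻¹) (I : {I : (Ideal (𝓞 K))⁰ // ClassGroup.mk0 I = C}) :
    ∃ α : {α : 𝓞 K // α ≠ 0 ∧ α ∈ J.1}, I.1.1 * J.1 = Ideal.span {α.1} := by
  have h1 : ClassGroup.mk0 (I.1 * J) = 1 := by rw [map_mul, I.2, hJ, mul_inv_cancel]
  obtain ⟨⟨α, hα⟩⟩ := (ClassGroup.mk0_eq_one_iff (I.1 * J).2).mp h1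
  have hα' : I.1.1 * J.1 = Ideal.span {α} := hα
  refine ⟨⟨α, ?_, ?_⟩, hα'⟩
  · rintro rfl
    rw [Ideal.span_singleton_zero, ← Ideal.zero_eq_bot] at hα'
    exact (mul_ne_zero (nonZeroDivisors.coe_ne_zero I.1) (nonZeroDivisors.coe_ne_zero J)) hα'
  · have : Ideal.span {α} ≤ J.1 := hα' ▸ Ideal.mul_le_right
    exact this (Ideal.mem_span_singleton_self α)

/-- The units act simply transitively on the generators of an ideal. -/
noncomputable def unitsEquivFiber {J : (Ideal (𝓞 K))⁰} {C : ClassGroup (𝓞 K)}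
    (hJ : ClassGroup.mk0 J = C⁻¹) (I : {I : (Ideal (𝓞 K))⁰ // ClassGroup.mk0 I = C})
    (α₀ : {α : 𝓞 K // α ≠ 0 ∧ α ∈ J.1}) (h : I.1.1 * J.1 = Ideal.span {α₀.1}) :
    (𝓞 K)ˣ ≃ {α : {α : 𝓞 K // α ≠ 0 ∧ α ∈ J.1} // idealOfMem hJ α = I} :=
  Equiv.ofBijective (fun u => ⟨⟨u * α₀.1, mul_ne_zero u.ne_zero α₀.2.1,
      Ideal.mul_mem_left _ _ α₀.2.2⟩, (idealOfMem_eq_iff hJ _ I).mpr <| h.trans <|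
        (Ideal.span_singleton_eq_span_singleton.mpr
          ((associated_unit_mul_right α₀.1 _ u.isUnit)))⟩) <| by
    constructor
    · intro u v huv
      have := congrArg (fun x => x.1.1) huv
      exact Units.ext (mul_right_cancel₀ α₀.2.1 this)
    · intro α
      have h1 := (idealOfMem_eq_iff hJ _ I).mp α.2
      rw [h, Ideal.span_singleton_eq_span_singleton] at h1
      obtain ⟨u, hu⟩ := h1
      refine ⟨u, Subtype.ext (Subtype.ext ?_)⟩
      change (u : 𝓞 K) * α₀.1 = α.1.1
      rw [mul_comm, hu]

theorem unitsEquivFiber_apply {J : (Ideal (𝓞 K))⁰} {C : ClassGroup (𝓞 K)}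
    (hJ : ClassGroup.mk0 J = C⁻¹) (I : {I : (Ideal (𝓞 K))⁰ // ClassGroup.mk0 I = C})
    (α₀ : {α : 𝓞 K // α ≠ 0 ∧ α ∈ J.1}) (h : I.1.1 * J.1 = Ideal.span {α₀.1}) (u : (𝓞 K)ˣ) :
    (unitsEquivFiber hJ I α₀ h u).1.1 = u * α₀.1 := rfl

theorem hasSum_coneWeight_fiber {J : (Ideal (𝓞 K))⁰} {C : ClassGroup (𝓞 K)}
    (hJ : ClassGroup.mk0 J = C⁻¹) (I : {I : (Ideal (𝓞 K))⁰ // ClassGroup.mk0 I = C}) :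
    HasSum (fun α : {α : {α : 𝓞 K // α ≠ 0 ∧ α ∈ J.1} // idealOfMem hJ α = I} =>
      coneWeight (mixedEmbedding K (α.1.1 : K))) (torsionOrder K : ℝ) := by
  obtain ⟨α₀, h⟩ := exists_generator hJ I
  rw [← (unitsEquivFiber hJ I α₀ h).hasSum_iff]
  have hα₀ : (α₀.1 : K) ≠ 0 := RingOfIntegers.coe_ne_zero_iff.mpr α₀.2.1
  refine (hasSum_iff_of_forall_eq fun u => ?_).mp (hasSum_coneWeight_unit hα₀)
  rw [Function.comp_apply, unitsEquivFiber_apply]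
  congr 2

theorem coneTerm_eq_of_mul_eq {I J : Ideal (𝓞 K)} {α : 𝓞 K} (h : I * J = Ideal.span {α}) (s : ℝ) :
    coneTerm s (mixedEmbedding K (α : K)) = coneWeight (mixedEmbedding K (α : K)) *
      ((Ideal.absNorm I : ℝ) ^ (-s) * (Ideal.absNorm J : ℝ) ^ (-s)) := by
  rw [coneTerm, norm_mixedEmbedding_coe, ← h, map_mul, Nat.cast_mul,
    Real.mul_rpow (Nat.cast_nonneg _) (Nat.cast_nonneg _)]

open scoped Classical in
/-- The sum over the ideals of a class as a weighted sum over algebraic integers. -/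
theorem hasSum_absNorm_rpow_class {J : (Ideal (𝓞 K))⁰} {C : ClassGroup (𝓞 K)}
    (hJ : ClassGroup.mk0 J = C⁻¹) {F : ℕ → ℂ} (hF : ∀ n, ‖F n‖ ≤ 1) {s : ℝ} (hs : 1 < s) :
    HasSum (fun I : {I : (Ideal (𝓞 K))⁰ // ClassGroup.mk0 I = C} =>
      F (Ideal.absNorm I.1.1) * ((Ideal.absNorm I.1.1 : ℝ) ^ (-s) : ℝ))
      (((Ideal.absNorm J.1 : ℝ) ^ s / torsionOrder K : ℝ) *
        ∑' α : 𝓞 K, (if α ∈ J.1 then F (Ideal.absNorm (Ideal.span {α}) / Ideal.absNorm J.1)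
          else 0) * coneTerm s (mixedEmbedding K (α : K))) := by
  set g : 𝓞 K → ℂ := fun α => (if α ∈ J.1 then
    F (Ideal.absNorm (Ideal.span {α}) / Ideal.absNorm J.1) else 0) *
      coneTerm s (mixedEmbedding K (α : K)) with hg
  have hsum : Summable g := by
    refine Summable.of_norm_bounded (summable_coneTerm (K := K) hs) fun α => ?_
    rw [hg, norm_mul, Complex.norm_real, Real.norm_of_nonneg (coneTerm_nonneg _ _)]
    refine mul_le_of_le_one_left (coneTerm_nonneg _ _) ?_
    split_ifs
    · exact hF _
    · simp
  have hsupp : Function.support g ⊆ {α : 𝓞 K | α ≠ 0 ∧ α ∈ J.1} := by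
    intro α hα
    rw [Function.mem_support] at hα
    constructor
    · rintro rfl
      rw [hg] at hα
      simp only [mixedEmbedding_coe_zero, coneTerm_zero (K := K) (show s ≠ 0 by linarith)] at hα
      simp at hα
    · by_contra h
      exact hα (by rw [hg]; simp only [if_neg h, zero_mul])
  have h1 : HasSum (fun α : {α : 𝓞 K // α ≠ 0 ∧ α ∈ J.1} => g α) (∑' α, g α) :=
    (hasSum_subtype_iff_of_support_subset hsupp).mpr hsum.hasSum
  have h2 := ((Equiv.sigmaFiberEquiv (idealOfMem hJ)).hasSum_iff.mpr h1)
  have hJ0 : Ideal.absNorm J.1 ≠ 0 := Ideal.absNorm_ne_zero_of_nonZeroDivisors J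
  -- The generators of `I * J` form one orbit of units, so their weights add up to the number of
  -- roots of unity while the norm is constant.
  have h3 : ∀ I : {I : (Ideal (𝓞 K))⁰ // ClassGroup.mk0 I = C},
      HasSum (fun α : {α : {α : 𝓞 K // α ≠ 0 ∧ α ∈ J.1} // idealOfMem hJ α = I} => g α.1)
        ((torsionOrder K : ℝ) * (F (Ideal.absNorm I.1.1) *
          ((Ideal.absNorm I.1.1 : ℝ) ^ (-s) * (Ideal.absNorm J.1 : ℝ) ^ (-s) : ℝ))) := by
    intro I
    have h4 := (Complex.hasSum_ofReal.mpr (hasSum_coneWeight_fiber hJ I)).mul_right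
      (F (Ideal.absNorm I.1.1) *
          ((Ideal.absNorm I.1.1 : ℝ) ^ (-s) * (Ideal.absNorm J.1 : ℝ) ^ (-s) : ℝ))
    refine (hasSum_iff_of_forall_eq fun α => ?_).mp h4
    have h5 := (idealOfMem_eq_iff hJ _ I).mp α.2
    rw [hg]
    simp only
    rw [coneTerm_eq_of_mul_eq h5, if_pos α.1.2.2, ← h5, map_mul,
      Nat.mul_div_cancel _ (Nat.pos_of_ne_zero hJ0)]
    push_cast
    ring
  have h6 := HasSum.sigma h2 h3
  have h7 := h6.mul_left (((Ideal.absNorm J.1 : ℝ) ^ s / torsionOrder K : ℝ) : ℂ)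
  refine (hasSum_iff_of_forall_eq fun I => ?_).mp h7
  have hw : (torsionOrder K : ℂ) ≠ 0 := Nat.cast_ne_zero.mpr (torsionOrder_ne_zero K)
  have hJs : (((Ideal.absNorm J.1 : ℝ) ^ s : ℝ) : ℂ) * (((Ideal.absNorm J.1 : ℝ) ^ (-s) : ℝ) : ℂ)
      = 1 := by
    rw [← Complex.ofReal_mul, ← Real.rpow_add (by positivity), add_neg_cancel, Real.rpow_zero,
      Complex.ofReal_one]
  push_cast at hJs ⊢
  rw [div_mul_eq_mul_div, mul_left_comm, mul_div_cancel_left₀ _ hw]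
  linear_combination (F (Ideal.absNorm I.1.1) * (((Ideal.absNorm I.1.1 : ℝ) ^ (-s) : ℝ) : ℂ)) * hJs

theorem summable_absNorm_rpow {s : ℝ} (hs : 1 < s) :
    Summable fun I : (Ideal (𝓞 K))⁰ => (Ideal.absNorm I.1 : ℝ) ^ (-s) := by
  have h : ∀ C : ClassGroup (𝓞 K), Summable fun I : {I : (Ideal (𝓞 K))⁰ // ClassGroup.mk0 I = C} =>
      (Ideal.absNorm I.1.1 : ℝ) ^ (-s) := fun C => by
    obtain ⟨J, hJ⟩ := ClassGroup.mk0_surjective C⁻¹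
    have h1 := (hasSum_absNorm_rpow_class hJ (F := fun _ => 1) (fun _ => by simp) hs).summable
    simp only [one_mul] at h1
    exact Complex.summable_ofReal.mp h1
  refine (Equiv.sigmaFiberEquiv (ClassGroup.mk0 (R := 𝓞 K))).summable_iff.mp ?_
  refine (summable_sigma_of_nonneg fun _ => by simp only [Function.comp]; positivity).mpr
    ⟨h, Summable.of_finite⟩

end NumberField

/-! ### Residues of zeta series at `s = 1`. -/

namespace NumberField

open NumberField.Units InfinitePlace Module Filter Topology

theorem sum_card_fiber_eq_card_le {ι : Type*} {N : ι → ℕ} (hN : ∀ i, 0 < N i)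
    (hfin : ∀ n, {i | N i ≤ n}.Finite) (n : ℕ) :
    ∑ k ∈ Finset.Icc 1 n, Nat.card {i // N i = k} = Nat.card {i // N i ≤ n} := by
  classical
  have hf := hfin n
  rw [show Nat.card {i // N i ≤ n} = hf.toFinset.card from Nat.card_eq_card_finite_toFinset hf]
  rw [Finset.card_eq_sum_card_fiberwise (f := N) (t := Finset.Icc 1 n)]
  · refine Finset.sum_congr rfl fun k hk => ?_
    refine Nat.subtype_card _ fun i => ?_
    rw [Finset.mem_Icc] at hk
    simp only [Finset.mem_filter, Set.Finite.mem_toFinset, Set.mem_ofPred_eq, and_iff_right_iff_imp]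
    rintro rfl
    exact hk.2
  · intro i hi
    simp at hi ⊢
    exact ⟨hN i, hi⟩

/-- If the number of elements of size at most `n` is asymptotic to `l * n`, then the associated
zeta series has residue `l` at `s = 1`. -/
theorem tendsto_sub_one_mul_tsum_rpow {ι : Type*} {N : ι → ℕ} (hN : ∀ i, 0 < N i)
    (hfin : ∀ n, {i | N i ≤ n}.Finite)
    (hsum : ∀ s : ℝ, 1 < s → Summable fun i => (N i : ℝ) ^ (-s)) {l : ℝ}
    (h : Tendsto (fun n : ℕ => (Nat.card {i // N i ≤ n} : ℝ) / n) atTop (𝓝 l)) :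
    Tendsto (fun s : ℝ => (s - 1) * ∑' i, (N i : ℝ) ^ (-s)) (𝓝[>] 1) (𝓝 l) := by
  have h1 := LSeries_tendsto_sub_mul_nhds_one_of_tendsto_sum_div_and_nonneg
    (fun n => (Nat.card {i // N i = n} : ℝ)) (l := l) (by
      refine h.congr fun n => ?_
      rw [← Nat.cast_sum, sum_card_fiber_eq_card_le hN hfin]) fun _ => Nat.cast_nonneg _
  have h2 : Tendsto (fun s : ℝ => (((s - 1) * ∑' i, (N i : ℝ) ^ (-s) : ℝ) : ℂ)) (𝓝[>] 1)
      (𝓝 (l : ℂ)) := by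
    refine h1.congr' ?_
    filter_upwards [self_mem_nhdsWithin] with s hs
    have hs1 : 1 < s := hs
    have key : HasSum (fun n => LSeries.term (fun n => ((Nat.card {i // N i = n} : ℝ) : ℂ)) s n)
        ((∑' i, (N i : ℝ) ^ (-s) : ℝ) : ℂ) := by
      have h3 := (Equiv.sigmaFiberEquiv N).hasSum_iff.mpr (hsum s hs1).hasSum
      have h4 : ∀ n, HasSum (fun i : {i // N i = n} => (N i.1 : ℝ) ^ (-s))
          ((Nat.card {i // N i = n} : ℝ) * (n : ℝ) ^ (-s)) := fun n => by
        have : Finite {i // N i = n} := (hfin n).subset fun i (hi : N i = n) => hi.le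
        have h5 := (hasSum_const_one_finite (T := {i // N i = n})).mul_right ((n : ℝ) ^ (-s))
        refine (hasSum_iff_of_forall_eq fun i => ?_).mp h5
        rw [one_mul, i.2]
      have h5 := Complex.hasSum_ofReal.mpr (HasSum.sigma h3 h4)
      refine (hasSum_iff_of_forall_eq fun n => ?_).mp h5
      rcases Nat.eq_zero_or_pos n with rfl | hn
      · have : IsEmpty {i // N i = 0} := ⟨fun i => (hN i.1).ne' i.2⟩
        simp
      · rw [LSeries.term_of_ne_zero hn.ne', Real.rpow_neg (Nat.cast_nonneg _)]
        push_cast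
        rw [Complex.ofReal_cpow (Nat.cast_nonneg _), div_eq_mul_inv]
        push_cast
        rfl
    rw [LSeries, key.tsum_eq]
    push_cast
    rfl
  exact Filter.tendsto_ofReal_iff.mp h2

variable (K : Type*) [Field K] [NumberField K]

theorem finite_absNorm_le (n : ℕ) : {I : (Ideal (𝓞 K))⁰ | Ideal.absNorm I.1 ≤ n}.Finite :=
  Set.Finite.preimage Subtype.val_injective.injOn (Ideal.finite_setOfPred_absNorm_le n)

/-- The zeta function of a number field has a pole at `s = 1`. -/
theorem exists_tendsto_sub_one_mul_tsum_absNorm : ∃ l : ℝ, 0 < l ∧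
    Tendsto (fun s : ℝ => (s - 1) * ∑' I : (Ideal (𝓞 K))⁰, (Ideal.absNorm I.1 : ℝ) ^ (-s))
      (𝓝[>] 1) (𝓝 l) := by
  refine ⟨_, dedekindZeta_residue_pos K, ?_⟩
  refine tendsto_sub_one_mul_tsum_rpow (N := fun I : (Ideal (𝓞 K))⁰ => Ideal.absNorm I.1)
    (fun I => Ideal.absNorm_pos_of_nonZeroDivisors I) (finite_absNorm_le K)
    (fun s hs => summable_absNorm_rpow hs) ?_
  refine ((Ideal.tendsto_norm_le_div_atTop₀ K).comp tendsto_natCast_atTop_atTop).congr fun n => ?_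
  simp only [Function.comp_apply, Nat.cast_le]

/-- The residue at `s = 1` of the zeta function of an ideal class does not depend on the class. -/
theorem exists_tendsto_sub_one_mul_tsum_class : ∃ l : ℝ, ∀ C : ClassGroup (𝓞 K),
    Tendsto (fun s : ℝ => (s - 1) * ∑' I : {I : (Ideal (𝓞 K))⁰ // ClassGroup.mk0 I = C},
      (Ideal.absNorm I.1.1 : ℝ) ^ (-s)) (𝓝[>] 1) (𝓝 l) := by
  refine ⟨(2 ^ nrRealPlaces K * (2 * Real.pi) ^ nrComplexPlaces K * regulator K) /
    (torsionOrder K * Real.sqrt |discr K|), fun C => ?_⟩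
  refine tendsto_sub_one_mul_tsum_rpow
    (N := fun I : {I : (Ideal (𝓞 K))⁰ // ClassGroup.mk0 I = C} => Ideal.absNorm I.1.1)
    (fun I => Ideal.absNorm_pos_of_nonZeroDivisors I.1)
    (fun n => (finite_absNorm_le K n).preimage Subtype.val_injective.injOn)
    (fun s hs => (summable_absNorm_rpow hs).comp_injective Subtype.val_injective) ?_
  refine ((Ideal.tendsto_norm_le_and_mk_eq_div_atTop K C).comp
    tendsto_natCast_atTop_atTop).congr fun n => ?_
  simp only [Function.comp_apply, Nat.cast_le]
  congr 2
  exact Nat.card_congr ((Equiv.subtypeSubtypeEquivSubtypeInter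
    (fun I : (Ideal (𝓞 K))⁰ => ClassGroup.mk0 I = C) fun I => Ideal.absNorm I.1 ≤ n).trans
      (Equiv.subtypeEquivRight fun _ => and_comm)).symm

end NumberField

namespace NumberField

open NumberField.Units InfinitePlace Module

variable {K : Type*} [Field K] [NumberField K]

/-! ### Twisted class sums are bounded -/

/-- The norm is the determinant of multiplication in an integral basis, and determinants commute
with reduction modulo `M`. -/
theorem norm_add_mul_modEq (M : ℕ) (α γ : 𝓞 K) :
    ((Algebra.norm ℤ (α + M * γ) : ℤ) : ZMod M) = ((Algebra.norm ℤ α : ℤ) : ZMod M) := by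
  classical
  let b := RingOfIntegers.basis K
  rw [Algebra.norm_eq_matrix_det b, Algebra.norm_eq_matrix_det b]
  have h : ∀ A : Matrix (Free.ChooseBasisIndex ℤ (𝓞 K)) (Free.ChooseBasisIndex ℤ (𝓞 K)) ℤ, ((A.det : ℤ) : ZMod M) = (A.map (Int.castRingHom (ZMod M))).det :=
    fun A => by
      rw [← RingHom.mapMatrix_apply, ← RingHom.map_det]
      rfl
  rw [h, h]
  congr 1
  ext i j
  rw [← nsmul_eq_mul, map_add, map_nsmul, Matrix.map_apply, Matrix.map_apply, Matrix.add_apply,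
    Matrix.smul_apply, map_add, map_nsmul, nsmul_eq_mul, ZMod.natCast_self, zero_mul, add_zero]

theorem norm_modEq_of_sub_mem {M : ℕ} {α β : 𝓞 K} (h : α - β ∈ Ideal.span {(M : 𝓞 K)}) :
    ((Algebra.norm ℤ α : ℤ) : ZMod M) = ((Algebra.norm ℤ β : ℤ) : ZMod M) := by
  obtain ⟨γ, hγ⟩ := Ideal.mem_span_singleton'.mp h
  have : α = β + M * γ := by rw [mul_comm, hγ]; ring
  rw [this, norm_add_mul_modEq]

/-- Absolute norms of ideals and norms of elements differ by a sign, which an even character does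
not see. -/
theorem DirichletCharacter_natAbs {q : ℕ} (θ : DirichletCharacter ℂ q) (hθ : θ (-1) = 1) (a : ℤ) :
    θ ((a.natAbs : ℕ) : ZMod q) = θ (a : ZMod q) := by
  rcases Int.natAbs_eq a with h | h
  · conv_rhs => rw [h, Int.cast_natCast]
  · conv_rhs => rw [h, Int.cast_neg, ← neg_one_mul, map_mul, hθ, one_mul, Int.cast_natCast]

/-- An element whose norm is prime to `M` with prescribed class modulo a prime. -/
theorem exists_norm_coprime {q N : ℕ} (hq : q.Prime) (hN : N ≠ 0) (β : 𝓞 K)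
    (hβ : IsCoprime (Algebra.norm ℤ β) q) : ∃ β' : 𝓞 K,
      ((Algebra.norm ℤ β' : ℤ) : ZMod q) = ((Algebra.norm ℤ β : ℤ) : ZMod q) ∧
      IsCoprime (Algebra.norm ℤ β') ((q * N : ℕ) : ℤ) := by
  obtain ⟨a, M, hM, rfl⟩ := Nat.exists_eq_pow_mul_and_not_dvd hN q hq.ne_one
  have hqM : IsCoprime (q : ℤ) (M : ℤ) :=
    Nat.isCoprime_iff_coprime.mpr ((Nat.Prime.coprime_iff_not_dvd hq).mpr hM)
  obtain ⟨x, y, hxy⟩ := hqM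
  have hxy' : (x : 𝓞 K) * q + y * M = 1 := by exact_mod_cast congrArg (Int.cast : ℤ → 𝓞 K) hxy
  -- Here `M` is the part of the original `N` prime to `q` and `x * q + y * M = 1`, so the new
  -- element is congruent to `β` modulo `q` and to `1` modulo `M`.
  have h1 : ((Algebra.norm ℤ (β * (y * M) + x * q) : ℤ) : ZMod q) =
      ((Algebra.norm ℤ β : ℤ) : ZMod q) := by
    refine norm_modEq_of_sub_mem (Ideal.mem_span_singleton'.mpr ⟨x * (1 - β), ?_⟩)
    linear_combination -β * hxy'
  have h2 : ((Algebra.norm ℤ (β * (y * M) + x * q) : ℤ) : ZMod M) =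
      ((Algebra.norm ℤ (1 : 𝓞 K) : ℤ) : ZMod M) := by
    refine norm_modEq_of_sub_mem (Ideal.mem_span_singleton'.mpr ⟨y * (β - 1), ?_⟩)
    linear_combination -hxy'
  refine ⟨β * (y * M) + x * q, h1, ?_⟩
  rw [map_one, Int.cast_one] at h2
  have h3 : IsCoprime (Algebra.norm ℤ (β * (y * M) + x * q)) (q : ℤ) := by
    have := (ZMod.intCast_eq_intCast_iff_dvd_sub _ _ _).mp h1
    obtain ⟨c, hc⟩ := this
    have e : Algebra.norm ℤ β = Algebra.norm ℤ (β * (y * M) + x * q) + q * c := by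
      linear_combination hc
    rw [e] at hβ
    exact (IsCoprime.add_mul_left_left_iff).mp hβ
  have h4 : IsCoprime (Algebra.norm ℤ (β * (y * M) + x * q)) (M : ℤ) := by
    rw [← Int.cast_one] at h2
    have := (ZMod.intCast_eq_intCast_iff_dvd_sub _ _ _).mp h2
    obtain ⟨c, hc⟩ := this
    exact ⟨1, c, by linear_combination -hc⟩
  push_cast
  exact h3.mul_right (h3.pow_right.mul_right h4)

/-- An algebraic integer divides its norm, and the norm is invertible modulo `M`. -/
theorem isUnit_mk_of_norm_coprime {M : ℕ} {β : 𝓞 K} (h : IsCoprime (Algebra.norm ℤ β) (M : ℤ)) :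
    ∃ γ : 𝓞 K, β * γ - 1 ∈ Ideal.span {(M : 𝓞 K)} := by
  obtain ⟨u, v, huv⟩ := h
  obtain ⟨δ, hδ⟩ : β ∣ ((Algebra.norm ℤ β : ℤ) : 𝓞 K) := by
    have := Ideal.absNorm_mem (Ideal.span {β})
    rw [Ideal.absNorm_span_singleton, Ideal.mem_span_singleton] at this
    rcases Int.natAbs_eq (Algebra.norm ℤ β) with h | h
    · rw [h, Int.cast_natCast]
      exact this
    · rw [h, Int.cast_neg, Int.cast_natCast, dvd_neg]
      exact this
  have huv' : (u : 𝓞 K) * ((Algebra.norm ℤ β : ℤ) : 𝓞 K) + v * M = 1 := by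
    exact_mod_cast congrArg (Int.cast : ℤ → 𝓞 K) huv
  refine ⟨δ * u, Ideal.mem_span_singleton'.mpr ⟨-v, ?_⟩⟩
  rw [← mul_assoc, ← hδ]
  linear_combination -huv'

open scoped Classical in
/-- The coefficient of a twisted class sum. -/
noncomputable def twistCoeff {q : ℕ} (θ : DirichletCharacter ℂ q) (J : Ideal (𝓞 K)) (α : 𝓞 K) : ℂ :=
  if α ∈ J then θ ((Ideal.absNorm (Ideal.span {α}) / Ideal.absNorm J : ℕ) : ZMod q) else 0

theorem exists_norm_eq_mul {J : Ideal (𝓞 K)} {α : 𝓞 K} (h : α ∈ J) :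
    ∃ a : ℤ, Algebra.norm ℤ α = Ideal.absNorm J * a := by
  have h1 : Ideal.absNorm J ∣ Ideal.absNorm (Ideal.span {α}) :=
    Ideal.absNorm_dvd_absNorm_of_le (Ideal.span_singleton_le_iff_mem _ |>.mpr h)
  rw [Ideal.absNorm_span_singleton] at h1
  exact Int.natCast_dvd.mpr h1

theorem twistCoeff_eq {q : ℕ} {θ : DirichletCharacter ℂ q} (hθ : θ (-1) = 1) {J : Ideal (𝓞 K)}
    (hJ : Ideal.absNorm J ≠ 0) {α : 𝓞 K} (h : α ∈ J) {a : ℤ}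
    (ha : Algebra.norm ℤ α = Ideal.absNorm J * a) : twistCoeff θ J α = θ (a : ZMod q) := by
  rw [twistCoeff, if_pos h, Ideal.absNorm_span_singleton, ha, Int.natAbs_mul, Int.natAbs_natCast,
    Nat.mul_div_cancel_left _ (Nat.pos_of_ne_zero hJ), DirichletCharacter_natAbs θ hθ]

/-- The modulus lies in `J`, so it decides membership. A norm divisible by `N J` and known modulo `q
* N J` has its quotient known modulo `q`. -/
theorem twistCoeff_congr {q : ℕ} {θ : DirichletCharacter ℂ q} (hθ : θ (-1) = 1) {J : Ideal (𝓞 K)}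
    (hJ : Ideal.absNorm J ≠ 0) {α β : 𝓞 K}
    (h : α - β ∈ Ideal.span {((q * Ideal.absNorm J : ℕ) : 𝓞 K)}) :
    twistCoeff θ J α = twistCoeff θ J β := by
  have hM : Ideal.span {((q * Ideal.absNorm J : ℕ) : 𝓞 K)} ≤ J := by
    rw [Ideal.span_singleton_le_iff_mem, Nat.cast_mul]
    exact Ideal.mul_mem_left _ _ (Ideal.absNorm_mem J)
  by_cases hα : α ∈ J
  · have hβ : β ∈ J := by
      have := J.sub_mem hα (hM h)
      rwa [sub_sub_cancel] at this
    obtain ⟨a, ha⟩ := exists_norm_eq_mul hα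
    obtain ⟨b, hb⟩ := exists_norm_eq_mul hβ
    rw [twistCoeff_eq hθ hJ hα ha, twistCoeff_eq hθ hJ hβ hb]
    have h1 := norm_modEq_of_sub_mem h
    rw [ha, hb, eq_comm, ZMod.intCast_eq_intCast_iff_dvd_sub, ← mul_sub, Nat.cast_mul,
      mul_comm (q : ℤ)] at h1
    have h2 := Int.dvd_of_mul_dvd_mul_left (Nat.cast_ne_zero.mpr hJ) h1
    congr 1
    exact ((ZMod.intCast_eq_intCast_iff_dvd_sub _ _ _).mpr h2).symm
  · have hβ : β ∉ J := fun hβ => hα (by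
      have := J.add_mem (hM h) hβ
      rwa [sub_add_cancel] at this)
    rw [twistCoeff, twistCoeff, if_neg hα, if_neg hβ]

/-- Invertibility of `β` is what keeps elements outside `J` outside. -/
theorem twistCoeff_mul {q : ℕ} {θ : DirichletCharacter ℂ q} (hθ : θ (-1) = 1) {J : Ideal (𝓞 K)}
    (hJ : Ideal.absNorm J ≠ 0) {α β γ : 𝓞 K}
    (h : β * γ - 1 ∈ Ideal.span {((q * Ideal.absNorm J : ℕ) : 𝓞 K)}) :
    twistCoeff θ J (β * α) = θ ((Algebra.norm ℤ β : ℤ) : ZMod q) * twistCoeff θ J α := by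
  have hM : Ideal.span {((q * Ideal.absNorm J : ℕ) : 𝓞 K)} ≤ J := by
    rw [Ideal.span_singleton_le_iff_mem, Nat.cast_mul]
    exact Ideal.mul_mem_left _ _ (Ideal.absNorm_mem J)
  by_cases hα : α ∈ J
  · obtain ⟨a, ha⟩ := exists_norm_eq_mul hα
    rw [twistCoeff_eq hθ hJ hα ha, twistCoeff_eq hθ hJ (J.mul_mem_left β hα)
      (a := Algebra.norm ℤ β * a) (by rw [map_mul, ha]; ring), Int.cast_mul, map_mul]
  · have hβ : β * α ∉ J := fun hβ => hα (by
      have h1 := J.sub_mem (J.mul_mem_left γ hβ) (J.mul_mem_right α (hM h))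
      have e : γ * (β * α) - (β * γ - 1) * α = α := by ring
      rwa [e] at h1)
    rw [twistCoeff, twistCoeff, if_neg hα, if_neg hβ, mul_zero]

open scoped Classical in
-- After replacing `β` by an element invertible modulo the whole period, multiplication by it
-- permutes the residues and scales the coefficients by `θ (N β) ≠ 1`. Hence they sum to zero over a
-- period.
theorem exists_norm_tsum_twist_le {q : ℕ} (hq : q.Prime) {θ : DirichletCharacter ℂ q}
    (hθ : θ (-1) = 1) (β : 𝓞 K) (hβ0 : IsCoprime (Algebra.norm ℤ β) (q : ℤ))
    (hβ1 : θ ((Algebra.norm ℤ β : ℤ) : ZMod q) ≠ 1) (C : ClassGroup (𝓞 K)) :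
    ∃ B : ℝ, ∀ s : ℝ, 1 < s → s ≤ 2 →
      ‖∑' I : {I : (Ideal (𝓞 K))⁰ // ClassGroup.mk0 I = C},
        θ (Ideal.absNorm I.1.1 : ZMod q) * ((Ideal.absNorm I.1.1 : ℝ) ^ (-s) : ℝ)‖ ≤ B := by
  obtain ⟨J, hJ⟩ := ClassGroup.mk0_surjective C⁻¹
  have hJ0 : Ideal.absNorm J.1 ≠ 0 := Ideal.absNorm_ne_zero_of_nonZeroDivisors J
  obtain ⟨β', hβ'1, hβ'2⟩ := exists_norm_coprime hq hJ0 β hβ0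
  obtain ⟨γ, hγ⟩ := isUnit_mk_of_norm_coprime hβ'2
  set M : 𝓞 K := ((q * Ideal.absNorm J.1 : ℕ) : 𝓞 K) with hM
  have hM0 : M ≠ 0 := Nat.cast_ne_zero.mpr (mul_ne_zero hq.ne_zero hJ0)
  have : Fintype (𝓞 K ⧸ Ideal.span {M}) :=
    @Fintype.ofFinite _ (Ideal.finiteQuotientOfFreeOfNeBot _
      (by rwa [Ne, Ideal.span_singleton_eq_bot]))
  let c : 𝓞 K ⧸ Ideal.span {M} → ℂ := fun x => twistCoeff θ J.1 (Quotient.out x)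
  have hc : ∀ α, c (Ideal.Quotient.mk _ α) = twistCoeff θ J.1 α := fun α => by
    refine twistCoeff_congr hθ hJ0 (Ideal.Quotient.eq.mp ?_)
    exact Quotient.out_eq' (Ideal.Quotient.mk (Ideal.span {M}) α)
  have hcm : ∀ x, c (Ideal.Quotient.mk _ β' * x) =
      θ ((Algebra.norm ℤ β : ℤ) : ZMod q) * c x := fun x => by
    obtain ⟨α, rfl⟩ := Ideal.Quotient.mk_surjective x
    rw [← map_mul, hc, hc, twistCoeff_mul hθ hJ0 hγ, hβ'1]
  have hu : IsUnit (Ideal.Quotient.mk (Ideal.span {M}) β') := by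
    refine IsUnit.of_mul_eq_one (Ideal.Quotient.mk _ γ) ?_
    rw [← map_mul, ← map_one (Ideal.Quotient.mk _)]
    exact Ideal.Quotient.eq.mpr hγ
  have hc0 : ∑ x, c x = 0 := by
    have h1 : ∑ x, c (hu.unit * x) = ∑ x, c x := Equiv.sum_comp (Units.mulLeft hu.unit) c
    simp_rw [IsUnit.unit_spec, hcm, ← Finset.mul_sum] at h1
    by_contra h0
    exact hβ1 (mul_right_cancel₀ h0 (h1.trans (one_mul _).symm))
  obtain ⟨B, hB⟩ := exists_norm_tsum_coneTerm_le hM0 c hc0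
  have hθ1 : ∀ n : ℕ, ‖θ (n : ZMod q)‖ ≤ 1 := fun n => DirichletCharacter.norm_le_one θ _
  refine ⟨(Ideal.absNorm J.1 : ℝ) ^ (2 : ℝ) * B, fun s hs1 hs2 => ?_⟩
  rw [(hasSum_absNorm_rpow_class hJ (F := fun n => θ (n : ZMod q)) hθ1 hs1).tsum_eq, norm_mul]
  have h1 := hB s hs1 hs2
  have hB0 : 0 ≤ B := (norm_nonneg _).trans h1
  simp_rw [hc] at h1
  refine mul_le_mul ?_ h1 (norm_nonneg _) (by positivity)
  rw [Complex.norm_real, Real.norm_of_nonneg (by positivity)]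
  refine (div_le_self (by positivity) ?_).trans ?_
  · exact_mod_cast Nat.one_le_iff_ne_zero.mpr (torsionOrder_ne_zero K)
  · exact Real.rpow_le_rpow_of_exponent_le
      (by exact_mod_cast Nat.one_le_iff_ne_zero.mpr hJ0) hs2

end NumberField

namespace NumberField

open Module Filter Topology IsDedekindDomain

/-! ### Euler products -/

section Sieve

variable {R : Type*} [CommRing R] [IsDedekindDomain R]

/-- A height one prime as a nonzero ideal. -/
def primeToNonZeroDivisors (P : HeightOneSpectrum R) : (Ideal R)⁰ :=
  ⟨P.asIdeal, mem_nonZeroDivisors_of_ne_zero P.ne_bot⟩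

theorem primeToNonZeroDivisors_dvd {P : HeightOneSpectrum R} {I : (Ideal R)⁰} :
    primeToNonZeroDivisors P ∣ I ↔ P.asIdeal ∣ I.1 := by
  constructor
  · rintro ⟨J, rfl⟩
    exact ⟨J.1, rfl⟩
  · rintro ⟨J, hJ⟩
    refine ⟨⟨J, mem_nonZeroDivisors_of_ne_zero ?_⟩, Subtype.ext hJ⟩
    rintro rfl
    exact nonZeroDivisors.coe_ne_zero I (hJ.trans (mul_zero _))

open scoped Classical in
/-- The restriction of `φ` to the ideals prime to `S`. -/
noncomputable def sieve (φ : (Ideal R)⁰ →* ℂ) (S : Finset (HeightOneSpectrum R)) (I : (Ideal R)⁰) :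
    ℂ := if ∀ P ∈ S, ¬ P.asIdeal ∣ I.1 then φ I else 0

theorem norm_sieve_le (φ : (Ideal R)⁰ →* ℂ) (S : Finset (HeightOneSpectrum R)) (I : (Ideal R)⁰) :
    ‖sieve φ S I‖ ≤ ‖φ I‖ := by
  rw [sieve]
  split_ifs
  · exact le_rfl
  · simp

theorem sieve_mul_of_notMem (φ : (Ideal R)⁰ →* ℂ) {S : Finset (HeightOneSpectrum R)}
    {P : HeightOneSpectrum R} (hP : P ∉ S) (I : (Ideal R)⁰) :
    sieve φ S (primeToNonZeroDivisors P * I) = φ (primeToNonZeroDivisors P) * sieve φ S I := by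
  have h : (∀ Q ∈ S, ¬ Q.asIdeal ∣ (primeToNonZeroDivisors P * I).1) ↔
      ∀ Q ∈ S, ¬ Q.asIdeal ∣ I.1 := by
    refine forall₂_congr fun Q hQ => not_congr ⟨fun h => ?_, fun h => ?_⟩
    · rcases (Q.prime.dvd_or_dvd (show Q.asIdeal ∣ P.asIdeal * I.1 from h)) with h1 | h1
      · refine absurd ?_ (ne_of_mem_of_not_mem hQ hP)
        refine HeightOneSpectrum.ext ?_
        exact (Q.prime.dvd_prime_iff_associated P.prime).mp h1 |>.eq_of_normalized
          (normalize_eq _) (normalize_eq _)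
      · exact h1
    · exact h.mul_left _
  rw [sieve, sieve]
  by_cases hI : ∀ Q ∈ S, ¬ Q.asIdeal ∣ I.1
  · rw [if_pos hI, if_pos (h.mpr hI), map_mul]
  · rw [if_neg hI, if_neg (mt h.mp hI), mul_zero]

theorem sieve_insert (φ : (Ideal R)⁰ →* ℂ) [DecidableEq (HeightOneSpectrum R)]
    {S : Finset (HeightOneSpectrum R)} {P : HeightOneSpectrum R} (I : (Ideal R)⁰) :
    sieve φ (insert P S) I = sieve φ S I -
      (Set.range fun J => primeToNonZeroDivisors P * J).indicator (sieve φ S) I := by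
  have h : I ∈ (Set.range fun J => primeToNonZeroDivisors P * J) ↔ P.asIdeal ∣ I.1 := by
    rw [← primeToNonZeroDivisors_dvd]
    exact ⟨fun ⟨J, hJ⟩ => ⟨J, hJ.symm⟩, fun ⟨J, hJ⟩ => ⟨J, hJ.symm⟩⟩
  by_cases hI : P.asIdeal ∣ I.1
  · rw [Set.indicator_of_mem (h.mpr hI), sub_self, sieve, if_neg]
    exact fun hh => hh P (Finset.mem_insert_self P S) hI
  · rw [Set.indicator_of_notMem (fun hh => hI (h.mp hh)), sub_zero, sieve, sieve]
    have h2 : (∀ Q ∈ insert P S, ¬ Q.asIdeal ∣ I.1) ↔ ∀ Q ∈ S, ¬ Q.asIdeal ∣ I.1 := by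
      rw [Finset.forall_mem_insert]
      exact and_iff_right hI
    by_cases h3 : ∀ Q ∈ S, ¬ Q.asIdeal ∣ I.1
    · rw [if_pos h3, if_pos (h2.mpr h3)]
    · rw [if_neg h3, if_neg (mt h2.mp h3)]

/-- Removing the multiples of a further prime `P` removes `φ P` times the current sum, by complete
multiplicativity. -/
theorem tsum_sieve (φ : (Ideal R)⁰ →* ℂ) (hφ : Summable φ) (S : Finset (HeightOneSpectrum R)) :
    ∑' I, sieve φ S I = (∏ P ∈ S, (1 - φ (primeToNonZeroDivisors P))) * ∑' I, φ I := by
  classical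
  have hs : ∀ S, Summable (sieve φ S) := fun S => .of_norm_bounded hφ.norm (norm_sieve_le φ S)
  induction S using Finset.induction_on with
  | empty => simp [sieve]
  | insert P S hP ih =>
    have hinj : Function.Injective fun J => primeToNonZeroDivisors P * J := mul_right_injective _
    simp_rw [sieve_insert]
    rw [(hs S).tsum_sub ((hs S).indicator _), ← tsum_subtype, tsum_range (sieve φ S) hinj]
    simp_rw [sieve_mul_of_notMem φ hP]
    rw [tsum_mul_left, ih, Finset.prod_insert hP]
    ring

/-- Sieving by more and more primes leaves only the unit ideal, by dominated convergence. In this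
form the Euler product needs neither logarithms nor the nonvanishing of the sum. -/
theorem tendsto_prod_one_sub (φ : (Ideal R)⁰ →* ℂ) (hφ : Summable φ) :
    Tendsto (fun S : Finset (HeightOneSpectrum R) =>
      (∏ P ∈ S, (1 - φ (primeToNonZeroDivisors P))) * ∑' I, φ I) atTop (𝓝 1) := by
  classical
  simp_rw [← tsum_sieve φ hφ]
  have h1 : ∑' I : (Ideal R)⁰, (if I = 1 then (1 : ℂ) else 0) = 1 := tsum_ite_eq 1 _
  rw [← h1]
  refine tendsto_tsum_of_dominated_convergence hφ.norm (fun I => ?_)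
    (Eventually.of_forall fun S I => norm_sieve_le φ S I)
  by_cases hI : I = 1
  · subst hI
    rw [if_pos rfl]
    refine tendsto_const_nhds.congr fun S => ?_
    rw [sieve, if_pos, map_one]
    intro P _ h
    exact P.prime.not_isUnit (isUnit_of_dvd_one h)
  · rw [if_neg hI]
    have : ¬ IsUnit I.1 := fun h => hI (Subtype.ext (Ideal.isUnit_iff.mp h |>.trans
      Ideal.one_eq_top.symm))
    obtain ⟨Q, hQ, hQI⟩ := WfDvdMonoid.exists_irreducible_factor this
      (nonZeroDivisors.coe_ne_zero I)
    have hQp := hQ.prime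
    let P : HeightOneSpectrum R := ⟨Q, Ideal.isPrime_of_prime hQp, hQp.ne_zero⟩
    refine tendsto_const_nhds.congr' ?_
    filter_upwards [eventually_ge_atTop {P}] with S hS
    rw [sieve, if_neg]
    exact fun h => h P (hS (Finset.mem_singleton_self P)) hQI

end Sieve

end NumberField

namespace NumberField

open Module Filter Topology IsDedekindDomain

/-! ### Zeta series twisted by characters of the class group and Dirichlet characters. -/

section Twist

variable {K : Type*} [Field K] [NumberField K]

/-- The completely multiplicative function `I ↦ χ(I) ψ(N I) (N I)⁻ˢ` on nonzero ideals. -/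
noncomputable def twistHom (χ : ClassGroup (𝓞 K) →* ℂˣ) (ψ : ℕ →* ℂ) (s : ℝ) :
    (Ideal (𝓞 K))⁰ →* ℂ where
  toFun I := (χ (ClassGroup.mk0 I) : ℂ) *
    (ψ (Ideal.absNorm I.1) * (((Ideal.absNorm I.1 : ℝ) ^ (-s) : ℝ) : ℂ))
  map_one' := by simp
  map_mul' I J := by
    simp only [Submonoid.coe_mul, map_mul, Units.val_mul, Nat.cast_mul,
      Real.mul_rpow (Nat.cast_nonneg _) (Nat.cast_nonneg _), Complex.ofReal_mul]
    ring

theorem twistHom_apply (χ : ClassGroup (𝓞 K) →* ℂˣ) (ψ : ℕ →* ℂ) (s : ℝ) (I : (Ideal (𝓞 K))⁰) :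
    twistHom χ ψ s I = (χ (ClassGroup.mk0 I) : ℂ) *
      (ψ (Ideal.absNorm I.1) * (((Ideal.absNorm I.1 : ℝ) ^ (-s) : ℝ) : ℂ)) := rfl

theorem norm_classGroup_char (χ : ClassGroup (𝓞 K) →* ℂˣ) (c : ClassGroup (𝓞 K)) :
    ‖(χ c : ℂ)‖ = 1 := by
  refine Complex.norm_eq_one_of_pow_eq_one (n := Fintype.card (ClassGroup (𝓞 K))) ?_
    Fintype.card_ne_zero
  rw [← Units.val_pow_eq_pow_val, ← map_pow, pow_card_eq_one, map_one, Units.val_one]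

theorem summable_twistHom (χ : ClassGroup (𝓞 K) →* ℂˣ) {ψ : ℕ →* ℂ} (hψ : ∀ n, ‖ψ n‖ ≤ 1)
    {s : ℝ} (hs : 1 < s) : Summable (twistHom χ ψ s) := by
  refine Summable.of_norm_bounded (summable_absNorm_rpow hs) fun I => ?_
  rw [twistHom_apply, norm_mul, norm_mul, norm_classGroup_char, one_mul, Complex.norm_real,
    Real.norm_of_nonneg (by positivity)]
  exact mul_le_of_le_one_left (by positivity) (hψ _)

theorem tsum_twistHom (χ : ClassGroup (𝓞 K) →* ℂˣ) {ψ : ℕ →* ℂ} (hψ : ∀ n, ‖ψ n‖ ≤ 1)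
    {s : ℝ} (hs : 1 < s) : ∑' I, twistHom χ ψ s I = ∑ C : ClassGroup (𝓞 K), (χ C : ℂ) *
      ∑' I : {I : (Ideal (𝓞 K))⁰ // ClassGroup.mk0 I = C},
        ψ (Ideal.absNorm I.1.1) * (((Ideal.absNorm I.1.1 : ℝ) ^ (-s) : ℝ) : ℂ) := by
  have h := summable_twistHom χ hψ hs
  have h1 := (Equiv.sigmaFiberEquiv fun I : (Ideal (𝓞 K))⁰ => ClassGroup.mk0 I).summable_iff.mpr h
  rw [← (Equiv.sigmaFiberEquiv fun I : (Ideal (𝓞 K))⁰ => ClassGroup.mk0 I).tsum_eq]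
  refine (h1.tsum_sigma).trans ?_
  rw [tsum_fintype]
  refine Finset.sum_congr rfl fun C _ => ?_
  rw [← tsum_mul_left]
  refine tsum_congr fun I => ?_
  refine (twistHom_apply χ ψ s I.1).trans ?_
  rw [I.2]

/-- Twisted zeta functions are bounded near `1` if the twist is nontrivial on principal ideals. -/
theorem exists_norm_tsum_twistHom_le (χ : ClassGroup (𝓞 K) →* ℂˣ) {q : ℕ} (hq : q.Prime)
    {θ : DirichletCharacter ℂ q} (hθ : θ (-1) = 1) (β : 𝓞 K)
    (hβ0 : IsCoprime (Algebra.norm ℤ β) (q : ℤ))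
    (hβ1 : θ ((Algebra.norm ℤ β : ℤ) : ZMod q) ≠ 1) {ψ : ℕ →* ℂ} (hψ : ∀ n : ℕ, ψ n = θ n) :
    ∃ B : ℝ, ∀ s : ℝ, 1 < s → s ≤ 2 → ‖∑' I, twistHom χ ψ s I‖ ≤ B := by
  choose B hB using exists_norm_tsum_twist_le hq hθ β hβ0 hβ1
  refine ⟨∑ C, B C, fun s hs1 hs2 => ?_⟩
  rw [tsum_twistHom χ (fun n => hψ n ▸ DirichletCharacter.norm_le_one θ _) hs1]
  refine (norm_sum_le _ _).trans (Finset.sum_le_sum fun C _ => ?_)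
  rw [norm_mul, norm_classGroup_char, one_mul]
  simp_rw [hψ]
  exact hB C s hs1 hs2

/-- All ideal classes contribute the same residue, and the values of a nontrivial character sum to
zero. -/
theorem tendsto_sub_one_mul_tsum_twistHom_one {χ : ClassGroup (𝓞 K) →* ℂˣ} (hχ : χ ≠ 1) :
    Tendsto (fun s : ℝ => ((s - 1 : ℝ) : ℂ) * ∑' I, twistHom χ 1 s I) (𝓝[>] 1) (𝓝 0) := by
  obtain ⟨l, hl⟩ := exists_tendsto_sub_one_mul_tsum_class K
  have h0 : ∑ C : ClassGroup (𝓞 K), (χ C : ℂ) = 0 := by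
    obtain ⟨D, hD⟩ : ∃ D, χ D ≠ 1 := by
      by_contra! h
      exact hχ (MonoidHom.ext h)
    have h1 : ∑ C : ClassGroup (𝓞 K), (χ (D * C) : ℂ) = ∑ C, (χ C : ℂ) :=
      Equiv.sum_comp (Equiv.mulLeft D) fun C => (χ C : ℂ)
    simp_rw [map_mul, Units.val_mul, ← Finset.mul_sum] at h1
    by_contra h0
    exact hD (Units.ext (mul_right_cancel₀ h0 (h1.trans (one_mul _).symm)))
  have h2 : Tendsto (fun s : ℝ => ∑ C : ClassGroup (𝓞 K), (χ C : ℂ) *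
      (((s - 1) * ∑' I : {I : (Ideal (𝓞 K))⁰ // ClassGroup.mk0 I = C},
        (Ideal.absNorm I.1.1 : ℝ) ^ (-s) : ℝ) : ℂ)) (𝓝[>] 1)
      (𝓝 (∑ C : ClassGroup (𝓞 K), (χ C : ℂ) * (l : ℂ))) :=
    tendsto_finsetSum _ fun C _ => ((Complex.continuous_ofReal.tendsto l).comp (hl C)).const_mul _
  rw [← Finset.sum_mul, h0, zero_mul] at h2
  refine h2.congr' ?_
  filter_upwards [self_mem_nhdsWithin] with s hs
  rw [tsum_twistHom χ (fun n => by simp) hs, Finset.mul_sum]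
  refine Finset.sum_congr rfl fun C _ => ?_
  simp only [MonoidHom.one_apply, one_mul]
  push_cast
  ring

end Twist

/-! ### Comparison of Euler factors at one prime. -/

section EulerFactor

/-- The comparison of Euler factors. -/
theorem prod_norm_one_sub_mul_le {p : ℕ} (hp : p.Prime) {c t : ℂ} (hc : ‖c‖ = 1) (ht : t ^ p = 1)
    (ht1 : t ≠ 1) {x : ℝ} (hx0 : 0 ≤ x) (hx1 : x ≤ 1) :
    ∏ j ∈ Finset.range p, ‖1 - c * (t ^ j * x)‖ ≤ 1 + x ^ 2 := by
  have : Fact p.Prime := ⟨hp⟩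
  have hprim : IsPrimitiveRoot t p := by
    have := orderOf_eq_prime ht ht1
    exact this ▸ IsPrimitiveRoot.orderOf t
  have h2 : ∏ j ∈ Finset.range p, (1 - c * (t ^ j * x)) = 1 - (c * x) ^ p := by
    have h := congrArg (Polynomial.eval 1)
      (X_pow_sub_C_eq_prod hprim hp.pos (α := c * x) (a := (c * x) ^ p) rfl)
    rw [Polynomial.eval_prod] at h
    simp only [Polynomial.eval_sub, Polynomial.eval_pow, Polynomial.eval_X, Polynomial.eval_C,
      one_pow] at h
    rw [h]
    exact Finset.prod_congr rfl fun j _ => by ring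
  rw [← norm_prod, h2]
  refine (norm_sub_le _ _).trans ?_
  rw [norm_one, norm_pow, norm_mul, hc, one_mul, Complex.norm_real, Real.norm_of_nonneg hx0]
  gcongr 1 + ?_
  exact pow_le_pow_of_le_one hx0 hx1 hp.two_le

theorem pow_le_prod_one_sub {ι : Type*} {A : Finset ι} {n : ℕ} (hA : A.card ≤ n) {y : ι → ℝ}
    {x : ℝ} (hx0 : 0 ≤ x) (hx1 : x ≤ 1) (hy : ∀ i ∈ A, y i ≤ x) :
    (1 - x) ^ n ≤ ∏ i ∈ A, (1 - y i) := by
  refine (pow_le_pow_of_le_one (sub_nonneg.mpr hx1) (sub_le_self _ hx0) hA).trans ?_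
  rw [← Finset.prod_const]
  exact Finset.prod_le_prod (fun _ _ => sub_nonneg.mpr hx1) fun i hi => by
    have := hy i hi
    linarith

/-- It is applied at a prime `P` with `t = θ (N P)`, `c = χ P`, `x = N P ^ (-s)`, `w = 1 - N P ^
(-2)` and `y` the values `N 𝔓 ^ (-s)` for `𝔓` above `P`. For `t = 1` also `c = 1`, and the left
product is `(1 - x) ^ p`. For `t ≠ 0, 1` the product over `j` collapses to `‖1 - (c x) ^ p‖ ≤ 1 + x
^ 2`; one factor `w` absorbs this since `(1 + x ^ 2) * (1 - x ^ 2) ≤ 1`, and the other `p` factors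
bound the primes above, whose norm is at least `N P ^ 2`. The case `t = 0` costs a constant and will
occur only finitely often. -/
theorem prod_norm_one_sub_mul_pow_le {ι : Type*} {p : ℕ} (hp : p.Prime) {c t : ℂ} (hc : ‖c‖ = 1)
    (ht : t = 0 ∨ t ^ p = 1) (hct : t = 1 → c = 1) {x w : ℝ} (hx0 : 0 ≤ x) (hx1 : x ≤ 1 / 2)
    (hw0 : 0 ≤ w) (hw : w ≤ 1 - x ^ 2) {A : Finset ι} (hA : A.card ≤ p) {y : ι → ℝ}
    (hy1 : ∀ i ∈ A, y i ≤ x) (hy2 : t ≠ 0 → t ≠ 1 → ∀ i ∈ A, y i ≤ x ^ 2) :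
    (∏ j ∈ Finset.range p, ‖1 - c * (t ^ j * x)‖) * w ^ (p + 1) *
      (if t = 0 then (1 / 2) ^ (p + 1) else 1) ≤ ∏ i ∈ A, (1 - y i) := by
  have hw1 : w ≤ 1 := by nlinarith
  have hx2 : x ^ 2 ≤ 1 := by nlinarith
  have h1 := pow_le_prod_one_sub hA hx0 (by linarith) hy1
  have hwp : w ^ (p + 1) ≤ 1 := pow_le_one₀ hw0 hw1
  have hwp0 : 0 ≤ w ^ (p + 1) := pow_nonneg hw0 _
  by_cases h0 : t = 0
  · subst h0
    rw [if_pos rfl]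
    refine le_trans ?_ h1
    have h2 : ∏ j ∈ Finset.range p, ‖1 - c * ((0 : ℂ) ^ j * x)‖ = ‖1 - c * x‖ := by
      rw [← Nat.sub_add_cancel hp.one_le, Finset.prod_range_succ']
      simp
    have h3 : ‖1 - c * x‖ ≤ 2 := by
      refine (norm_sub_le _ _).trans ?_
      rw [norm_one, norm_mul, hc, one_mul, Complex.norm_real, Real.norm_of_nonneg hx0]
      linarith
    rw [h2]
    calc ‖1 - c * x‖ * w ^ (p + 1) * (1 / 2) ^ (p + 1) ≤ 2 * 1 * (1 / 2) ^ (p + 1) := by gcongr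
      _ = (1 / 2) ^ p := by ring
      _ ≤ (1 - x) ^ p := by gcongr; linarith
  · rw [if_neg h0, mul_one]
    have htp := ht.resolve_left h0
    by_cases h1t : t = 1
    · rw [hct h1t, h1t]
      refine le_trans ?_ h1
      have h2 : ‖(1 : ℂ) - x‖ = 1 - x := by
        rw [← Complex.ofReal_one, ← Complex.ofReal_sub, Complex.norm_real,
          Real.norm_of_nonneg (by linarith)]
      simp only [one_pow, one_mul, h2, Finset.prod_const, Finset.card_range]
      exact mul_le_of_le_one_right (pow_nonneg (by linarith) _) hwp
    · refine le_trans ?_ (pow_le_prod_one_sub hA (sq_nonneg x) hx2 (hy2 h0 h1t))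
      have h2 := prod_norm_one_sub_mul_le hp hc htp h1t hx0 (by linarith : x ≤ 1)
      calc _ ≤ (1 + x ^ 2) * (1 - x ^ 2) ^ (p + 1) := by gcongr
        _ = (1 - x ^ 2) ^ p * ((1 + x ^ 2) * (1 - x ^ 2)) := by ring
        _ ≤ (1 - x ^ 2) ^ p := by
          refine mul_le_of_le_one_right (pow_nonneg (sub_nonneg.mpr hx2) _) ?_
          nlinarith [sq_nonneg (x ^ 2)]

end EulerFactor

end NumberField

namespace NumberField

open Module Filter Topology IsDedekindDomain

/-! ### Uniform bounds for finite Euler products, and the primes above a given prime. -/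

section EulerProduct

/-- The finite products decrease as the set of primes grows, and multiplied by the absolute value of
the zeta sum at 2 they tend to 1. -/
theorem prod_one_sub_ge {K : Type*} [Field K] [NumberField K] : ∃ W : ℝ, 0 < W ∧
    ∀ S : Finset (HeightOneSpectrum (𝓞 K)),
      W ≤ ∏ P ∈ S, (1 - (Ideal.absNorm P.asIdeal : ℝ) ^ (-2 : ℝ)) := by
  have h := tendsto_prod_one_sub (twistHom (K := K) 1 1 2)
    (summable_twistHom 1 (fun n => by simp) one_lt_two)
  have hn : ∀ P : HeightOneSpectrum (𝓞 K),
      (1 : ℂ) - twistHom 1 1 2 (primeToNonZeroDivisors P) =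
        ((1 - (Ideal.absNorm P.asIdeal : ℝ) ^ (-2 : ℝ) : ℝ) : ℂ) := fun P => by
    rw [twistHom_apply]
    simp [primeToNonZeroDivisors]
  have hpos : ∀ P : HeightOneSpectrum (𝓞 K),
      0 ≤ 1 - (Ideal.absNorm P.asIdeal : ℝ) ^ (-2 : ℝ) := fun P => by
    refine sub_nonneg.mpr (Real.rpow_le_one_of_one_le_of_nonpos ?_ (by norm_num))
    exact_mod_cast Ideal.absNorm_pos_of_nonZeroDivisors (primeToNonZeroDivisors P)
  set Z : ℂ := ∑' I, twistHom (K := K) 1 1 2 I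
  have h1 : ∀ S : Finset (HeightOneSpectrum (𝓞 K)),
      ‖(∏ P ∈ S, ((1 : ℂ) - twistHom 1 1 2 (primeToNonZeroDivisors P))) * Z‖ =
        (∏ P ∈ S, (1 - (Ideal.absNorm P.asIdeal : ℝ) ^ (-2 : ℝ))) * ‖Z‖ := fun S => by
    simp_rw [hn]
    rw [norm_mul, ← Complex.ofReal_prod, Complex.norm_real,
      Real.norm_of_nonneg (Finset.prod_nonneg fun P _ => hpos P)]
  have h2 := h.norm
  simp_rw [h1, norm_one] at h2
  have h3 : Antitone fun S : Finset (HeightOneSpectrum (𝓞 K)) =>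
      (∏ P ∈ S, (1 - (Ideal.absNorm P.asIdeal : ℝ) ^ (-2 : ℝ))) * ‖Z‖ := fun S T hST => by
    refine mul_le_mul_of_nonneg_right ?_ (norm_nonneg Z)
    classical
    rw [← Finset.prod_sdiff hST]
    refine mul_le_of_le_one_left (Finset.prod_nonneg fun P _ => hpos P) ?_
    exact Finset.prod_le_one (fun P _ => hpos P) fun P _ => sub_le_self _ (by positivity)
  have h4 := h3.le_of_tendsto h2
  have hZ : 0 < ‖Z‖ := by
    refine (norm_nonneg Z).lt_of_ne fun h0 => ?_
    have := h4 ∅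
    rw [← h0, mul_zero] at this
    linarith
  refine ⟨‖Z‖⁻¹, inv_pos.mpr hZ, fun S => ?_⟩
  rw [inv_eq_one_div, div_le_iff₀ hZ]
  exact h4 S

/-- If the character vanishes, `q` divides the order of the residue field, so `q` is zero in it and
the prime divides `(q)`. -/
theorem finite_setOf_apply_absNorm_eq_zero {K : Type*} [Field K] [NumberField K] {q : ℕ}
    (hq : q.Prime) (θ : DirichletCharacter ℂ q) :
    {P : HeightOneSpectrum (𝓞 K) | θ (Ideal.absNorm P.asIdeal : ZMod q) = 0}.Finite := by
  have : Fact q.Prime := ⟨hq⟩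
  have hq0 : (Ideal.span {(q : 𝓞 K)}) ≠ 0 := by
    rw [Ne, Ideal.zero_eq_bot, Ideal.span_singleton_eq_bot]
    exact_mod_cast hq.ne_zero
  refine (Ideal.finite_factors hq0).subset fun P hP => ?_
  have h1 : ¬ IsUnit ((Ideal.absNorm P.asIdeal : ℕ) : ZMod q) := fun h =>
    (h.map θ).ne_zero hP
  have h2 : q ∣ Ideal.absNorm P.asIdeal := by
    rw [isUnit_iff_ne_zero, not_not] at h1
    exact (ZMod.natCast_eq_zero_iff _ _).mp h1
  refine Ideal.dvd_span_singleton.mpr ?_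
  have hfin : Finite (𝓞 K ⧸ P.asIdeal) := Ideal.finiteQuotientOfFreeOfNeBot _ P.ne_bot
  rw [Ideal.absNorm_apply, Submodule.cardQuot_apply] at h2
  obtain ⟨x, hx⟩ := exists_prime_addOrderOf_dvd_card' (G := 𝓞 K ⧸ P.asIdeal) q h2
  have h3 := addOrderOf_nsmul_eq_zero x
  rw [hx, nsmul_eq_mul] at h3
  have hx0 : x ≠ 0 := by
    rintro rfl
    rw [addOrderOf_zero] at hx
    exact hq.one_lt.ne hx
  have := (mul_eq_zero.mp h3).resolve_right hx0
  rw [← map_natCast (Ideal.Quotient.mk P.asIdeal)] at this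
  exact Ideal.Quotient.eq_zero_iff_mem.mp this

variable {K L : Type*} [Field K] [NumberField K] [Field L] [NumberField L] [Algebra K L]

variable (K L) in
theorem finite_setOf_under_eq (P : HeightOneSpectrum (𝓞 K)) :
    {w : HeightOneSpectrum (𝓞 L) | w.under (𝓞 K) = P}.Finite := by
  refine Set.Finite.of_finite_image (f := HeightOneSpectrum.asIdeal) ?_
    fun _ _ _ _ h => HeightOneSpectrum.ext h
  refine (IsDedekindDomain.primesOver_finite P.asIdeal (𝓞 L)).subset ?_
  rintro _ ⟨w, hw, rfl⟩
  exact ⟨w.isPrime, ⟨(congrArg HeightOneSpectrum.asIdeal hw).symm⟩⟩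

variable (K L) in
/-- The primes of `L` above a prime of `K`. -/
noncomputable def primesAbove (P : HeightOneSpectrum (𝓞 K)) : Finset (HeightOneSpectrum (𝓞 L)) :=
  (finite_setOf_under_eq K L P).toFinset

theorem mem_primesAbove {P : HeightOneSpectrum (𝓞 K)} {w : HeightOneSpectrum (𝓞 L)} :
    w ∈ primesAbove K L P ↔ w.under (𝓞 K) = P := by
  rw [primesAbove, Set.Finite.mem_toFinset, Set.mem_ofPred_eq]

theorem liesOver_of_mem_primesAbove {P : HeightOneSpectrum (𝓞 K)} {w : HeightOneSpectrum (𝓞 L)}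
    (h : w ∈ primesAbove K L P) : w.asIdeal.LiesOver P.asIdeal :=
  ⟨(congrArg HeightOneSpectrum.asIdeal (mem_primesAbove.mp h)).symm⟩

theorem card_primesAbove_le (P : HeightOneSpectrum (𝓞 K)) :
    (primesAbove K L P).card ≤ finrank K L := by
  classical
  have : P.asIdeal.IsMaximal := P.isMaximal
  have : NoZeroSMulDivisors (𝓞 K) (𝓞 L) := ⟨fun h => smul_eq_zero.mp h⟩
  refine le_trans ?_ (Ideal.card_primesOverFinset_le_finrank (S := 𝓞 L) K L P.ne_bot)
  refine Finset.card_le_card_of_injOn HeightOneSpectrum.asIdeal (fun w hw => ?_)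
    fun _ _ _ _ h => HeightOneSpectrum.ext h
  exact (IsDedekindDomain.mem_primesOverFinset_iff P.ne_bot _).mpr ⟨w.isPrime, liesOver_of_mem_primesAbove hw⟩

theorem tendsto_biUnion_primesAbove [DecidableEq (HeightOneSpectrum (𝓞 L))] :
    Tendsto (fun S : Finset (HeightOneSpectrum (𝓞 K)) => S.biUnion (primesAbove K L))
      atTop atTop := by
  refine tendsto_atTop_finset_of_monotone (fun S T h => Finset.biUnion_subset_biUnion_of_subset_left
    _ h) fun w => ⟨{w.under (𝓞 K)}, ?_⟩
  rw [Finset.singleton_biUnion]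
  exact mem_primesAbove.mpr rfl

theorem exists_absNorm_eq_pow {P : HeightOneSpectrum (𝓞 K)} {w : HeightOneSpectrum (𝓞 L)}
    (h : w ∈ primesAbove K L P) : ∃ f : ℕ, 0 < f ∧
      Ideal.absNorm w.asIdeal = Ideal.absNorm P.asIdeal ^ f := by
  have := liesOver_of_mem_primesAbove h
  refine ⟨P.asIdeal.inertiaDeg' w.asIdeal, Nat.pos_of_ne_zero fun h0 => ?_,
    Ideal.absNorm_eq_pow_inertiaDeg'_of_liesOver _ _ P.isPrime P.ne_bot⟩
  have h1 := Ideal.absNorm_eq_pow_inertiaDeg'_of_liesOver w.asIdeal P.asIdeal P.isPrime P.ne_bot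
  rw [h0, pow_zero] at h1
  exact w.isPrime.ne_top (Ideal.absNorm_eq_one_iff.mp h1)

end EulerProduct

end NumberField

namespace NumberField

open Module Filter Topology IsDedekindDomain

/-! ### Analytic proof that the norm on class groups is onto. -/

section NormSurjective

variable {K L : Type*} [Field K] [NumberField K] [Field L] [NumberField L] [Algebra K L]

/-- This is ζ_L(s) ≤ c·∏_j |L(s, χθ^j)| with `c` independent of `s`: multiply the local comparisons
over a finite set of primes of `K` and let it grow. The correction factors are bounded below by the
convergent Euler product at 2 and by the finiteness of the set of primes where `θ` vanishes. -/
theorem exists_norm_tsum_le_prod {p : ℕ} (hp : p.Prime) (hKL : finrank K L ≤ p) {q : ℕ}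
    (hq : q.Prime) {θ : DirichletCharacter ℂ q} (hθ : ∀ a, θ a = 0 ∨ θ a ^ p = 1)
    {ψ : ℕ →* ℂ} (hψ : ∀ n : ℕ, ψ n = θ n)
    (h1 : ∀ w : HeightOneSpectrum (𝓞 L), θ (Ideal.absNorm w.asIdeal : ZMod q) = 0 ∨
      θ (Ideal.absNorm w.asIdeal : ZMod q) = 1)
    {χ : ClassGroup (𝓞 K) →* ℂˣ} (hχ : ∀ P : HeightOneSpectrum (𝓞 K),
      θ (Ideal.absNorm P.asIdeal : ZMod q) = 1 →
        χ (ClassGroup.mk0 (primeToNonZeroDivisors P)) = 1) :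
    ∃ c : ℝ, ∀ s : ℝ, 1 < s → ‖∑' I, twistHom (K := L) 1 1 s I‖ ≤
      c * ∏ j ∈ Finset.range p, ‖∑' I, twistHom χ (ψ ^ j) s I‖ := by
  classical
  obtain ⟨W, hW0, hW⟩ := prod_one_sub_ge (K := K)
  set T := (finite_setOf_apply_absNorm_eq_zero (K := K) hq θ).toFinset with hT
  set κ : ℝ := ((1 / 2) ^ (p + 1)) ^ T.card with hκ
  have hκ0 : 0 < κ := by positivity
  have hψ1 : ∀ j n, ‖(ψ ^ j) n‖ ≤ 1 := fun j n => by
    rw [MonoidHom.pow_apply, norm_pow, hψ]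
    exact pow_le_one₀ (norm_nonneg _) (DirichletCharacter.norm_le_one θ _)
  refine ⟨(W ^ (p + 1) * κ)⁻¹, fun s hs => ?_⟩
  have hs0 : -s ≤ 0 := by linarith
  have hN : ∀ P : HeightOneSpectrum (𝓞 K), (2 : ℝ) ≤ Ideal.absNorm P.asIdeal := fun P => by
    have h0 := Ideal.absNorm_pos_of_nonZeroDivisors (primeToNonZeroDivisors P)
    have h2 : Ideal.absNorm P.asIdeal ≠ 1 := fun h =>
      P.isPrime.ne_top (Ideal.absNorm_eq_one_iff.mp h)
    change 0 < Ideal.absNorm P.asIdeal at h0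
    exact_mod_cast (by lia : 2 ≤ Ideal.absNorm P.asIdeal)
  have hL : ∀ w : HeightOneSpectrum (𝓞 L),
      ‖(1 : ℂ) - twistHom 1 1 s (primeToNonZeroDivisors w)‖ =
        1 - (Ideal.absNorm w.asIdeal : ℝ) ^ (-s) := fun w => by
    have e : (1 : ℂ) - twistHom 1 1 s (primeToNonZeroDivisors w) =
        ((1 - (Ideal.absNorm w.asIdeal : ℝ) ^ (-s) : ℝ) : ℂ) := by
      rw [twistHom_apply]
      simp [primeToNonZeroDivisors]
    rw [e, Complex.norm_real, Real.norm_of_nonneg]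
    refine sub_nonneg.mpr (Real.rpow_le_one_of_one_le_of_nonpos ?_ hs0)
    exact_mod_cast Ideal.absNorm_pos_of_nonZeroDivisors (primeToNonZeroDivisors w)
  have hloc : ∀ P : HeightOneSpectrum (𝓞 K),
      (∏ j ∈ Finset.range p, ‖1 - twistHom χ (ψ ^ j) s (primeToNonZeroDivisors P)‖) *
        (1 - (Ideal.absNorm P.asIdeal : ℝ) ^ (-2 : ℝ)) ^ (p + 1) *
        (if P ∈ T then (1 / 2) ^ (p + 1) else 1) ≤
      ∏ w ∈ primesAbove K L P, ‖(1 : ℂ) - twistHom 1 1 s (primeToNonZeroDivisors w)‖ := by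
    intro P
    have hP0 : (0 : ℝ) ≤ Ideal.absNorm P.asIdeal := Nat.cast_nonneg _
    have hP1 : (1 : ℝ) ≤ Ideal.absNorm P.asIdeal := by linarith [hN P]
    simp_rw [hL]
    have hTP : P ∈ T ↔ θ (Ideal.absNorm P.asIdeal : ZMod q) = 0 := by
      rw [hT, Set.Finite.mem_toFinset, Set.mem_ofPred_eq]
    simp_rw [hTP]
    have key := prod_norm_one_sub_mul_pow_le hp (c := (χ (ClassGroup.mk0 (primeToNonZeroDivisors P)) : ℂ))
      (t := θ (Ideal.absNorm P.asIdeal : ZMod q)) (norm_classGroup_char χ _) (hθ _)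
      (fun h => by rw [hχ P h, Units.val_one])
      (x := (Ideal.absNorm P.asIdeal : ℝ) ^ (-s))
      (w := 1 - (Ideal.absNorm P.asIdeal : ℝ) ^ (-2 : ℝ)) (by positivity) ?_ ?_ ?_
      ((card_primesAbove_le (L := L) P).trans hKL)
      (y := fun w => (Ideal.absNorm w.asIdeal : ℝ) ^ (-s)) ?_ ?_
    · refine le_trans (le_of_eq ?_) key
      congr 2
      refine Finset.prod_congr rfl fun j _ => ?_
      rw [twistHom_apply, MonoidHom.pow_apply, hψ]
      rfl
    · calc (Ideal.absNorm P.asIdeal : ℝ) ^ (-s) ≤ (2 : ℝ) ^ (-s) :=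
            Real.rpow_le_rpow_of_nonpos two_pos (hN P) hs0
        _ ≤ (2 : ℝ) ^ (-1 : ℝ) :=
            Real.rpow_le_rpow_of_exponent_le one_le_two (by linarith)
        _ = 1 / 2 := by rw [Real.rpow_neg_one]; norm_num
    · exact sub_nonneg.mpr (Real.rpow_le_one_of_one_le_of_nonpos hP1 (by norm_num))
    · rw [← Real.rpow_natCast, ← Real.rpow_mul hP0]
      refine sub_le_sub_left (Real.rpow_le_rpow_of_exponent_le hP1 ?_) 1
      push_cast
      linarith
    · intro w hw
      obtain ⟨f, hf, hfw⟩ := exists_absNorm_eq_pow hw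
      refine Real.rpow_le_rpow_of_nonpos (by linarith) ?_ hs0
      rw [hfw]
      push_cast
      exact le_self_pow₀ hP1 hf.ne'
    · intro ht0 ht1 w hw
      obtain ⟨f, hf, hfw⟩ := exists_absNorm_eq_pow hw
      -- A prime of residue degree one has the norm of `P`, but on norms of primes of `L` the
      -- character takes only the values 0 and 1.
      have hf2 : 2 ≤ f := by
        by_contra hlt
        obtain rfl : f = 1 := by lia
        have h := h1 w
        rw [hfw, pow_one] at h
        exact h.elim ht0 ht1
      rw [← Real.rpow_natCast, ← Real.rpow_mul hP0, mul_comm, Real.rpow_mul hP0]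
      refine Real.rpow_le_rpow_of_nonpos (by positivity) ?_ hs0
      rw [hfw]
      push_cast
      rw [Real.rpow_two]
      exact pow_le_pow_right₀ hP1 hf2
  have hκS : ∀ S : Finset (HeightOneSpectrum (𝓞 K)),
      κ ≤ ∏ P ∈ S, (if P ∈ T then (1 / 2 : ℝ) ^ (p + 1) else 1) := fun S => by
    rw [Finset.prod_ite, Finset.prod_const_one, mul_one, Finset.prod_const, hκ]
    refine pow_le_pow_of_le_one (by positivity)
      (pow_le_one₀ (by norm_num) (by norm_num)) (Finset.card_le_card fun P hP => ?_)
    exact (Finset.mem_filter.mp hP).2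
  have hglob : ∀ S : Finset (HeightOneSpectrum (𝓞 K)),
      (∏ j ∈ Finset.range p, ‖(∏ P ∈ S,
        (1 - twistHom χ (ψ ^ j) s (primeToNonZeroDivisors P)))‖) * (W ^ (p + 1) * κ) ≤
      ‖∏ w ∈ S.biUnion (primesAbove K L),
        ((1 : ℂ) - twistHom 1 1 s (primeToNonZeroDivisors w))‖ := by
    intro S
    rw [Finset.prod_biUnion, norm_prod]
    swap
    · intro P _ P' _ hne
      exact Finset.disjoint_left.mpr fun w hw hw' =>
        hne ((mem_primesAbove.mp hw).symm.trans (mem_primesAbove.mp hw'))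
    simp_rw [norm_prod]
    rw [Finset.prod_comm]
    refine le_trans ?_ (Finset.prod_le_prod (fun P _ => ?_) fun P _ => hloc P)
    · rw [Finset.prod_mul_distrib, Finset.prod_mul_distrib, mul_assoc, Finset.prod_pow]
      have := hW S
      have := hκS S
      have hw0 : 0 ≤ ∏ P ∈ S, (1 - (Ideal.absNorm P.asIdeal : ℝ) ^ (-2 : ℝ)) :=
        hW0.le.trans (hW S)
      gcongr
    · have h0 : 0 ≤ 1 - (Ideal.absNorm P.asIdeal : ℝ) ^ (-2 : ℝ) := by
        refine sub_nonneg.mpr (Real.rpow_le_one_of_one_le_of_nonpos ?_ (by norm_num))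
        linarith [hN P]
      have h2 : 0 ≤ (if P ∈ T then (1 / 2 : ℝ) ^ (p + 1) else 1) := by split_ifs <;> positivity
      have h3 : 0 ≤ ∏ j ∈ Finset.range p,
        ‖1 - twistHom χ (ψ ^ j) s (primeToNonZeroDivisors P)‖ :=
          Finset.prod_nonneg fun j _ => norm_nonneg _
      positivity
  have hlim1 := ((tendsto_prod_one_sub (twistHom (K := L) 1 1 s)
    (summable_twistHom 1 (fun n => by simp) hs)).comp
      (tendsto_biUnion_primesAbove (K := K) (L := L))).norm
  have hlim2 : Tendsto (fun S : Finset (HeightOneSpectrum (𝓞 K)) =>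
      ∏ j ∈ Finset.range p, ‖(∏ P ∈ S,
        (1 - twistHom χ (ψ ^ j) s (primeToNonZeroDivisors P))) * ∑' I, twistHom χ (ψ ^ j) s I‖)
      atTop (𝓝 (∏ j ∈ Finset.range p, ‖(1 : ℂ)‖)) :=
    tendsto_finsetProd _ fun j _ => (tendsto_prod_one_sub (twistHom χ (ψ ^ j) s)
      (summable_twistHom χ (hψ1 j) hs)).norm
  set Z := ‖∑' I, twistHom (K := L) 1 1 s I‖ with hZ
  set Λ := ∏ j ∈ Finset.range p, ‖∑' I, twistHom χ (ψ ^ j) s I‖ with hΛ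
  have hfin := le_of_tendsto_of_tendsto'
    (hlim2.mul_const ((W ^ (p + 1) * κ) * Z)) (hlim1.mul_const Λ) fun S => by
      simp only [Function.comp_apply]
      rw [norm_mul, ← hZ]
      simp_rw [norm_mul]
      rw [Finset.prod_mul_distrib, ← hΛ]
      have h3 := hglob S
      have hΛ0 : 0 ≤ Λ := Finset.prod_nonneg fun j _ => norm_nonneg _
      have hZ0 : 0 ≤ Z := norm_nonneg _
      calc _ = ((∏ j ∈ Finset.range p, ‖(∏ P ∈ S,
        (1 - twistHom χ (ψ ^ j) s (primeToNonZeroDivisors P)))‖) * (W ^ (p + 1) * κ)) * (Z * Λ) := by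
            ring
        _ ≤ _ := mul_le_mul_of_nonneg_right h3 (mul_nonneg hZ0 hΛ0)
        _ = _ := by ring
  simp only [norm_one, Finset.prod_const_one, one_mul] at hfin
  rwa [inv_mul_eq_div, le_div_iff₀ (by positivity), mul_comm]

/-- Surjectivity of the norm on ideal classes for an extension of prime degree that is cut out by a
Dirichlet character which is nontrivial on norms of integers. -/
theorem classGroupNorm_surjective {p : ℕ} (hp : p.Prime) (hp2 : Odd p) (hKL : finrank K L ≤ p)
    {q : ℕ} (hq : q.Prime) {θ : DirichletCharacter ℂ q} (hθ : ∀ a, θ a = 0 ∨ θ a ^ p = 1)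
    (h1 : ∀ w : HeightOneSpectrum (𝓞 L), θ (Ideal.absNorm w.asIdeal : ZMod q) = 0 ∨
      θ (Ideal.absNorm w.asIdeal : ZMod q) = 1)
    (h2 : ∀ P : HeightOneSpectrum (𝓞 K), θ (Ideal.absNorm P.asIdeal : ZMod q) = 1 →
      ∃ J : Ideal (𝓞 L), Ideal.relNorm (𝓞 K) J = P.asIdeal)
    (h3 : ∃ β : 𝓞 K, IsCoprime (Algebra.norm ℤ β) (q : ℤ) ∧
      θ ((Algebra.norm ℤ β : ℤ) : ZMod q) ≠ 1) :
    Function.Surjective (IwasawaThaine.classGroupNorm (𝓞 K) (𝓞 L)) := by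
  classical
  by_contra hsurj
  have hne : (IwasawaThaine.classGroupNorm (𝓞 K) (𝓞 L)).range ≠ ⊤ := fun h =>
    hsurj (MonoidHom.range_eq_top.mp h)
  obtain ⟨C, hC⟩ : ∃ C, C ∉ (IwasawaThaine.classGroupNorm (𝓞 K) (𝓞 L)).range := by
    by_contra! h
    exact hne (eq_top_iff.mpr fun c _ => h c)
  obtain ⟨χ', hχ'⟩ := CommGroup.exists_apply_ne_one_of_hasEnoughRootsOfUnity
    (ClassGroup (𝓞 K) ⧸ (IwasawaThaine.classGroupNorm (𝓞 K) (𝓞 L)).range) ℂ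
    (a := QuotientGroup.mk C) fun h => hC ((QuotientGroup.eq_one_iff C).mp h)
  set χ : ClassGroup (𝓞 K) →* ℂˣ := χ'.comp (QuotientGroup.mk' _) with hχ
  have hχ1 : χ ≠ 1 := fun h => hχ' (DFunLike.congr_fun h C)
  have hχ0 : ∀ c, χ (IwasawaThaine.classGroupNorm (𝓞 K) (𝓞 L) c) = 1 := fun c => by
    have : (QuotientGroup.mk (IwasawaThaine.classGroupNorm (𝓞 K) (𝓞 L) c) : ClassGroup (𝓞 K) ⧸
      (IwasawaThaine.classGroupNorm (𝓞 K) (𝓞 L)).range) = 1 :=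
        (QuotientGroup.eq_one_iff _).mpr ⟨c, rfl⟩
    rw [hχ, MonoidHom.comp_apply, QuotientGroup.coe_mk', this, map_one]
  have hχP : ∀ P : HeightOneSpectrum (𝓞 K), θ (Ideal.absNorm P.asIdeal : ZMod q) = 1 →
      χ (ClassGroup.mk0 (primeToNonZeroDivisors P)) = 1 := fun P hP => by
    obtain ⟨J, hJ⟩ := h2 P hP
    have hJ0 : J ≠ 0 := by
      rintro rfl
      exact P.ne_bot (hJ.symm.trans (map_zero _))
    have e : primeToNonZeroDivisors P =
        IwasawaThaine.idealNorm (𝓞 K) (𝓞 L) ⟨J, mem_nonZeroDivisors_of_ne_zero hJ0⟩ :=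
      Subtype.ext hJ.symm
    rw [e, ← IwasawaThaine.classGroupNorm_mk0, hχ0]
  -- Since `p` is odd, `θ (-1) = θ ((-1) ^ p) = θ (-1) ^ p`, and this is 1.
  have hθ1 : θ (-1) = 1 := by
    have h := hp2.neg_one_pow (α := ZMod q)
    have h' := congrArg θ h
    rw [map_pow] at h'
    rcases hθ (-1) with h0 | h0
    · exact absurd h0 ((isUnit_one.neg.map θ).ne_zero)
    · exact h'.symm.trans h0
  let ψ : ℕ →* ℂ := (θ : ZMod q →* ℂ).comp (Nat.castRingHom (ZMod q) : ℕ →* ZMod q)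
  have hψ : ∀ n : ℕ, ψ n = θ n := fun n => rfl
  obtain ⟨β, hβ0, hβ1⟩ := h3
  have hβθ : θ ((Algebra.norm ℤ β : ℤ) : ZMod q) ≠ 0 := by
    refine ((IsUnit.map θ ?_)).ne_zero
    obtain ⟨u, v, huv⟩ := hβ0
    refine IsUnit.of_mul_eq_one (u : ZMod q) ?_
    have := congrArg (Int.cast : ℤ → ZMod q) huv
    push_cast at this
    rwa [ZMod.natCast_self, mul_zero, add_zero, mul_comm] at this
  -- For `0 < j < p` the exponent is prime to `p`, so `θ ^ j` is still nontrivial on the norm of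
  -- `β`, and the twisted series is bounded near 1 whatever `χ` is.
  have hB : ∀ j : ℕ, ∃ B : ℝ, j ∈ Finset.Ico 1 p → ∀ s : ℝ, 1 < s → s ≤ 2 →
      ‖∑' I, twistHom χ (ψ ^ j) s I‖ ≤ B := fun j => by
    by_cases hj : j ∈ Finset.Ico 1 p
    · obtain ⟨hj1, hjp⟩ := Finset.mem_Ico.mp hj
      obtain ⟨B, hB⟩ := exists_norm_tsum_twistHom_le χ hq (θ := θ ^ j)
        (by rw [MulChar.pow_apply' _ (by lia), hθ1, one_pow]) β hβ0 (by
          rw [MulChar.pow_apply' _ (by lia)]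
          intro h
          have h' := (hθ _).resolve_left hβθ
          have hcop : Nat.Coprime j p := 
            (Nat.coprime_of_lt_prime (by lia) hjp hp).symm
          have := pow_gcd_eq_one.mpr ⟨h, h'⟩
          rw [hcop, pow_one] at this
          exact hβ1 this) (ψ := ψ ^ j) (fun n => by
            rw [MonoidHom.pow_apply, hψ, MulChar.pow_apply' _ (by lia)])
      exact ⟨B, fun _ => hB⟩
    · exact ⟨0, fun h => absurd h hj⟩
  choose B hB using hB
  obtain ⟨c, hc⟩ := exists_norm_tsum_le_prod (L := L) hp hKL hq hθ hψ h1 hχP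
  obtain ⟨l, hl0, hl⟩ := exists_tendsto_sub_one_mul_tsum_absNorm L
  have hlim := (tendsto_sub_one_mul_tsum_twistHom_one hχ1).norm
  have hcont : Tendsto (fun s : ℝ => (|c| * ∏ j ∈ Finset.Ico 1 p, |B j|) *
      ‖((s - 1 : ℝ) : ℂ) * ∑' I, twistHom χ 1 s I‖) (𝓝[>] 1) (𝓝 0) := by
    have := hlim.const_mul (|c| * ∏ j ∈ Finset.Ico 1 p, |B j|)
    rwa [norm_zero, mul_zero] at this
  -- The residue of the zeta function of `L` is positive, yet it is bounded by a multiple of the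
  -- limit of `|(s - 1) L(s, χ)|`, which is zero.
  refine absurd (le_of_tendsto_of_tendsto hl hcont ?_) (not_le.mpr hl0)
  have hmem : Set.Ioc (1 : ℝ) 2 ∈ 𝓝[>] (1 : ℝ) := Ioc_mem_nhdsGT one_lt_two
  filter_upwards [hmem] with s hs
  have hs1 : 0 ≤ s - 1 := by linarith [hs.1]
  have hZ : ∑' I : (Ideal (𝓞 L))⁰, (Ideal.absNorm I.1 : ℝ) ^ (-s) =
      ‖∑' I, twistHom (K := L) 1 1 s I‖ := by
    have : ∑' I, twistHom (K := L) 1 1 s I =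
        ((∑' I : (Ideal (𝓞 L))⁰, (Ideal.absNorm I.1 : ℝ) ^ (-s) : ℝ) : ℂ) := by
      rw [Complex.ofReal_tsum]
      exact tsum_congr fun I => by simp [twistHom_apply]
    rw [this, Complex.norm_real, Real.norm_of_nonneg (tsum_nonneg fun I => by positivity)]
  rw [hZ, norm_mul, Complex.norm_real, Real.norm_of_nonneg hs1]
  have hprod : ∏ j ∈ Finset.range p, ‖∑' I, twistHom χ (ψ ^ j) s I‖ ≤
      ‖∑' I, twistHom χ 1 s I‖ * ∏ j ∈ Finset.Ico 1 p, |B j| := by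
    rw [Finset.range_eq_Ico, Finset.prod_eq_prod_Ico_succ_bot hp.pos, pow_zero]
    gcongr with j hj
    exact (hB j hj s hs.1 hs.2).trans (le_abs_self _)
  have h4 : ‖∑' I, twistHom (K := L) 1 1 s I‖ ≤
      |c| * (‖∑' I, twistHom χ 1 s I‖ * ∏ j ∈ Finset.Ico 1 p, |B j|) :=
    (hc s hs.1).trans (mul_le_mul (le_abs_self c) hprod
      (Finset.prod_nonneg fun _ _ => norm_nonneg _) (abs_nonneg c))
  calc _ ≤ (s - 1) * (|c| * (‖∑' I, twistHom χ 1 s I‖ * ∏ j ∈ Finset.Ico 1 p, |B j|)) :=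
        mul_le_mul_of_nonneg_left h4 hs1
    _ = _ := by ring

end NormSurjective

end NumberField

namespace IwasawaThaine

open Module

/-! ### Galois action, extension and norm on integers and on ideals -/

/-- The map induced on class groups by a ring isomorphism passes through fractional ideals; this
brings it down to integral ideals. -/
theorem ringEquivOfRingEquiv_coeIdeal {R R' : Type*} [CommRing R] [CommRing R'] [IsDedekindDomain R]
    [IsDedekindDomain R'] (g : R ≃+* R') (I : Ideal R) :
    FractionalIdeal.ringEquivOfRingEquiv (FractionRing R) (FractionRing R') g
      (I : FractionalIdeal R⁰ (FractionRing R)) =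
        ((I.map g : Ideal R') : FractionalIdeal R'⁰ (FractionRing R')) := by
  have key : ∀ r : R, IsFractionRing.ringEquivOfRingEquiv (K := FractionRing R)
      (L := FractionRing R') g (algebraMap R (FractionRing R) r) =
      algebraMap R' (FractionRing R') (g r) := fun r =>
    IsFractionRing.ringEquivOfRingEquiv_algebraMap g r
  ext z
  rw [FractionalIdeal.mem_coeIdeal]
  change z ∈ Submodule.map _ _ ↔ _
  constructor
  · rintro ⟨y, hy, rfl⟩
    obtain ⟨r, hr, rfl⟩ := (FractionalIdeal.mem_coeIdeal _).mp hy
    exact ⟨g r, Ideal.mem_map_of_mem g hr, (key r).symm⟩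
  · rintro ⟨w, hw, rfl⟩
    obtain ⟨r, hr, rfl⟩ := (Ideal.mem_map_of_equiv g w).mp hw
    exact ⟨_, (FractionalIdeal.mem_coeIdeal _).mpr ⟨r, hr, rfl⟩, key r⟩

theorem mulEquiv_mk0 {R R' : Type*} [CommRing R] [CommRing R'] [IsDedekindDomain R]
    [IsDedekindDomain R'] (g : R ≃+* R') (I : (Ideal R)⁰) (J : (Ideal R')⁰) (h : J.1 = I.1.map g) :
    ClassGroup.mulEquiv g (ClassGroup.mk0 I) = ClassGroup.mk0 J := by
  apply (ClassGroup.equiv (FractionRing R')).injective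
  rw [ClassGroup.equiv_mk0, ClassGroup.mulEquiv, MulEquiv.trans_apply, MulEquiv.trans_apply,
    MulEquiv.apply_symm_apply, ClassGroup.equiv_mk0]
  refine congrArg _ (Units.ext ?_)
  refine (ringEquivOfRingEquiv_coeIdeal g I.1).trans ?_
  rw [← h]
  rfl

section Basics

variable {E E' : GaloisNF}

/-- The action of an automorphism of `ℚ̄` on the integers of a Galois number field. -/
noncomputable def galInt (σ : QBar ≃ₐ[ℚ] QBar) (E : GaloisNF) : 𝓞 E ≃+* 𝓞 E :=
  RingOfIntegers.mapRingEquiv (σ.restrictNormal E).toRingEquiv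

/-- The inclusion of rings of integers. -/
noncomputable def extInt (h : E ≤ E') : 𝓞 E →+* 𝓞 E' := RingOfIntegers.mapRingHom (incl h)

theorem coe_restrictNormal (σ : QBar ≃ₐ[ℚ] QBar) (E : GaloisNF) (x : E) :
    ((σ.restrictNormal E x : E) : QBar) = σ (x : QBar) :=
  AlgEquiv.restrictNormal_commutes σ E x

theorem coe_galInt (σ : QBar ≃ₐ[ℚ] QBar) (x : 𝓞 E) :
    ((galInt σ E x : E) : QBar) = σ ((x : E) : QBar) :=
  coe_restrictNormal σ E x

theorem coe_extInt (h : E ≤ E') (x : 𝓞 E) : ((extInt h x : E') : QBar) = ((x : E) : QBar) := rfl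

theorem int_ext {x y : 𝓞 E} (h : ((x : E) : QBar) = ((y : E) : QBar)) : x = y :=
  RingOfIntegers.ext (Subtype.ext h)

theorem extInt_injective (h : E ≤ E') : Function.Injective (extInt h) := fun _ _ hxy =>
  int_ext (congrArg (fun z : 𝓞 E' => ((z : E') : QBar)) hxy)

/-- The action of an automorphism of `ℚ̄` on nonzero ideals. -/
noncomputable def galIdeal (σ : QBar ≃ₐ[ℚ] QBar) (E : GaloisNF) :
    (Ideal (𝓞 E))⁰ →* (Ideal (𝓞 E))⁰ where
  toFun I := ⟨I.1.map (galInt σ E), mem_nonZeroDivisors_of_ne_zero fun h =>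
    nonZeroDivisors.coe_ne_zero I
      ((Ideal.map_eq_bot_iff_of_injective (galInt σ E).injective).mp h)⟩
  map_one' := Subtype.ext (by simp [Ideal.one_eq_top, Ideal.map_top])
  map_mul' I J := Subtype.ext (Ideal.map_mul _ _ _)

/-- Extension of nonzero ideals. -/
noncomputable def extIdeal (h : E ≤ E') : (Ideal (𝓞 E))⁰ →* (Ideal (𝓞 E'))⁰ where
  toFun I := ⟨I.1.map (extInt h), mem_nonZeroDivisors_of_ne_zero fun h0 =>
    nonZeroDivisors.coe_ne_zero I
      ((Ideal.map_eq_bot_iff_of_injective (extInt_injective h)).mp h0)⟩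
  map_one' := Subtype.ext (by simp [Ideal.one_eq_top, Ideal.map_top])
  map_mul' I J := Subtype.ext (Ideal.map_mul _ _ _)

/-- The norm of nonzero ideals. -/
noncomputable def normIdeal (h : E ≤ E') : (Ideal (𝓞 E'))⁰ →* (Ideal (𝓞 E))⁰ :=
  letI : Algebra E E' := (incl h).toAlgebra
  idealNorm (𝓞 E) (𝓞 E')

/-- The norm of integers. -/
noncomputable def normInt (h : E ≤ E') : 𝓞 E' →* 𝓞 E :=
  letI : Algebra E E' := (incl h).toAlgebra
  Algebra.intNorm (𝓞 E) (𝓞 E')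

/-- The nonzero principal ideal generated by an element. -/
noncomputable def principal {R : Type*} [CommRing R] [IsDomain R] (x : R) (hx : x ≠ 0) :
    (Ideal R)⁰ :=
  ⟨Ideal.span {x}, mem_nonZeroDivisors_of_ne_zero (mt Ideal.span_singleton_eq_bot.mp hx)⟩

theorem coe_galIdeal (σ : QBar ≃ₐ[ℚ] QBar) (I : (Ideal (𝓞 E))⁰) :
    (galIdeal σ E I).1 = I.1.map (galInt σ E) := rfl

theorem coe_extIdeal (h : E ≤ E') (I : (Ideal (𝓞 E))⁰) :
    (extIdeal h I).1 = I.1.map (extInt h) := rfl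

theorem galIdeal_principal (σ : QBar ≃ₐ[ℚ] QBar) {x : 𝓞 E} (hx : x ≠ 0) :
    (galIdeal σ E (principal x hx)).1 = Ideal.span {galInt σ E x} := by
  rw [coe_galIdeal, principal, Ideal.map_span, Set.image_singleton]

theorem extIdeal_principal (h : E ≤ E') {x : 𝓞 E} (hx : x ≠ 0) :
    (extIdeal h (principal x hx)).1 = Ideal.span {extInt h x} := by
  rw [coe_extIdeal, principal, Ideal.map_span, Set.image_singleton]

theorem normIdeal_principal (h : E ≤ E') {x : 𝓞 E'} (hx : x ≠ 0) :
    (normIdeal h (principal x hx)).1 = Ideal.span {normInt h x} :=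
  let : Algebra E E' := (incl h).toAlgebra
  Ideal.relNorm_singleton (𝓞 E) x

theorem normInt_ne_zero (h : E ≤ E') {x : 𝓞 E'} (hx : x ≠ 0) : normInt h x ≠ 0 :=
  let : Algebra E E' := (incl h).toAlgebra
  Algebra.intNorm_ne_zero.mpr hx

theorem normCl_mk0 (h : E ≤ E') (I : (Ideal (𝓞 E'))⁰) :
    normCl h (ClassGroup.mk0 I) = ClassGroup.mk0 (normIdeal h I) :=
  let : Algebra E E' := (incl h).toAlgebra
  classGroupNorm_mk0 (𝓞 E) (𝓞 E') I

theorem liftCl_mk0 (h : E ≤ E') (I : (Ideal (𝓞 E))⁰) :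
    liftCl h (ClassGroup.mk0 I) = ClassGroup.mk0 (extIdeal h I) :=
  let : Algebra E E' := (incl h).toAlgebra
  ClassGroup.extendedHom_mk0 (𝓞 E) (𝓞 E') I

theorem galCl_mk0 (σ : QBar ≃ₐ[ℚ] QBar) (I : (Ideal (𝓞 E))⁰) :
    galCl σ E (ClassGroup.mk0 I) = ClassGroup.mk0 (galIdeal σ E I) :=
  mulEquiv_mk0 (galInt σ E) I _ rfl

/-- Multiplicative maps on ideals are determined by their values on principal ideals. -/
theorem monoidHom_ideal_ext {R : Type*} [CommRing R] [IsDedekindDomain R] 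
    {f g : (Ideal (𝓞 E))⁰ →* (Ideal R)⁰}
    (h : ∀ (x : 𝓞 E) (hx : x ≠ 0), f (principal x hx) = g (principal x hx)) : f = g := by
  refine MonoidHom.ext fun I => ?_
  -- Some power of every ideal is principal, and roots of nonzero ideals are unique.
  set n := Fintype.card (ClassGroup (𝓞 E)) with hn
  have h1 : ClassGroup.mk0 (I ^ n) = 1 := by rw [map_pow, pow_card_eq_one]
  rw [ClassGroup.mk0_eq_one_iff] at h1
  obtain ⟨x, hx⟩ := h1
  have hx' : (I ^ n).1 = Ideal.span {x} := hx
  have hx0 : x ≠ 0 := by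
    rintro rfl
    refine nonZeroDivisors.coe_ne_zero (I ^ n) (hx'.trans ?_)
    simp
  have h2 : I ^ n = principal x hx0 := Subtype.ext hx'
  have h3 : f I ^ n = g I ^ n := by rw [← map_pow, ← map_pow, h2, h]
  exact Subtype.ext (pow_left_injective Fintype.card_ne_zero (congrArg Subtype.val h3))

/-- A family of automorphisms of `ℚ̄` that represents the Galois group of `E'/E`. -/
structure GalSystem (h : E ≤ E') {ι : Type*} (τ : ι → (QBar ≃ₐ[ℚ] QBar)) : Prop where
  fixes : ∀ i, ∀ x : E, τ i x = x
  inj : ∀ i j, (∀ x : E', τ i x = τ j x) → i = j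
  surj : ∀ σ : QBar ≃ₐ[ℚ] QBar, (∀ x : E, σ x = x) → ∃ i, ∀ x : E', σ x = τ i x

/-- Automorphisms of `ℚ̄` act on all layers at once, which spares identifications between Galois
groups of different extensions. This is the passage back to the Galois group of one extension. -/
theorem GalSystem.exists_equiv {h : E ≤ E'} {ι : Type*} {τ : ι → (QBar ≃ₐ[ℚ] QBar)}
    (hτ : GalSystem h τ) : letI : Algebra E E' := (incl h).toAlgebra
    ∃ f : ι ≃ (E' ≃ₐ[E] E'), ∀ i (y : E'), ((f i y : E') : QBar) = τ i y := by
  let : Algebra E E' := (incl h).toAlgebra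
  have hco : ∀ x : E, ((algebraMap E E' x : E') : QBar) = x := fun x => rfl
  let f : ι → (E' ≃ₐ[E] E') := fun i => AlgEquiv.ofRingEquiv
    (f := ((τ i).restrictNormal E').toRingEquiv) fun y => Subtype.ext (by
      refine (coe_restrictNormal (τ i) E' _).trans ?_
      rw [hco, hτ.fixes])
  have hf : ∀ i (y : E'), ((f i y : E') : QBar) = τ i y := fun i y => coe_restrictNormal (τ i) E' y
  have : IsScalarTower ℚ E E' :=
    IsScalarTower.of_algebraMap_eq fun x => (map_ratCast (incl h) x).symm
  refine ⟨Equiv.ofBijective f ⟨fun i j hij => ?_, fun g => ?_⟩, hf⟩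
  · refine hτ.inj i j fun y => ?_
    rw [← hf, ← hf, hij]
  · let σ : QBar ≃ₐ[ℚ] QBar := (g.restrictScalars ℚ).liftNormal QBar
    have hσ : ∀ y : E', σ y = (g y : E') := fun y =>
      AlgEquiv.liftNormal_commutes (g.restrictScalars ℚ) QBar y
    obtain ⟨i, hi⟩ := hτ.surj σ fun y => by
      have := hσ (algebraMap E E' y)
      rw [AlgEquiv.commutes, hco] at this
      exact this
    refine ⟨i, AlgEquiv.ext fun y => Subtype.ext ?_⟩
    rw [hf, ← hi, hσ]

theorem coe_normInt (h : E ≤ E') {ι : Type*} [Fintype ι] {τ : ι → (QBar ≃ₐ[ℚ] QBar)}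
    (hτ : GalSystem h τ) (x : 𝓞 E') :
    ((normInt h x : E) : QBar) = ∏ i, τ i ((x : E') : QBar) := by
  let : Algebra E E' := (incl h).toAlgebra
  have : IsScalarTower ℚ E E' :=
    IsScalarTower.of_algebraMap_eq fun x => (map_ratCast (incl h) x).symm
  have : IsGalois E E' := IsGalois.tower_top_of_isGalois ℚ E E'
  have : FiniteDimensional E E' := FiniteDimensional.right ℚ E E'
  have h1 : ((normInt h x : E) : QBar) =
      ((algebraMap E E' (Algebra.norm E (x : E')) : E') : QBar) :=
    congrArg Subtype.val (Algebra.algebraMap_intNorm (A := 𝓞 E) (K := E) (L := E') x)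
  obtain ⟨f, hf⟩ := hτ.exists_equiv
  have h2 : ∏ g : E' ≃ₐ[E] E', g (x : E') = ∏ i, f i (x : E') :=
    (Equiv.prod_comp f fun g : E' ≃ₐ[E] E' => g (x : E')).symm
  rw [h1, Algebra.norm_eq_prod_automorphisms, h2]
  change E'.toIntermediateField.val (∏ i, f i (x : E')) = _
  rw [map_prod]
  exact Finset.prod_congr rfl fun i _ => hf i x

theorem GalSystem.card_eq {h : E ≤ E'} {ι : Type*} [Fintype ι] {τ : ι → (QBar ≃ₐ[ℚ] QBar)}
    (hτ : GalSystem h τ) : letI : Algebra E E' := (incl h).toAlgebra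
    finrank E E' = Fintype.card ι := by
  let : Algebra E E' := (incl h).toAlgebra
  have : IsScalarTower ℚ E E' :=
    IsScalarTower.of_algebraMap_eq fun x => (map_ratCast (incl h) x).symm
  have : IsGalois E E' := IsGalois.tower_top_of_isGalois ℚ E E'
  have : FiniteDimensional E E' := FiniteDimensional.right ℚ E E'
  obtain ⟨f, -⟩ := hτ.exists_equiv
  rw [← IsGalois.card_aut_eq_finrank, Nat.card_congr f.symm, Nat.card_eq_fintype_card]

theorem exists_galSystem (h : E ≤ E') :
    ∃ (ι : Type) (_ : Fintype ι) (τ : ι → (QBar ≃ₐ[ℚ] QBar)), GalSystem h τ := by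
  let : Algebra E E' := (incl h).toAlgebra
  have : IsScalarTower ℚ E E' :=
    IsScalarTower.of_algebraMap_eq fun x => (map_ratCast (incl h) x).symm
  have : FiniteDimensional E E' := FiniteDimensional.right ℚ E E'
  have hco : ∀ x : E, ((algebraMap E E' x : E') : QBar) = x := fun x => rfl
  have hl : ∀ (g : E' ≃ₐ[E] E') (y : E'), (g.restrictScalars ℚ).liftNormal QBar (y : QBar) =
      (g y : E') := fun g y => AlgEquiv.liftNormal_commutes (g.restrictScalars ℚ) QBar y
  refine ⟨E' ≃ₐ[E] E', inferInstance, fun g => (g.restrictScalars ℚ).liftNormal QBar, ?_, ?_, ?_⟩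
  · intro g x
    have := hl g (algebraMap E E' x)
    rw [AlgEquiv.commutes, hco] at this
    exact this
  · intro g g' hg
    refine AlgEquiv.ext fun y => Subtype.ext ?_
    rw [← hl, ← hl, hg]
  · intro σ hσ
    refine ⟨AlgEquiv.ofRingEquiv (f := (σ.restrictNormal E').toRingEquiv) fun y => Subtype.ext (by
      refine (coe_restrictNormal σ E' _).trans ?_
      rw [hco, hσ]), fun x => ?_⟩
    rw [hl]
    exact (coe_restrictNormal σ E' x).symm

theorem galInt_comm {σ τ : QBar ≃ₐ[ℚ] QBar} {E : GaloisNF}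
    (h : ∀ x : E, σ (τ x) = τ (σ x)) (x : 𝓞 E) :
    galInt σ E (galInt τ E x) = galInt τ E (galInt σ E x) :=
  int_ext (by rw [coe_galInt, coe_galInt, coe_galInt, coe_galInt]; exact h x)

theorem galIdeal_comm {σ τ : QBar ≃ₐ[ℚ] QBar} {E : GaloisNF}
    (h : ∀ x : E, σ (τ x) = τ (σ x)) (I : (Ideal (𝓞 E))⁰) :
    galIdeal σ E (galIdeal τ E I) = galIdeal τ E (galIdeal σ E I) := by
  refine Subtype.ext ?_
  simp only [coe_galIdeal]
  refine (Ideal.map_map _ _).trans (Eq.trans ?_ (Ideal.map_map _ _).symm)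
  congr 1
  exact RingHom.ext (galInt_comm h)

theorem galIdeal_extIdeal (σ : QBar ≃ₐ[ℚ] QBar) (h : E ≤ E') (I : (Ideal (𝓞 E))⁰) :
    galIdeal σ E' (extIdeal h I) = extIdeal h (galIdeal σ E I) := by
  refine Subtype.ext ?_
  simp only [coe_galIdeal, coe_extIdeal]
  refine (Ideal.map_map _ _).trans (Eq.trans ?_ (Ideal.map_map _ _).symm)
  congr 1
  refine RingHom.ext fun x => int_ext ?_
  change ((galInt σ E' (extInt h x) : E') : QBar) = ((extInt h (galInt σ E x) : E') : QBar)
  rw [coe_galInt, coe_extInt, coe_extInt, coe_galInt]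

theorem extIdeal_extIdeal {E'' : GaloisNF} (h : E ≤ E') (h' : E' ≤ E'') (I : (Ideal (𝓞 E))⁰) :
    extIdeal h' (extIdeal h I) = extIdeal (h.trans h') I := by
  refine Subtype.ext ?_
  simp only [coe_extIdeal]
  rw [Ideal.map_map]
  rfl

/-- The relative norm of an extended ideal is a power of the ideal, and roots of ideals are unique.
-/
theorem extIdeal_injective (h : E ≤ E') : Function.Injective (extIdeal h) := by
  let : Algebra E E' := (incl h).toAlgebra
  intro I J hIJ
  refine Subtype.ext ?_
  have h1 : I.1.map (algebraMap (𝓞 E) (𝓞 E')) = J.1.map (algebraMap (𝓞 E) (𝓞 E')) :=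
    congrArg Subtype.val hIJ
  have h2 := congrArg (Ideal.relNorm (𝓞 E)) h1
  rw [Ideal.relNorm_algebraMap, Ideal.relNorm_algebraMap] at h2
  refine pow_left_injective ?_ h2
  have : Module.Finite (𝓞 E) (𝓞 E') := inferInstance
  exact (Module.finrank_pos (R := 𝓞 E) (M := 𝓞 E')).ne'

/-- On principal ideals the norm is a product over a representing family. Moving `σ` through it
replaces each `τ i` by `σ⁻¹ * τ i * σ`, again a representing family because both fields are Galois
over `ℚ`. -/
theorem normIdeal_galIdeal (σ : QBar ≃ₐ[ℚ] QBar) (h : E ≤ E') (I : (Ideal (𝓞 E'))⁰) :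
    normIdeal h (galIdeal σ E' I) = galIdeal σ E (normIdeal h I) := by
  refine DFunLike.congr_fun (f := (normIdeal h).comp (galIdeal σ E'))
    (g := (galIdeal σ E).comp (normIdeal h)) (monoidHom_ideal_ext fun x hx => Subtype.ext ?_) I
  have hx' : galInt σ E' x ≠ 0 := (map_ne_zero_iff _ (galInt σ E').injective).mpr hx
  have e1 : galIdeal σ E' (principal x hx) = principal _ hx' :=
    Subtype.ext (galIdeal_principal σ hx)
  have e2 : normIdeal h (principal x hx) = principal _ (normInt_ne_zero h hx) :=
    Subtype.ext (normIdeal_principal h hx)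
  rw [MonoidHom.comp_apply, MonoidHom.comp_apply, e1, e2, normIdeal_principal,
    galIdeal_principal]
  congr 2
  refine int_ext ?_
  obtain ⟨ι, _, τ, hτ⟩ := exists_galSystem h
  have hτ' : GalSystem h fun i => (σ⁻¹ : QBar ≃ₐ[ℚ] QBar) * τ i * σ := by
    have hσE : ∀ (E : GaloisNF) (ρ : QBar ≃ₐ[ℚ] QBar) (y : E), ∃ z : E, (z : QBar) = ρ y :=
      fun E ρ y => ⟨_, coe_restrictNormal ρ E y⟩
    refine ⟨fun i y => ?_, fun i j hij => hτ.inj i j fun y => ?_, fun ρ hρ => ?_⟩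
    · obtain ⟨z, hz⟩ := hσE E σ y
      simp only [AlgEquiv.mul_apply]
      rw [← hz, hτ.fixes, hz]
      exact σ.symm_apply_apply _
    · obtain ⟨z, hz⟩ := hσE E' σ⁻¹ y
      have := hij z
      simp only [AlgEquiv.mul_apply, hz] at this
      have e : σ ((σ⁻¹ : QBar ≃ₐ[ℚ] QBar) (y : QBar)) = y := σ.apply_symm_apply _
      rw [e] at this
      exact (σ⁻¹ : QBar ≃ₐ[ℚ] QBar).injective this
    · obtain ⟨i, hi⟩ := hτ.surj (σ * ρ * σ⁻¹) fun y => by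
        obtain ⟨z, hz⟩ := hσE E σ⁻¹ y
        simp only [AlgEquiv.mul_apply]
        rw [← hz, hρ, hz]
        exact σ.apply_symm_apply _
      refine ⟨i, fun y => ?_⟩
      obtain ⟨z, hz⟩ := hσE E' σ y
      have := hi z
      simp only [AlgEquiv.mul_apply] at this ⊢
      rw [← hz, ← this, hz]
      have e : (σ⁻¹ : QBar ≃ₐ[ℚ] QBar) (σ (y : QBar)) = y := σ.symm_apply_apply _
      have e' : ∀ w, (σ⁻¹ : QBar ≃ₐ[ℚ] QBar) (σ w) = w := σ.symm_apply_apply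
      rw [e, e']
  rw [coe_normInt h hτ, coe_galInt, coe_galInt, coe_normInt h hτ', map_prod]
  refine Finset.prod_congr rfl fun i _ => ?_
  simp only [AlgEquiv.mul_apply]
  exact (σ.apply_symm_apply _).symm

theorem normIdeal_normIdeal {E'' : GaloisNF} (h : E ≤ E') (h' : E' ≤ E'') (I : (Ideal (𝓞 E''))⁰) :
    normIdeal h (normIdeal h' I) = normIdeal (h.trans h') I := by
  let : Algebra E E' := (incl h).toAlgebra
  let : Algebra E' E'' := (incl h').toAlgebra
  let : Algebra E E'' := (incl (h.trans h')).toAlgebra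
  have : IsScalarTower E E' E'' := IsScalarTower.of_algebraMap_eq fun x => rfl
  exact Subtype.ext (Ideal.relNorm_relNorm (𝓞 E) (𝓞 E') I.1)

end Basics

end IwasawaThaine

namespace IwasawaThaine

open Module

/-! ### Field theory of the towers -/

section Fields

theorem exists_subgroup_card {G : Type*} [Group G] [Finite G] [IsCyclic G] {d e : ℕ}
    (h : Nat.card G = d * e) :
    ∃ H : Subgroup G, Nat.card H = e ∧ ∀ H' : Subgroup G, Nat.card H' = e → H' = H := by
  let : CommGroup G := IsCyclic.commGroup
  have hcard : Nat.card (powMonoidHom e : G →* G).ker = e := by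
    rw [IsCyclic.card_powMonoidHom_ker, h, Nat.gcd_mul_left_left]
  refine ⟨(powMonoidHom e : G →* G).ker, hcard, fun H' hH' => ?_⟩
  refine Subgroup.eq_of_le_of_card_ge (fun x hx => ?_) (hcard.trans hH'.symm).le
  rw [MonoidHom.mem_ker, powMonoidHom_apply]
  have h1 : (⟨x, hx⟩ : H') ^ Nat.card H' = 1 := pow_card_eq_one'
  rw [hH'] at h1
  exact congrArg Subtype.val h1

/-- Galois correspondence for a cyclic group. It identifies the compositum defining `fieldF` with a
single field and supplies the field of degree `p ^ n` inside `layerB p (n + 1)`. -/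
theorem exists_unique_subfield {F Ω : Type*} [Field F] [Field Ω] [Algebra F Ω]
    {C : IntermediateField F Ω} [FiniteDimensional F C]
    [IsGalois F C] (hc : IsCyclic (C ≃ₐ[F] C)) {d e : ℕ} (he : 0 < e) (h : finrank F C = d * e) :
    ∃ E : IntermediateField F Ω, E ≤ C ∧ finrank F E = d ∧
      ∀ E' : IntermediateField F Ω, E' ≤ C → finrank F E' = d → E' = E := by
  obtain ⟨H, hH1, hH2⟩ := exists_subgroup_card (G := C ≃ₐ[F] C) (d := d) (e := e)
    (by rw [IsGalois.card_aut_eq_finrank, h])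
  refine ⟨IntermediateField.lift (IntermediateField.fixedField H), IntermediateField.lift_le _, ?_,
    fun E' hE' hd => ?_⟩
  · have h1 := Module.finrank_mul_finrank F (IntermediateField.fixedField H) C
    rw [IntermediateField.finrank_fixedField_eq_card, hH1, h] at h1
    rw [← Nat.eq_of_mul_eq_mul_right he h1]
    exact (LinearEquiv.finrank_eq
      (IntermediateField.liftAlgEquiv (IntermediateField.fixedField H)).toLinearEquiv).symm
  · set E'' := IntermediateField.restrict hE' with hE''
    have h2 : finrank F E'' = d := by
      rw [← hd]
      exact (LinearEquiv.finrank_eq (IntermediateField.restrictAlgEquiv hE').toLinearEquiv).symm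
    have h3 : Nat.card E''.fixingSubgroup = e := by
      rw [IsGalois.card_fixingSubgroup_eq_finrank E'']
      have h4 := Module.finrank_mul_finrank F E'' C
      rw [h, h2] at h4
      refine Nat.eq_of_mul_eq_mul_left (Nat.pos_of_ne_zero ?_) h4
      rintro rfl
      rw [zero_mul] at h
      exact finrank_pos.ne' h
    rw [← hH2 _ h3, IsGalois.fixedField_fixingSubgroup E'', hE'', IntermediateField.lift_restrict]

instance cyclo_finiteDimensional (N : ℕ) [NeZero N] : FiniteDimensional ℚ (cyclo N) :=
  IsCyclotomicExtension.finiteDimensional {N} ℚ _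

instance cyclo_isAbelianGalois (N : ℕ) [NeZero N] : IsAbelianGalois ℚ (cyclo N) :=
  IsCyclotomicExtension.isAbelianGalois {N} ℚ _

instance cyclo_numberField (N : ℕ) [NeZero N] : NumberField (cyclo N) where

theorem finrank_cyclo (N : ℕ) [NeZero N] : finrank ℚ (cyclo N) = N.totient :=
  IsCyclotomicExtension.finrank (cyclo N)
    (Polynomial.cyclotomic.irreducible_rat (Nat.pos_of_ne_zero (NeZero.ne N)))

theorem isCyclic_gal_cyclo {r k : ℕ} (hr : r.Prime) (hr2 : r ≠ 2) [NeZero (r ^ k)] :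
    IsCyclic (cyclo (r ^ k) ≃ₐ[ℚ] cyclo (r ^ k)) := by
  have := ZMod.isCyclic_units_of_prime_pow r hr hr2 k
  exact isCyclic_of_surjective (IsCyclotomicExtension.Rat.galEquivZMod (r ^ k) (cyclo (r ^ k))).symm
    (MulEquiv.surjective _)

theorem mem_cyclo {N : ℕ} {x : QBar} (hx : x ^ N = 1) : x ∈ cyclo N :=
  IntermediateField.subset_adjoin ℚ _ hx

theorem cyclo_le {N : ℕ} {E : IntermediateField ℚ QBar} (h : ∀ x : QBar, x ^ N = 1 → x ∈ E) :
    cyclo N ≤ E := IntermediateField.adjoin_le_iff.mpr h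

theorem cyclo_mono {M N : ℕ} (h : M ∣ N) : cyclo M ≤ cyclo N :=
  cyclo_le fun x hx => mem_cyclo (by
    obtain ⟨k, rfl⟩ := h
    rw [pow_mul, hx, one_pow])

theorem coe_cycloSub_le (N : ℕ) [NeZero N] (D : Set ℕ) :
    (cycloSub N D).toIntermediateField ≤ cyclo N :=
  sSup_le fun _ hE => hE.1

theorem le_coe_cycloSub {N : ℕ} [NeZero N] {D : Set ℕ} {E : IntermediateField ℚ QBar}
    (h1 : E ≤ cyclo N) (h2 : finrank ℚ E ∈ D) : E ≤ (cycloSub N D).toIntermediateField :=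
  le_sSup (show E ∈ {E : IntermediateField ℚ QBar | E ≤ cyclo N ∧ finrank ℚ E ∈ D} from ⟨h1, h2⟩)

theorem coe_le {E E' : GaloisNF} : E ≤ E' ↔ E.toIntermediateField ≤ E'.toIntermediateField :=
  Iff.rfl

variable (p : ℕ) [Fact p.Prime]

theorem finrank_fieldF (q : ℕ) [Fact q.Prime] (hq : q ≡ 1 [MOD p]) :
    finrank ℚ (fieldF p q) = p := by
  have hp1 : p.Prime := Fact.out
  have hq1 : q.Prime := Fact.out
  obtain ⟨e, he⟩ : p ∣ q - 1 := (Nat.modEq_iff_dvd' hq1.one_le).mp hq.symm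
  have hq2 : q ≠ 2 := by
    rintro rfl
    have : p ∣ 1 := ⟨e, he⟩
    exact hp1.one_lt.ne' (Nat.dvd_one.mp this)
  have hcyc : IsCyclic (cyclo q ≃ₐ[ℚ] cyclo q) := by
    have : NeZero (q ^ 1) := ⟨by simpa using hq1.ne_zero⟩
    have := isCyclic_gal_cyclo (k := 1) hq1 hq2
    rwa [pow_one] at this
  have hfin : finrank ℚ (cyclo q) = p * e := by
    rw [finrank_cyclo, Nat.totient_prime hq1, he]
  have he0 : 0 < e := Nat.pos_of_ne_zero fun h => by
    rw [h, mul_zero] at hfin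
    exact finrank_pos.ne' hfin
  have : @IsGalois ℚ _ (cyclo q) _ (cyclo q).algebra' := (cyclo_isAbelianGalois q).toIsGalois
  obtain ⟨E, hE1, hE2, hE3⟩ := exists_unique_subfield hcyc he0 hfin
  have : (fieldF p q).toIntermediateField = E := by
    refine le_antisymm (sSup_le fun E' hE' => (hE3 E' hE'.1 hE'.2).le) ?_
    exact le_coe_cycloSub hE1 hE2
  change finrank ℚ (fieldF p q).toIntermediateField = p
  rw [this, hE2]

/-- The layer contributes degree `p ^ n` and `ℚ(ζ_p)` contributes `p - 1`. These are coprime with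
product `[ℚ(ζ_{p^(n+1)}) : ℚ]`, so the compositum is the whole cyclotomic field. -/
theorem cyclo_pow_le_towerK (hp : Odd p) (K : GaloisNF)
    (hζ : ∀ ζ : QBar, ζ ^ p = 1 → ζ ∈ K.toIntermediateField) (n : ℕ) :
    cyclo (p ^ n) ≤ (towerK p K n).toIntermediateField := by
  have hp1 : p.Prime := Fact.out
  have hp2 : p ≠ 2 := by rintro rfl; exact absurd hp (by decide)
  rcases n with _ | n
  · exact cyclo_le fun x hx => by
      rw [pow_zero, pow_one] at hx
      rw [hx]
      exact one_mem _
  have hfin : finrank ℚ (cyclo (p ^ (n + 1))) = p ^ n * (p - 1) := by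
    rw [finrank_cyclo, Nat.totient_prime_pow_succ hp1]
  have hp0 : 0 < p - 1 := by have := hp1.two_le; lia
  have : @IsGalois ℚ _ (cyclo (p ^ (n + 1))) _ (cyclo (p ^ (n + 1))).algebra' :=
    (cyclo_isAbelianGalois _).toIsGalois
  obtain ⟨E, hE1, hE2, -⟩ := exists_unique_subfield (isCyclic_gal_cyclo hp1 hp2) hp0 hfin
  have hEK : E ≤ (towerK p K (n + 1)).toIntermediateField :=
    (le_coe_cycloSub hE1 (show _ ∈ {d | ∃ k : ℕ, d = p ^ k} from ⟨n, hE2⟩)).trans (coe_le.mp (le_sup_right : layerB p (n + 1) ≤ _))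
  have hCK : cyclo p ≤ (towerK p K (n + 1)).toIntermediateField :=
    (cyclo_le hζ).trans (coe_le.mp (le_sup_left : K ≤ _))
  have hle : E ⊔ cyclo p ≤ cyclo (p ^ (n + 1)) := sup_le hE1 (cyclo_mono ⟨p ^ n, pow_succ' p n⟩)
  have : FiniteDimensional ℚ (E ⊔ cyclo p : IntermediateField ℚ QBar) :=
    FiniteDimensional.of_injective (IntermediateField.inclusion hle).toLinearMap
      (IntermediateField.inclusion hle).injective
  have hpos : 0 < finrank ℚ (E ⊔ cyclo p : IntermediateField ℚ QBar) := finrank_pos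
  have d1 : finrank ℚ E ∣ finrank ℚ (E ⊔ cyclo p : IntermediateField ℚ QBar) :=
    IntermediateField.finrank_dvd_of_le_right le_sup_left
  have d2 : finrank ℚ (cyclo p) ∣ finrank ℚ (E ⊔ cyclo p : IntermediateField ℚ QBar) :=
    IntermediateField.finrank_dvd_of_le_right le_sup_right
  rw [hE2] at d1
  rw [finrank_cyclo, Nat.totient_prime hp1] at d2
  have hcop : Nat.Coprime (p ^ n) (p - 1) :=
    Nat.Coprime.pow_left n (Nat.coprime_of_lt_prime hp0.ne' (Nat.sub_lt hp1.pos one_pos) hp1)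
  have d3 := hcop.mul_dvd_of_dvd_of_dvd d1 d2
  have heq : E ⊔ cyclo p = cyclo (p ^ (n + 1)) :=
    IntermediateField.eq_of_le_of_finrank_le hle (by rw [hfin]; exact Nat.le_of_dvd hpos d3)
  rw [← heq]
  exact sup_le hEK hCK

/-- Otherwise 𝔹_{n+1} ⊆ ℚ(ζ_{p^(n+1)}) ⊆ 𝕂_n for all `n ≥ N`; the tower would be stationary from `N`
on and yet contain fields of unbounded degree. -/
theorem exists_good (K : GaloisNF) (N : ℕ) :
    ∃ n, N ≤ n ∧ ∃ ζ : QBar, IsPrimitiveRoot ζ (p ^ (n + 1)) ∧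
      ζ ∉ (towerK p K n).toIntermediateField := by
  have hp1 : p.Prime := Fact.out
  by_contra! hcon
  have hsub : ∀ n, N ≤ n → cyclo (p ^ (n + 1)) ≤ (towerK p K n).toIntermediateField := by
    intro n hn
    obtain ⟨ζ, hζ'⟩ := exists_isPrimitiveRoot (p ^ (n + 1))
    refine cyclo_le fun x hx => ?_
    obtain ⟨i, -, rfl⟩ := hζ'.eq_pow_of_pow_eq_one hx
    exact pow_mem (hcon n hn ζ hζ') i
  have hK : ∀ n, N ≤ n → towerK p K n ≤ towerK p K N := by
    intro n hn
    induction n, hn using Nat.le_induction with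
    | base => exact le_rfl
    | succ n hn ih =>
      refine le_trans ?_ ih
      refine sup_le le_sup_left ?_
      exact coe_le.mpr ((coe_cycloSub_le _ _).trans (hsub n hn))
  have hdim : ∀ n, N ≤ n → p ^ n * (p - 1) ≤ finrank ℚ (towerK p K N) := by
    intro n hn
    have hle := (hsub n hn).trans (coe_le.mp (hK n hn))
    have := LinearMap.finrank_le_finrank_of_injective
      (f := (IntermediateField.inclusion hle).toLinearMap) (IntermediateField.inclusion hle).injective
    rwa [finrank_cyclo, Nat.totient_prime_pow_succ hp1] at this
  set D := finrank ℚ (towerK p K N)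
  have h1 := hdim (N + D) (Nat.le_add_right _ _)
  have h2 : N + D < p ^ (N + D) := Nat.lt_pow_self hp1.one_lt
  have h3 : 1 ≤ p - 1 := by have := hp1.two_le; lia
  have h4 : p ^ (N + D) ≤ p ^ (N + D) * (p - 1) := Nat.le_mul_of_pos_right _ h3
  lia

end Fields

/-! ### Automorphisms on composita, and complex conjugation. -/

section Automorphisms

/-- Automorphisms that agree on two fields agree on the compositum. -/
theorem apply_eq_of_mem_sup {σ τ : QBar ≃ₐ[ℚ] QBar} {E E' : IntermediateField ℚ QBar}
    (h : ∀ x ∈ E, σ x = τ x) (h' : ∀ x ∈ E', σ x = τ x) : ∀ x ∈ E ⊔ E', σ x = τ x := by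
  have key : ∀ F : IntermediateField ℚ QBar, (∀ x ∈ F, σ x = τ x) ↔
      F ≤ IntermediateField.fixedField (Subgroup.zpowers (τ⁻¹ * σ)) := fun F => by
    have e : ∀ x, σ x = τ x ↔ (τ⁻¹ * σ) x = x := fun x =>
      ⟨fun hx => by
        rw [AlgEquiv.mul_apply, hx]
        exact τ.symm_apply_apply x, fun hx => by
        have := congrArg τ hx
        rw [AlgEquiv.mul_apply] at this
        exact (τ.apply_symm_apply (σ x)).symm.trans this⟩
    refine forall₂_congr fun x _ => (e x).trans ?_
    rw [IntermediateField.mem_fixedField_iff]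
    refine ⟨fun hx f hf => ?_, fun hx => hx _ (Subgroup.mem_zpowers _)⟩
    have hle : Subgroup.zpowers (τ⁻¹ * σ) ≤ MulAction.stabilizer (QBar ≃ₐ[ℚ] QBar) x :=
      Subgroup.zpowers_le.mpr hx
    exact hle hf
  rw [key] at h h' ⊢
  exact sup_le h h'

theorem conjugation_apply_of_pow_eq_one {x : QBar} {N : ℕ} (hN : N ≠ 0) (hx : x ^ N = 1) :
    conjugation x = x⁻¹ := by
  refine Subtype.ext ?_
  rw [coe_conjugation]
  have h1 : ‖(x : ℂ)‖ = 1 := Complex.norm_eq_one_of_pow_eq_one (n := N)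
    (by exact_mod_cast congrArg Subtype.val hx) hN
  exact (Complex.inv_eq_conj h1).symm

theorem conjugation_comm_cyclo (τ : QBar ≃ₐ[ℚ] QBar) (N : ℕ) [NeZero N] :
    ∀ x ∈ cyclo N, (τ * conjugation) x = (conjugation * τ) x := by
  have hN : N ≠ 0 := NeZero.ne N
  suffices h : ∀ x : QBar, x ^ N = 1 → (τ * conjugation) x = (conjugation * τ) x by
    intro x hx
    refine IntermediateField.adjoin_induction (F := ℚ) (s := {x : QBar | x ^ N = 1})
      (p := fun x _ => (τ * conjugation) x = (conjugation * τ) x)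
      (fun x hx => h x hx) (fun r => ?_) (fun x y _ _ hx hy => ?_) (fun x _ hx => ?_)
      (fun x y _ _ hx hy => ?_) hx
    · rw [AlgEquiv.commutes, AlgEquiv.commutes]
    · rw [map_add, map_add, hx, hy]
    · rw [map_inv₀, map_inv₀, hx]
    · rw [map_mul, map_mul, hx, hy]
  intro x hx
  rw [AlgEquiv.mul_apply, AlgEquiv.mul_apply, conjugation_apply_of_pow_eq_one hN hx, map_inv₀,
    conjugation_apply_of_pow_eq_one hN (by rw [← map_pow, hx, map_one])]

/-- In a CM field one automorphism induces complex conjugation through every embedding, in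
particular through the given one composed with `τ`. -/
theorem conjugation_comm_of_isCMField (K : GaloisNF) [IsCMField K] (τ : QBar ≃ₐ[ℚ] QBar) :
    ∀ x ∈ K.toIntermediateField, (τ * conjugation) x = (conjugation * τ) x := by
  intro x hx
  let φ : K →+* ℂ := (algebraMap QBar ℂ).comp K.toIntermediateField.val.toRingHom
  have h1 : ∀ y : K, (φ (IsCMField.complexConj K y) : ℂ) = starRingEnd ℂ (φ y) :=
    fun y => IsCMField.complexEmbedding_complexConj K φ y
  have h2 : ∀ y : K, ((IsCMField.complexConj K y : K) : QBar) = conjugation y := fun y =>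
    Subtype.ext ((h1 y).trans (coe_conjugation y).symm)
  let φ' : K →+* ℂ := φ.comp (τ.restrictNormal K : K →+* K)
  have h3 : φ' (IsCMField.complexConj K ⟨x, hx⟩) = starRingEnd ℂ (φ' ⟨x, hx⟩) :=
    IsCMField.complexEmbedding_complexConj K φ' _
  refine Subtype.ext ?_
  rw [AlgEquiv.mul_apply, AlgEquiv.mul_apply, coe_conjugation]
  have h4 : ∀ y : K, φ' y = ((τ y : QBar) : ℂ) := fun y =>
    congrArg Subtype.val (coe_restrictNormal τ K y)
  rw [h4, h4, h2] at h3
  exact h3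

variable (p : ℕ) [Fact p.Prime]

theorem conjugation_comm_towerL (K : GaloisNF) [IsCMField K] (q : ℕ) [Fact q.Prime]
    (τ : QBar ≃ₐ[ℚ] QBar) (n : ℕ) (x : towerL p K q n) :
    τ (conjugation (x : QBar)) = conjugation (τ x) := by
  have h1 : ∀ y ∈ (towerK p K n).toIntermediateField, (τ * conjugation) y = (conjugation * τ) y :=
    apply_eq_of_mem_sup (conjugation_comm_of_isCMField K τ) fun y hy =>
      conjugation_comm_cyclo τ (p ^ n) y (coe_cycloSub_le _ _ hy)
  exact apply_eq_of_mem_sup h1 (fun y hy =>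
    conjugation_comm_cyclo τ q y (coe_cycloSub_le _ _ hy)) x x.2

end Automorphisms

end IwasawaThaine

namespace IwasawaThaine

open Module

/-! ### Norms of ideals as products over representing families. -/

section Systems

variable {E E' : GaloisNF}

theorem extInt_normInt (h : E ≤ E') {ι : Type*} [Fintype ι] {τ : ι → (QBar ≃ₐ[ℚ] QBar)}
    (hτ : GalSystem h τ) (x : 𝓞 E') : extInt h (normInt h x) = ∏ i, galInt (τ i) E' x := by
  refine int_ext ?_
  rw [coe_extInt, coe_normInt h hτ]
  have e : ((((∏ i, galInt (τ i) E' x : 𝓞 E') : E')) : QBar) =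
      ∏ i, ((galInt (τ i) E' x : E') : QBar) :=
    map_prod (E'.toIntermediateField.val.toRingHom.comp (algebraMap (𝓞 E') E')) _ _
  rw [e]
  exact Finset.prod_congr rfl fun i _ => (coe_galInt (τ i) x).symm

theorem galInt_mul (σ τ : QBar ≃ₐ[ℚ] QBar) (x : 𝓞 E) :
    galInt (σ * τ) E x = galInt σ E (galInt τ E x) :=
  int_ext (by rw [coe_galInt, coe_galInt, coe_galInt, AlgEquiv.mul_apply])

theorem galIdeal_mul (σ τ : QBar ≃ₐ[ℚ] QBar) (I : (Ideal (𝓞 E))⁰) :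
    galIdeal (σ * τ) E I = galIdeal σ E (galIdeal τ E I) := by
  have h : (galInt (σ * τ) E : 𝓞 E →+* 𝓞 E) =
      (galInt σ E : 𝓞 E →+* 𝓞 E).comp (galInt τ E : 𝓞 E →+* 𝓞 E) :=
    RingHom.ext fun x => galInt_mul σ τ x
  have h2 := congrArg (fun f => Ideal.map f I.1) h
  exact Subtype.ext (h2.trans (Ideal.map_map _ _).symm)

theorem galIdeal_eq_self {σ : QBar ≃ₐ[ℚ] QBar} (h : ∀ x : E, σ x = x) (I : (Ideal (𝓞 E))⁰) :
    galIdeal σ E I = I := by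
  refine Subtype.ext ?_
  rw [coe_galIdeal]
  have : (galInt σ E : 𝓞 E →+* 𝓞 E) = RingHom.id _ :=
    RingHom.ext fun x => int_ext ((coe_galInt σ x).trans (h x))
  exact (congrArg (fun f => Ideal.map f I.1) this).trans (Ideal.map_id _)

theorem galIdeal_pow (σ : QBar ≃ₐ[ℚ] QBar) (i : ℕ) (I : (Ideal (𝓞 E))⁰) :
    galIdeal (σ ^ i) E I = (galIdeal σ E)^[i] I := by
  induction i generalizing I with
  | zero =>
    rw [pow_zero, galIdeal_eq_self fun x => AlgEquiv.one_apply _]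
    rfl
  | succ i ih => rw [pow_succ, galIdeal_mul, ih, Function.iterate_succ_apply]

theorem coe_principal {R : Type*} [CommRing R] [IsDomain R] {x : R} (hx : x ≠ 0) :
    (principal x hx).1 = Ideal.span {x} := rfl

theorem extIdeal_normIdeal_eq_prod (h : E ≤ E') {ι : Type*} [Fintype ι]
    {τ : ι → (QBar ≃ₐ[ℚ] QBar)} (hτ : GalSystem h τ) (I : (Ideal (𝓞 E'))⁰) :
    extIdeal h (normIdeal h I) = ∏ i, galIdeal (τ i) E' I := by
  have key : (extIdeal h).comp (normIdeal h) = ∏ i, galIdeal (τ i) E' := by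
    refine monoidHom_ideal_ext fun x hx => Subtype.ext ?_
    have e2 : normIdeal h (principal x hx) = principal _ (normInt_ne_zero h hx) :=
      Subtype.ext (normIdeal_principal h hx)
    rw [MonoidHom.comp_apply, e2, extIdeal_principal, extInt_normInt h hτ, MonoidHom.finsetProd_apply,
      SubmonoidClass.coe_finsetProd]
    simp_rw [galIdeal_principal]
    rw [Ideal.prod_span_singleton]
  have := DFunLike.congr_fun key I
  rwa [MonoidHom.comp_apply, MonoidHom.finsetProd_apply] at this

theorem normIdeal_extIdeal_self (h : E ≤ E') {ι : Type*} [Fintype ι]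
    {τ : ι → (QBar ≃ₐ[ℚ] QBar)} (hτ : GalSystem h τ) (I : (Ideal (𝓞 E))⁰) :
    normIdeal h (extIdeal h I) = I ^ Fintype.card ι := by
  refine extIdeal_injective h ?_
  rw [extIdeal_normIdeal_eq_prod h hτ, map_pow]
  have : ∀ i, galIdeal (τ i) E' (extIdeal h I) = extIdeal h I := fun i => by
    rw [galIdeal_extIdeal, galIdeal_eq_self (hτ.fixes i)]
  simp_rw [this]
  rw [Finset.prod_const, Finset.card_univ]

/-- Base change for norms of ideals in a diamond of fields. -/
theorem normIdeal_extIdeal {E₁ E₂ L₁ L₂ : GaloisNF} (hE : E₁ ≤ E₂) (hL : L₁ ≤ L₂) (h₁ : E₁ ≤ L₁)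
    (h₂ : E₂ ≤ L₂) {ι : Type*} [Fintype ι] {τ : ι → (QBar ≃ₐ[ℚ] QBar)} (hτ : GalSystem hE τ)
    (hτ' : GalSystem hL τ) (I : (Ideal (𝓞 E₂))⁰) :
    normIdeal hL (extIdeal h₂ I) = extIdeal h₁ (normIdeal hE I) := by
  refine extIdeal_injective hL ?_
  rw [extIdeal_normIdeal_eq_prod hL hτ', extIdeal_extIdeal, ← extIdeal_extIdeal hE h₂,
    extIdeal_normIdeal_eq_prod hE hτ, map_prod]
  exact Finset.prod_congr rfl fun i _ => galIdeal_extIdeal _ _ _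

end Systems

/-! ### Galois groups of the two towers. -/

section Towers

variable {p : ℕ} [Fact p.Prime] {K : GaloisNF} {q : ℕ} [Fact q.Prime] {ν : QBar ≃ₐ[ℚ] QBar}

theorem orderOf_restrictNormal_fieldF (hq : q ≡ 1 [MOD p])
    (hνF : Subgroup.zpowers (ν.restrictNormal (fieldF p q)) = ⊤) :
    orderOf (ν.restrictNormal (fieldF p q)) = p := by
  rw [← Nat.card_zpowers, hνF, Subgroup.card_top, IsGalois.card_aut_eq_finrank]
  exact finrank_fieldF p q hq

theorem exists_pow_eq_on_fieldF (hq : q ≡ 1 [MOD p])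
    (hνF : Subgroup.zpowers (ν.restrictNormal (fieldF p q)) = ⊤) (σ : QBar ≃ₐ[ℚ] QBar) :
    ∃ i < p, ∀ x ∈ (fieldF p q).toIntermediateField, σ x = (ν ^ i) x := by
  classical
  have h1 : σ.restrictNormal (fieldF p q) ∈
      Subgroup.zpowers (ν.restrictNormal (fieldF p q)) := hνF ▸ Subgroup.mem_top _
  rw [mem_zpowers_iff_mem_range_orderOf, orderOf_restrictNormal_fieldF hq hνF] at h1
  obtain ⟨i, hi, h2⟩ := Finset.mem_image.mp h1
  refine ⟨i, Finset.mem_range.mp hi, fun x hx => ?_⟩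
  have h3 : (ν ^ i).restrictNormal (fieldF p q) = ν.restrictNormal (fieldF p q) ^ i :=
    map_pow (AlgEquiv.restrictNormalHom (fieldF p q)) ν i
  have h4 := coe_restrictNormal σ (fieldF p q) ⟨x, hx⟩
  have h5 := coe_restrictNormal (ν ^ i) (fieldF p q) ⟨x, hx⟩
  rw [h3, h2] at h5
  exact h4.symm.trans h5

theorem pow_apply_of_mem_towerK
    (hνK : ∀ n, ∀ x ∈ (towerK p K n).toIntermediateField, ν x = x) (i n : ℕ) {x : QBar}
    (hx : x ∈ (towerK p K n).toIntermediateField) : (ν ^ i) x = x := by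
  induction i with
  | zero => rw [pow_zero, AlgEquiv.one_apply]
  | succ i ih => rw [pow_succ, AlgEquiv.mul_apply, hνK n x hx, ih]

/-- The powers of `ν` represent the Galois group of `𝕃_n/𝕂_n`. -/
theorem galSystem_pow (hq : q ≡ 1 [MOD p])
    (hνK : ∀ n, ∀ x ∈ (towerK p K n).toIntermediateField, ν x = x)
    (hνF : Subgroup.zpowers (ν.restrictNormal (fieldF p q)) = ⊤) (n : ℕ) :
    GalSystem (towerK_le_towerL p K q n) fun i : Fin p => ν ^ (i : ℕ) := by
  refine ⟨fun i x => pow_apply_of_mem_towerK hνK i n x.2, fun i j hij => ?_, fun σ hσ => ?_⟩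
  · have h1 : (ν.restrictNormal (fieldF p q)) ^ (i : ℕ) =
        (ν.restrictNormal (fieldF p q)) ^ (j : ℕ) := by
      have h3 : ∀ k, (ν ^ k).restrictNormal (fieldF p q) = ν.restrictNormal (fieldF p q) ^ k :=
        fun k => map_pow (AlgEquiv.restrictNormalHom (fieldF p q)) ν k
      rw [← h3, ← h3]
      refine AlgEquiv.ext fun x => Subtype.ext ?_
      rw [coe_restrictNormal, coe_restrictNormal]
      have hle : fieldF p q ≤ towerL p K q n := le_sup_right
      exact hij ⟨x, hle x.2⟩
    refine Fin.ext (pow_injOn_Iio_orderOf ?_ ?_ h1)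
    · rw [orderOf_restrictNormal_fieldF hq hνF]
      exact i.2
    · rw [orderOf_restrictNormal_fieldF hq hνF]
      exact j.2
  · obtain ⟨i, hi, h⟩ := exists_pow_eq_on_fieldF hq hνF σ
    refine ⟨⟨i, hi⟩, fun x => ?_⟩
    refine apply_eq_of_mem_sup (E := (towerK p K n).toIntermediateField)
      (E' := (fieldF p q).toIntermediateField) (fun y hy => ?_) h x x.2
    rw [hσ ⟨y, hy⟩, pow_apply_of_mem_towerK hνK i n hy]

/-- Multiply each representative of Gal(𝕂_j/𝕂_i) by the inverse of the power of `ν` that agrees with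
it on 𝔽. As `ν` is trivial on 𝕂_∞, only the action on 𝔽 changes, and it becomes trivial. A common
family for both towers is what makes norms compatible with lifts. -/
theorem exists_galSystem_tower (hq : q ≡ 1 [MOD p])
    (hνK : ∀ n, ∀ x ∈ (towerK p K n).toIntermediateField, ν x = x)
    (hνF : Subgroup.zpowers (ν.restrictNormal (fieldF p q)) = ⊤) {i j : ℕ} (h : i ≤ j) :
    ∃ (ι : Type) (_ : Fintype ι) (τ : ι → (QBar ≃ₐ[ℚ] QBar)),
      GalSystem (towerK_mono p K h) τ ∧ GalSystem (towerL_mono p K q h) τ := by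
  obtain ⟨ι, hι, τ, hτ⟩ := exists_galSystem (towerK_mono p K h)
  choose a ha haF using fun k => exists_pow_eq_on_fieldF hq hνF (τ k)
  have hmem : ∀ (E : GaloisNF) (ρ : QBar ≃ₐ[ℚ] QBar) {x : QBar}, x ∈ E.toIntermediateField →
      ρ x ∈ E.toIntermediateField := fun E ρ x hx => by
    rw [← coe_restrictNormal ρ E ⟨x, hx⟩]
    exact Subtype.property _
  have hinv : ∀ k (x : QBar), (ν ^ a k) ((ν ^ a k)⁻¹ x) = x := fun k x =>
    (ν ^ a k).apply_symm_apply x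
  have hinv' : ∀ k (x : QBar), (ν ^ a k)⁻¹ ((ν ^ a k) x) = x := fun k x =>
    (ν ^ a k).symm_apply_apply x
  have hK : ∀ k n, ∀ x ∈ (towerK p K n).toIntermediateField, (τ k * (ν ^ a k)⁻¹) x = τ k x := by
    intro k n x hx
    rw [AlgEquiv.mul_apply]
    congr 1
    have := hinv' k x
    rwa [pow_apply_of_mem_towerK hνK _ n hx] at this
  have hF : ∀ k, ∀ x ∈ (fieldF p q).toIntermediateField, (τ k * (ν ^ a k)⁻¹) x = x := by
    intro k x hx
    rw [AlgEquiv.mul_apply, haF k _ (hmem _ _ hx), hinv]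
  have hone : ∀ (E : IntermediateField ℚ QBar) (ρ : QBar ≃ₐ[ℚ] QBar), (∀ x ∈ E, ρ x = x) ↔
      ∀ x ∈ E, ρ x = (1 : QBar ≃ₐ[ℚ] QBar) x := fun E ρ => Iff.rfl
  refine ⟨ι, hι, fun k => τ k * (ν ^ a k)⁻¹, ⟨fun k x => ?_, fun k l hkl => ?_, fun σ hσ => ?_⟩,
    ⟨fun k x => ?_, fun k l hkl => ?_, fun σ hσ => ?_⟩⟩
  · rw [hK k i x x.2, hτ.fixes]
  · refine hτ.inj k l fun x => ?_
    rw [← hK k j x x.2, ← hK l j x x.2]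
    exact hkl x
  · obtain ⟨k, hk⟩ := hτ.surj σ hσ
    exact ⟨k, fun x => by rw [hK k j x x.2, hk]⟩
  · refine (hone (towerL p K q i).toIntermediateField _).mpr ?_ x x.2
    refine apply_eq_of_mem_sup (E := (towerK p K i).toIntermediateField)
      (E' := (fieldF p q).toIntermediateField) (fun y hy => ?_) (fun y hy => hF k y hy)
    rw [hK k i y hy]
    exact hτ.fixes k ⟨y, hy⟩
  · refine hτ.inj k l fun x => ?_
    rw [← hK k j x x.2, ← hK l j x x.2]
    exact hkl ⟨x, towerK_le_towerL p K q j x.2⟩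
  · obtain ⟨k, hk⟩ := hτ.surj σ fun x => hσ ⟨x, towerK_le_towerL p K q i x.2⟩
    refine ⟨k, fun x => ?_⟩
    refine apply_eq_of_mem_sup (E := (towerK p K j).toIntermediateField)
      (E' := (fieldF p q).toIntermediateField) (fun y hy => ?_) (fun y hy => ?_) x x.2
    · rw [hK k j y hy]
      exact hk ⟨y, hy⟩
    · rw [hF k y hy]
      have hle : fieldF p q ≤ towerL p K q i := le_sup_right
      exact hσ ⟨y, hle hy⟩

end Towers

end IwasawaThaine

namespace IwasawaThaine

open Module

/-! ### Inertia at `q` -/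

section Inertia

variable {E E' : GaloisNF} {q : ℕ} [Fact q.Prime]

theorem liesOver_of_natCast_mem {P : Ideal (𝓞 E)} (hP : P.IsPrime) (hq : (q : 𝓞 E) ∈ P) :
    P.LiesOver (Ideal.span {(q : ℤ)}) := by
  have hpr : Prime (q : ℤ) := Nat.prime_iff_prime_int.mp Fact.out
  have hmax : (Ideal.span {(q : ℤ)}).IsMaximal :=
    PrincipalIdealRing.isMaximal_of_irreducible hpr.irreducible
  refine ⟨hmax.eq_of_le (Ideal.IsPrime.under ℤ P).ne_top ?_⟩
  rw [Ideal.span_singleton_le_iff_mem, Ideal.under_def, Ideal.mem_comap]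
  simpa using hq

theorem span_natCast_ne_bot : (Ideal.span {(q : ℤ)}) ≠ ⊥ := by
  rw [Ne, Ideal.span_singleton_eq_bot]
  exact_mod_cast (Fact.out : q.Prime).ne_zero

instance isPrime_span_natCast : (Ideal.span {(q : ℤ)}).IsPrime := by
  rw [Ideal.span_singleton_prime (by exact_mod_cast (Fact.out : q.Prime).ne_zero)]
  exact Nat.prime_iff_prime_int.mp Fact.out

/-- The ramification index is the order of the inertia group. Ramification is thus read off from the
powers of `P` containing `q`. -/
theorem natCast_mem_pow_iff {P : Ideal (𝓞 E)} (hP : P.IsPrime) (hq : (q : 𝓞 E) ∈ P) (k : ℕ) :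
    (q : 𝓞 E) ∈ P ^ k ↔ k ≤ Nat.card (P.inertia Gal(E/ℚ)) := by
  have := liesOver_of_natCast_mem hP hq
  have hq0 : (q : 𝓞 E) ≠ 0 := by exact_mod_cast (Fact.out : q.Prime).ne_zero
  have hmap : (Ideal.span {(q : ℤ)}).map (algebraMap ℤ (𝓞 E)) = Ideal.span {(q : 𝓞 E)} := by
    rw [Ideal.map_span, Set.image_singleton, map_natCast]
  have hbot : Ideal.span {(q : 𝓞 E)} ≠ ⊥ := by rwa [Ne, Ideal.span_singleton_eq_bot]
  have hfin : FiniteMultiplicity P (Ideal.span {(q : 𝓞 E)}) := by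
    refine FiniteMultiplicity.of_not_isUnit ?_ hbot
    rw [Ideal.isUnit_iff]
    exact hP.ne_top
  rw [Ideal.card_inertia_eq_ramificationIdxIn (Ideal.span {(q : ℤ)}) P,
    Ideal.ramificationIdxIn_eq_ramificationIdx (Ideal.span {(q : ℤ)}) P Gal(E/ℚ),
    ← Ideal.ramificationIdx'_eq_ramificationIdx (Ideal.span {(q : ℤ)}) P span_natCast_ne_bot,
    Ideal.IsDedekindDomain.ramificationIdx'_eq_multiplicity (by rwa [hmap]) hP, hmap,
    ← hfin.pow_dvd_iff_le_multiplicity, Ideal.dvd_span_singleton]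

theorem card_inertia_eq {P P' : Ideal (𝓞 E)} (hP : P.IsPrime) (hq : (q : 𝓞 E) ∈ P)
    (hP' : P'.IsPrime) (hq' : (q : 𝓞 E) ∈ P') :
    Nat.card (P.inertia Gal(E/ℚ)) = Nat.card (P'.inertia Gal(E/ℚ)) := by
  have := liesOver_of_natCast_mem hP hq
  have := liesOver_of_natCast_mem hP' hq'
  rw [Ideal.card_inertia_eq_ramificationIdxIn (Ideal.span {(q : ℤ)}) P,
    Ideal.card_inertia_eq_ramificationIdxIn (Ideal.span {(q : ℤ)}) P']

theorem comap_map_extInt (h : E ≤ E') (I : Ideal (𝓞 E)) : (I.map (extInt h)).comap (extInt h) = I :=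
  let : Algebra E E' := (incl h).toAlgebra
  Ideal.comap_map_eq_self_of_faithfullyFlat (B := 𝓞 E') I

theorem exists_prime_comap_extInt (h : E ≤ E') (P : Ideal (𝓞 E)) (hP : P.IsPrime) :
    ∃ P' : Ideal (𝓞 E'), P'.IsPrime ∧ P'.comap (extInt h) = P := by
  let : Algebra E E' := (incl h).toAlgebra
  obtain ⟨P', -, h1, h2⟩ := Ideal.exists_ideal_over_prime_of_isIntegral (S := 𝓞 E') P ⊥
    ((Ideal.comap_bot_of_injective _ (extInt_injective h)).trans_le bot_le)
  exact ⟨P', h1, h2⟩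

/-- `q` is unramified in `E`: the inertia groups of the primes above `q` are trivial. -/
def UnramifiedAt (q : ℕ) (E : GaloisNF) : Prop :=
  ∀ P : Ideal (𝓞 E), P.IsPrime → (q : 𝓞 E) ∈ P → ∀ σ : QBar ≃ₐ[ℚ] QBar,
    (∀ x, galInt σ E x - x ∈ P) → ∀ x : E, σ x = x

theorem unramifiedAt_of_notMem_sq {P : Ideal (𝓞 E)} (hP : P.IsPrime) (hq : (q : 𝓞 E) ∈ P)
    (h2 : (q : 𝓞 E) ∉ P ^ 2) : UnramifiedAt q E := by
  intro P' hP' hq' σ hσ x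
  rw [natCast_mem_pow_iff hP hq, card_inertia_eq hP hq hP' hq', not_le] at h2
  have h1 : P'.inertia Gal(E/ℚ) = ⊥ := Subgroup.eq_bot_of_card_le _ (by omega)
  have h3 : σ.restrictNormal E ∈ P'.inertia Gal(E/ℚ) := fun x => hσ x
  rw [h1, Subgroup.mem_bot] at h3
  have := coe_restrictNormal σ E x
  rw [h3] at this
  exact this.symm

/-- In `e * f * g = [E : ℚ]` the number of primes already exhausts the degree. -/
theorem TotallySplit.notMem_sq (hs : TotallySplit q E) {P : Ideal (𝓞 E)} (hP : P.IsPrime)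
    (hq : (q : 𝓞 E) ∈ P) : (q : 𝓞 E) ∉ P ^ 2 := by
  have := liesOver_of_natCast_mem hP hq
  rw [natCast_mem_pow_iff hP hq, Ideal.card_inertia_eq_ramificationIdxIn (Ideal.span {(q : ℤ)}) P]
  have h1 := Ideal.ncard_primesOver_mul_ramificationIdxIn_mul_inertiaDegIn (Ideal.span {(q : ℤ)})
    (𝓞 E) Gal(E/ℚ)
  rw [hs, IsGalois.card_aut_eq_finrank] at h1
  have h2 := Nat.eq_one_of_mul_eq_one_right
    ((Nat.mul_eq_left (Module.finrank_pos (R := ℚ) (M := E)).ne').mp h1)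
  omega

/-- A square lost in extension would already be present below: contracting the extension of `Q ^ 2`
gives back `Q ^ 2`. So `q` is not in the square of the prime generated by `Q`, and all primes above
`q` have the same ramification. -/
theorem unramifiedAt_of_inert (h : E ≤ E') {Q : Ideal (𝓞 E)} (hQ : Q.IsPrime) (hq : (q : 𝓞 E) ∈ Q)
    (hs : TotallySplit q E) (hi : Inert h Q) : UnramifiedAt q E' := by
  have hmem : (q : 𝓞 E') ∈ Q.map (extInt h) := by
    have := Ideal.mem_map_of_mem (extInt h) hq
    rwa [map_natCast] at this
  refine unramifiedAt_of_notMem_sq (P := Q.map (extInt h)) hi hmem fun h2 => ?_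
  refine hs.notMem_sq hQ hq ?_
  rw [← Ideal.map_pow, ← map_natCast (extInt h), ← Ideal.mem_comap, comap_map_extInt] at h2
  exact h2

/-- The field `ℚ(ζ_q)`. -/
noncomputable def cycloNF (q : ℕ) [Fact q.Prime] : GaloisNF := cycloSub q Set.univ

theorem coe_cycloNF : (cycloNF q).toIntermediateField = cyclo q :=
  le_antisymm (coe_cycloSub_le q _) (le_coe_cycloSub le_rfl (Set.mem_univ _))

theorem galInt_sub_mem_comap (h : E ≤ E') {P : Ideal (𝓞 E')} {σ : QBar ≃ₐ[ℚ] QBar}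
    (hσ : ∀ x, galInt σ E' x - x ∈ P) (y : 𝓞 E) : galInt σ E y - y ∈ P.comap (extInt h) := by
  have h1 : extInt h (galInt σ E y) = galInt σ E' (extInt h y) :=
    int_ext (by rw [coe_extInt, coe_galInt, coe_galInt, coe_extInt])
  rw [Ideal.mem_comap, map_sub, h1]
  exact hσ _

/-- `q` is the product of the `q - 1` numbers `1 - z ^ k`. One of them lies in `P`, and it divides
all the others. -/
theorem natCast_mem_pow_pred {z : 𝓞 E} (hz : IsPrimitiveRoot z q) {P : Ideal (𝓞 E)}
    (hP : P.IsPrime) (hq : (q : 𝓞 E) ∈ P) : (q : 𝓞 E) ∈ P ^ (q - 1) := by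
  have hq1 : q - 1 + 1 = q := Nat.sub_add_cancel (Fact.out : q.Prime).one_le
  have h1 := IsPrimitiveRoot.prod_one_sub_pow_eq_order (n := q - 1) (hq1.symm ▸ hz)
  have h2 : ∏ k ∈ Finset.range (q - 1), (1 - z ^ (k + 1)) = (q : 𝓞 E) := by
    rw [h1]
    exact_mod_cast congrArg (Nat.cast (R := 𝓞 E)) hq1
  obtain ⟨k, hk, hkP⟩ : ∃ k ∈ Finset.range (q - 1), 1 - z ^ (k + 1) ∈ P := by
    rw [← Ideal.IsPrime.prod_mem_iff, h2]
    exact hq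
  have hcop : Nat.Coprime (k + 1) q := by
    rw [Nat.coprime_comm]
    refine (Nat.Prime.coprime_iff_not_dvd Fact.out).mpr fun hd => ?_
    have := Nat.le_of_dvd k.succ_pos hd
    have := Finset.mem_range.mp hk
    omega
  have hw : IsPrimitiveRoot (z ^ (k + 1)) q := hz.pow_of_coprime _ hcop
  have hall : ∀ j, 1 - z ^ (j + 1) ∈ P := fun j => by
    obtain ⟨i, -, hi⟩ := hw.eq_pow_of_pow_eq_one
      (show (z ^ (j + 1)) ^ q = 1 by rw [← pow_mul, mul_comm, pow_mul, hz.pow_eq_one, one_pow])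
    rw [← hi, ← neg_mem_iff, neg_sub]
    refine P.mem_of_dvd (sub_one_dvd_pow_sub_one _ _) ?_
    rwa [← neg_mem_iff, neg_sub]
  rw [← h2, ← Finset.card_range (q - 1), ← Finset.prod_const, Finset.card_range]
  exact Ideal.prod_mem_prod fun j _ => hall j

theorem exists_isPrimitiveRoot_int {N : ℕ} [NeZero N] (h : cyclo N ≤ E.toIntermediateField) :
    ∃ z : 𝓞 E, IsPrimitiveRoot z N := by
  obtain ⟨ζ, hζ⟩ := exists_isPrimitiveRoot N
  have h1 : IsPrimitiveRoot (⟨ζ, h (mem_cyclo hζ.pow_eq_one)⟩ : E) N :=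
    IsPrimitiveRoot.of_map_of_injective (f := E.toIntermediateField.val) hζ
      Subtype.val_injective
  exact ⟨h1.toInteger, h1.toInteger_isPrimitiveRoot⟩

theorem apply_eq_of_mem_cyclo {σ τ : QBar ≃ₐ[ℚ] QBar} {N : ℕ}
    (h : ∀ x : QBar, x ^ N = 1 → σ x = τ x) : ∀ x ∈ cyclo N, σ x = τ x := by
  intro x hx
  refine IntermediateField.adjoin_induction (F := ℚ) (s := {x : QBar | x ^ N = 1})
    (p := fun x _ => σ x = τ x)
    (fun x hx => h x hx) (fun r => ?_) (fun x y _ _ hx hy => ?_) (fun x _ hx => ?_)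
    (fun x y _ _ hx hy => ?_) hx
  · rw [AlgEquiv.commutes, AlgEquiv.commutes]
  · rw [map_add, map_add, hx, hy]
  · rw [map_inv₀, map_inv₀, hx]
  · rw [map_mul, map_mul, hx, hy]

/-- If `q` is unramified in `E`, then it is totally ramified in `E(ζ_q)/E`. -/
theorem sub_mem_of_unramifiedAt (hE : UnramifiedAt q E) {M : GaloisNF} (hEM : E ≤ M)
    (hcM : cycloNF q ≤ M) (hM : M ≤ E ⊔ cycloNF q) {P : Ideal (𝓞 M)}
    (hP : P.IsPrime) (hq : (q : 𝓞 M) ∈ P) {σ : QBar ≃ₐ[ℚ] QBar}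
    (hσ : ∀ x : E, σ x = x) (x : 𝓞 M) : galInt σ _ x - x ∈ P := by
  have hq1 : NeZero q := ⟨(Fact.out : q.Prime).ne_zero⟩
  obtain ⟨z, hz⟩ := exists_isPrimitiveRoot_int (E := M) (N := q)
    (coe_cycloNF.ge.trans (coe_le.mp hcM))
  have hz' : IsPrimitiveRoot ((z : M) : QBar) q :=
    (hz.map_of_injective (f := algebraMap (𝓞 M) M) RingOfIntegers.coe_injective).map_of_injective
      (f := M.toIntermediateField.val) Subtype.val_injective
  let S : Set Gal(M/ℚ) := {g | ∀ x : M, (x : QBar) ∈ E.toIntermediateField → g x = x}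
  have hlift : ∀ (g : Gal(M/ℚ)) (y : M), g.liftNormal QBar (y : QBar) = (g y : M) :=
    fun g y => AlgEquiv.liftNormal_commutes g QBar y
  have hIS : (P.inertia Gal(M/ℚ) : Set Gal(M/ℚ)) ⊆ S := by
    intro g hg y hy
    have h1 : g.liftNormal QBar (y : QBar) = y := by
      refine hE (P.comap (extInt hEM)) (hP.comap _) (by rwa [Ideal.mem_comap, map_natCast])
        (g.liftNormal QBar) (galInt_sub_mem_comap hEM fun w => ?_) ⟨(y : QBar), hy⟩
      have : galInt (g.liftNormal QBar) M w = g • w :=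
        int_ext (by rw [coe_galInt, hlift]; rfl)
      rw [this]
      exact hg w
    exact Subtype.ext ((hlift g y).symm.trans h1)
  -- Gal(M/E) injects into the `q - 1` primitive roots of unity, while the inertia group has order
  -- at least `q - 1`. It is contained in Gal(M/E) because `q` is unramified in `E`, so the two
  -- coincide.
  have hS : S.ncard ≤ Nat.card (P.inertia Gal(M/ℚ)) := by
    refine le_trans ?_ ((natCast_mem_pow_iff hP hq _).mp (natCast_mem_pow_pred hz hP hq))
    have hc : (primitiveRoots q QBar).card = q - 1 := by
      rw [hz'.card_primitiveRoots, Nat.totient_prime Fact.out]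
    rw [← hc, ← Set.ncard_coe_finset]
    refine Set.ncard_le_ncard_of_injOn (fun g => ((g (z : M) : M) : QBar)) (fun g _ => ?_)
      (fun g hg g' hg' hgg => ?_) (Finset.finite_toSet _)
    · rw [Finset.mem_coe, mem_primitiveRoots (Fact.out : q.Prime).pos, ← hlift]
      exact hz'.map_of_injective (f := g.liftNormal QBar) (AlgEquiv.injective _)
    · have hgg' : ((g (z : M) : M) : QBar) = ((g' (z : M) : M) : QBar) := hgg
      rw [← hlift, ← hlift] at hgg'
      refine AlgEquiv.ext fun y => Subtype.ext ?_
      rw [← hlift, ← hlift]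
      refine apply_eq_of_mem_sup (E := E.toIntermediateField)
        (E' := (cycloNF q).toIntermediateField) (fun w hw => ?_) (fun w hw => ?_) y (hM y.2)
      · have h1 := hlift g ⟨w, hEM hw⟩
        have h2 := hlift g' ⟨w, hEM hw⟩
        rw [hg _ hw] at h1
        rw [hg' _ hw] at h2
        exact h1.trans h2.symm
      · rw [coe_cycloNF] at hw
        refine apply_eq_of_mem_cyclo (fun w hw => ?_) w hw
        obtain ⟨i, -, rfl⟩ := hz'.eq_pow_of_pow_eq_one hw
        rw [map_pow, map_pow, hgg']
  have hfinal : (P.inertia Gal(M/ℚ) : Set Gal(M/ℚ)) = S :=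
    Set.eq_of_subset_of_ncard_le hIS hS (Set.toFinite _)
  have h1 : σ.restrictNormal M ∈ S := fun y hy =>
    Subtype.ext ((coe_restrictNormal σ M y).trans (hσ ⟨y, hy⟩))
  rw [← hfinal] at h1
  exact h1 x

end Inertia

end IwasawaThaine

namespace IwasawaThaine

open Module

/-! ### Total ramification at `q`, no ramification elsewhere. -/

section Ramified

variable {E E' : GaloisNF} {q : ℕ} [Fact q.Prime]

/-- If `q` is unramified in `E`, then it is totally ramified in subextensions of `E(ζ_q)/E`. -/
theorem galInt_sub_mem (hE : UnramifiedAt q E) (h : E ≤ E') (hE' : E' ≤ E ⊔ cycloNF q)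
    {P : Ideal (𝓞 E')} (hP : P.IsPrime) (hq : (q : 𝓞 E') ∈ P) {σ : QBar ≃ₐ[ℚ] QBar}
    (hσ : ∀ x : E, σ x = x) (x : 𝓞 E') : galInt σ _ x - x ∈ P := by
  obtain ⟨P', hP', hc⟩ := exists_prime_comap_extInt hE' P hP
  rw [← hc]
  refine galInt_sub_mem_comap hE' (fun y => ?_) x
  refine sub_mem_of_unramifiedAt hE (h.trans hE') le_sup_right le_rfl hP' ?_ hσ y
  rwa [← hc, Ideal.mem_comap, map_natCast] at hq

/-- The norm of `x ∈ P` lies in `P'`, hence so does a conjugate of `x`, which is congruent to `x`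
modulo `P'`. It yields the uniqueness of the prime above a totally ramified one. -/
theorem GalSystem.le_of_comap_le {h : E ≤ E'} {ι : Type*} [Fintype ι]
    {τ : ι → (QBar ≃ₐ[ℚ] QBar)} (hτ : GalSystem h τ) {P P' : Ideal (𝓞 E')}
    (hP' : P'.IsPrime) (hc : P.comap (extInt h) ≤ P'.comap (extInt h))
    (ht : ∀ i x, galInt (τ i) E' x - x ∈ P') : P ≤ P' := by
  intro x hx
  have h1 : extInt h (normInt h x) ∈ P := by
    obtain ⟨i, hi⟩ := hτ.surj 1 fun x => AlgEquiv.one_apply _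
    rw [extInt_normInt h hτ]
    refine P.mem_of_dvd (Finset.dvd_prod_of_mem _ (Finset.mem_univ i)) ?_
    have : galInt (τ i) E' x = x := int_ext (by rw [coe_galInt, ← hi, AlgEquiv.one_apply])
    rwa [this]
  have h2 : extInt h (normInt h x) ∈ P' := hc h1
  rw [extInt_normInt h hτ, Ideal.IsPrime.prod_mem_iff] at h2
  obtain ⟨i, -, hi⟩ := h2
  have := P'.sub_mem hi (ht i x)
  rwa [sub_sub_cancel] at this

theorem exists_eq_map_galInt {P P' : Ideal (𝓞 E)} (hP : P.IsPrime) (hq : (q : 𝓞 E) ∈ P)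
    (hP' : P'.IsPrime) (hq' : (q : 𝓞 E) ∈ P') :
    ∃ σ : QBar ≃ₐ[ℚ] QBar, P' = P.map (galInt σ E) := by
  have := liesOver_of_natCast_mem hP hq
  have := liesOver_of_natCast_mem hP' hq'
  obtain ⟨g, hg⟩ := Ideal.exists_smul_eq_of_isGaloisGroup (Ideal.span {(q : ℤ)}) P P' Gal(E/ℚ)
  refine ⟨g.liftNormal QBar, ?_⟩
  rw [← hg, Ideal.pointwise_smul_def]
  have : (galInt (g.liftNormal QBar) E : 𝓞 E →+* 𝓞 E) = MulSemiringAction.toRingHom _ (𝓞 E) g :=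
    RingHom.ext fun x => int_ext ((coe_galInt _ x).trans (AlgEquiv.liftNormal_commutes g QBar x))
  exact congrArg (fun f => Ideal.map f P) this.symm

/-- If a prime over `q` generates a prime ideal of `E''`, then all primes over `q` of `E''`
come from `E`, hence from every intermediate field `E'`. -/
theorem exists_eq_map_extInt {E'' : GaloisNF} (h : E ≤ E') (h' : E' ≤ E'') {Q : Ideal (𝓞 E)}
    (hq : (q : 𝓞 E) ∈ Q) (hi : Inert (h.trans h') Q) {P : Ideal (𝓞 E'')} (hP : P.IsPrime)
    (hqP : (q : 𝓞 E'') ∈ P) : ∃ P' : Ideal (𝓞 E'), P = P'.map (extInt h') := by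
  have hmem : (q : 𝓞 E'') ∈ Q.map (extInt (h.trans h')) := by
    have := Ideal.mem_map_of_mem (extInt (h.trans h')) hq
    rwa [map_natCast] at this
  -- All primes above `q` are conjugate to the extension of `Q`, and conjugation commutes with
  -- extension.
  obtain ⟨σ, hσ⟩ := exists_eq_map_galInt hi hmem hP hqP
  refine ⟨(Q.map (extInt h)).map (galInt σ E'), ?_⟩
  rw [hσ]
  have e1 : ((galInt σ E'' : 𝓞 E'' →+* 𝓞 E'').comp (extInt (h.trans h'))) =
      ((extInt h').comp (galInt σ E' : 𝓞 E' →+* 𝓞 E')).comp (extInt h) :=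
    RingHom.ext fun x => int_ext (by
      change ((galInt σ E'' (extInt _ x) : E'') : QBar) =
        ((extInt h' (galInt σ E' (extInt h x)) : E'') : QBar)
      rw [coe_extInt, coe_galInt, coe_galInt, coe_extInt, coe_extInt])
  have e2 := congrArg (fun f => Ideal.map f Q) e1
  rw [← Ideal.map_map, ← Ideal.map_map, ← Ideal.map_map] at e2
  exact e2

/-- The quotient `z / w` is a primitive `r`-th root of unity, and `1 - z / w` divides `r`. -/
theorem natCast_mem_of_sub_mem {R : Type*} [CommRing R] [IsDomain R] {r : ℕ} (hr : r.Prime)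
    {z w : R} (hz : z ^ r = 1) (hw : w ^ r = 1) (hne : z ≠ w) {P : Ideal R} (hmem : z - w ∈ P) :
    (r : R) ∈ P := by
  have hr1 : r - 1 + 1 = r := Nat.sub_add_cancel hr.one_le
  have hwr : w ^ (r - 1) * w = 1 := by rw [← pow_succ, hr1, hw]
  have hu : IsPrimitiveRoot (z * w ^ (r - 1)) (r - 1 + 1) := by
    rw [hr1]
    have : Fact r.Prime := ⟨hr⟩
    have h1 : orderOf (z * w ^ (r - 1)) = r := by
      refine orderOf_eq_prime ?_ fun h => hne ?_
      · rw [mul_pow, hz, one_mul, ← pow_mul, mul_comm, pow_mul, hw, one_pow]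
      · have := congrArg (· * w) h
        simpa only [mul_assoc, hwr, mul_one, one_mul] using this
    conv => enter [2]; rw [← h1]
    exact IsPrimitiveRoot.orderOf _
  have h2 := IsPrimitiveRoot.prod_one_sub_pow_eq_order hu
  have h3 : ((r - 1 : ℕ) : R) + 1 = r := by exact_mod_cast congrArg (Nat.cast (R := R)) hr1
  rw [← h3, ← h2]
  refine P.mem_of_dvd (Finset.dvd_prod_of_mem _ (Finset.mem_range.mpr
    (Nat.sub_pos_of_lt hr.one_lt))) ?_
  have h4 : 1 - (z * w ^ (r - 1)) ^ (0 + 1) = -(w ^ (r - 1)) * (z - w) := by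
    linear_combination (-1 : R) * hwr
  rw [h4]
  exact P.mul_mem_left _ hmem

theorem apply_eq_of_sub_mem (hc : cycloNF q ≤ E')
    (hE' : E' ≤ E ⊔ cycloNF q) {P : Ideal (𝓞 E')} (hq : (q : 𝓞 E') ∉ P)
    {σ : QBar ≃ₐ[ℚ] QBar} (hσE : ∀ x : E, σ x = x) (hσ : ∀ x, galInt σ E' x - x ∈ P) (x : E') :
    σ x = x := by
  have hq1 : NeZero q := ⟨(Fact.out : q.Prime).ne_zero⟩
  obtain ⟨z, hz⟩ := exists_isPrimitiveRoot_int (E := E') (N := q)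
    (coe_cycloNF.ge.trans (coe_le.mp hc))
  have hz' : IsPrimitiveRoot ((z : E') : QBar) q :=
    (hz.map_of_injective (f := algebraMap (𝓞 E') E')
      RingOfIntegers.coe_injective).map_of_injective
      (f := E'.toIntermediateField.val) Subtype.val_injective
  have hfix : galInt σ E' z = z := by
    by_contra hne
    refine hq (natCast_mem_of_sub_mem Fact.out ?_ hz.pow_eq_one hne (hσ z))
    rw [← map_pow, hz.pow_eq_one, map_one]
  have hfix' : σ ((z : E') : QBar) = ((z : E') : QBar) := by rw [← coe_galInt, hfix]
  refine apply_eq_of_mem_sup (τ := 1) (E := E.toIntermediateField)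
    (E' := (cycloNF q).toIntermediateField) (fun w hw => hσE ⟨w, hw⟩) (fun w hw => ?_) x (hE' x.2)
  rw [coe_cycloNF] at hw
  refine apply_eq_of_mem_cyclo (fun w hw => ?_) w hw
  obtain ⟨i, -, rfl⟩ := hz'.eq_pow_of_pow_eq_one hw
  rw [map_pow, map_pow, hfix', AlgEquiv.one_apply]

/-- Primes not above `q` are unramified in `E(ζ_q)/E`. -/
theorem emultiplicity_map_extInt (h : E ≤ E') (hc : cycloNF q ≤ E')
    (hE' : E' ≤ E ⊔ cycloNF q) {P : Ideal (𝓞 E')} (hP : P.IsPrime) (hP0 : P ≠ ⊥)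
    (hq : (q : 𝓞 E') ∉ P) {I : Ideal (𝓞 E)} (hI : I ≠ ⊥) :
    emultiplicity P (I.map (extInt h)) = emultiplicity (P.comap (extInt h)) I := by
  let : Algebra E E' := (incl h).toAlgebra
  have : IsScalarTower ℚ E E' :=
    IsScalarTower.of_algebraMap_eq fun x => (map_ratCast (incl h) x).symm
  have : IsGalois E E' := IsGalois.tower_top_of_isGalois ℚ E E'
  have hlies : P.LiesOver (P.comap (extInt h)) := ⟨rfl⟩
  have hPc : (P.comap (extInt h)).IsPrime := hP.comap _
  have hPc0 : P.comap (extInt h) ≠ ⊥ := by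
    exact Ideal.under_ne_bot (𝓞 E) hP0
  have h1 := Ideal.IsDedekindDomain.emultiplicity_map_eq_ramificationIdx'_mul (S := 𝓞 E')
    (v := P.comap (extInt h)) (w := P) hI (Ideal.prime_of_isPrime hPc0 hPc).irreducible
    (Ideal.prime_of_isPrime hP0 hP).irreducible hP0
  have h2 : Nat.card (P.inertia Gal(E'/E)) = 1 := by
    have hbot : P.inertia Gal(E'/E) = ⊥ := by
      refine (Subgroup.eq_bot_iff_forall _).mpr fun g hg => ?_
      have hl : ∀ y : E', (g.restrictScalars ℚ).liftNormal QBar (y : QBar) = (g y : E') :=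
        fun y => AlgEquiv.liftNormal_commutes (g.restrictScalars ℚ) QBar y
      refine AlgEquiv.ext fun y => Subtype.ext ?_
      rw [← hl]
      refine apply_eq_of_sub_mem hc hE' hq (fun x => ?_) (fun x => ?_) y
      · have := hl (algebraMap E E' x)
        rw [AlgEquiv.commutes] at this
        exact this
      · have : galInt ((g.restrictScalars ℚ).liftNormal QBar) E' x = g • x :=
          int_ext (by rw [coe_galInt, hl]; rfl)
        rw [this]
        exact hg x
    rw [hbot, Subgroup.card_bot]
  rw [Ideal.card_inertia_eq_ramificationIdxIn (P.comap (extInt h)) P,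
    Ideal.ramificationIdxIn_eq_ramificationIdx (P.comap (extInt h)) P Gal(E'/E),
    ← Ideal.ramificationIdx'_eq_ramificationIdx (P.comap (extInt h)) P hPc0] at h2
  rw [h2, Nat.cast_one, one_mul] at h1
  exact h1

/-- Pass to `E(ζ_q)`, where `P` is unramified: the valuation of `I` at `P` equals the valuation of a
`p`-th power at a prime above. -/
theorem dvd_count_of_map_eq_pow (h : E ≤ E') (hE' : E' ≤ E ⊔ cycloNF q) {P : Ideal (𝓞 E)}
    (hP : P.IsPrime) (hP0 : P ≠ ⊥) (hq : (q : 𝓞 E) ∉ P) {I : Ideal (𝓞 E)} (hI : I ≠ ⊥)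
    {J : Ideal (𝓞 E')} {p : ℕ} (hp : p ≠ 0) (hJ : I.map (extInt h) = J ^ p) [DecidableEq (Ideal (𝓞 E))] :
    p ∣ (UniqueFactorizationMonoid.normalizedFactors I).count P := by
  have hEM : E ≤ E ⊔ cycloNF q := le_sup_left
  obtain ⟨P', hP', rfl⟩ := exists_prime_comap_extInt hEM P hP
  have hP0' : P' ≠ ⊥ := by
    rintro rfl
    exact hP0 (Ideal.comap_bot_of_injective _ (extInt_injective hEM))
  have h1 : I.map (extInt hEM) = (J.map (extInt hE')) ^ p := by
    rw [← Ideal.map_pow, ← hJ, Ideal.map_map]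
    rfl
  have h2 := emultiplicity_map_extInt hEM le_sup_right le_rfl hP' hP0'
    (by rwa [Ideal.mem_comap, map_natCast] at hq) hI
  have hpr := Ideal.prime_of_isPrime hP0' hP'
  have hJ0 : (J.map (extInt hE')) ^ p ≠ 0 := by
    rw [← h1]
    exact fun h0 => hI ((Ideal.map_eq_bot_iff_of_injective (extInt_injective hEM)).mp h0)
  rw [h1, UniqueFactorizationMonoid.emultiplicity_eq_count_normalizedFactors
    (Ideal.prime_of_isPrime hP0 hP).irreducible hI, normalize_eq, emultiplicity_pow hpr] at h2
  have h4 : FiniteMultiplicity P' (J.map (extInt hE')) :=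
    FiniteMultiplicity.of_prime_left hpr (ne_zero_of_dvd_ne_zero hJ0 (dvd_pow_self _ hp))
  rw [h4.emultiplicity_eq_multiplicity] at h2
  exact ⟨_, (by exact_mod_cast h2.symm)⟩

/-- An ideal whose valuations away from `q` are divisible by `p` is the product of a `p`-th power
and an ideal of `E`, if the primes over `q` come from `E`. -/
theorem exists_eq_pow_mul_extIdeal (h : E ≤ E') {p : ℕ} (c : (Ideal (𝓞 E'))⁰)
    (hA : ∀ P : Ideal (𝓞 E'), P.IsPrime → (q : 𝓞 E') ∈ P → ∃ P₁, P = Ideal.map (extInt h) P₁)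
    [DecidableEq (Ideal (𝓞 E'))]
    (hB : ∀ P : Ideal (𝓞 E'), P.IsPrime → P ≠ ⊥ → (q : 𝓞 E') ∉ P →
      p ∣ (UniqueFactorizationMonoid.normalizedFactors c.1).count P) :
    ∃ (d : (Ideal (𝓞 E'))⁰) (r : (Ideal (𝓞 E))⁰), c = d ^ p * extIdeal h r := by
  let S : Submonoid (Ideal (𝓞 E'))⁰ :=
    MonoidHom.mrange (powMonoidHom p) ⊔ MonoidHom.mrange (extIdeal h)
  have hc : c.1 ≠ ⊥ := nonZeroDivisors.coe_ne_zero c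
  suffices hS : c.1 ∈ S.map (Submonoid.subtype _) by
    obtain ⟨c', hc', he⟩ := hS
    obtain rfl : c' = c := Subtype.ext he
    obtain ⟨-, ⟨d, rfl⟩, -, ⟨r, rfl⟩, h2⟩ := Submonoid.mem_sup.mp hc'
    exact ⟨d, r, h2.symm⟩
  rw [← Ideal.prod_normalizedFactors_eq_self hc, Finset.prod_multiset_count]
  refine Submonoid.prod_mem _ fun P hP => ?_
  rw [Multiset.mem_toFinset] at hP
  have hpr := UniqueFactorizationMonoid.prime_of_normalized_factor P hP
  have hP0 : P ≠ ⊥ := hpr.ne_zero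
  have hPp := Ideal.isPrime_of_prime hpr
  by_cases hq : (q : 𝓞 E') ∈ P
  · refine Submonoid.pow_mem _ ?_ _
    obtain ⟨P₁, rfl⟩ := hA P hPp hq
    have h0 : P₁ ∈ (Ideal (𝓞 E))⁰ := mem_nonZeroDivisors_of_ne_zero fun h0 => hP0 (by
      rw [h0]
      exact Ideal.map_bot)
    exact ⟨extIdeal h ⟨P₁, h0⟩, Submonoid.mem_sup_right ⟨_, rfl⟩, rfl⟩
  · obtain ⟨k, hk⟩ := hB P hPp hP0 hq
    rw [hk, mul_comm, pow_mul]
    exact ⟨(⟨P, mem_nonZeroDivisors_of_ne_zero hP0⟩ ^ k) ^ p,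
      Submonoid.mem_sup_left ⟨_, rfl⟩, rfl⟩

end Ramified

end IwasawaThaine

namespace IwasawaThaine

open Module

/-! ### Hilbert 90 for integers, representatives prime to `q`, and units of absolute value one. -/

section HilbertNinety

variable {E E' : GaloisNF} {p : ℕ} [Fact p.Prime] {ν : QBar ≃ₐ[ℚ] QBar}

theorem exists_mul_eq_of_norm_eq {F L : Type} [Field F] [Field L] [Algebra F L]
    [FiniteDimensional F L] [IsGalois F L] {g : L ≃ₐ[F] L} (hg : ∀ x, x ∈ Subgroup.zpowers g)
    {a c : L} (hc : c ≠ 0) (h : Algebra.norm F a = Algebra.norm F c) :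
    ∃ y ≠ 0, a * g y = c * y := by
  have : IsCyclic (L ≃ₐ[F] L) := ⟨g, hg⟩
  have h1 : Algebra.norm F (a / c) = 1 := by
    rw [div_eq_mul_inv, map_mul, h, ← map_mul, mul_inv_cancel₀ hc, map_one]
  obtain ⟨y, hy⟩ := groupCohomology.exists_div_of_norm_eq_one hg h1
  have hgy : g y ≠ 0 := (map_ne_zero g).mpr y.ne_zero
  refine ⟨y, y.ne_zero, ?_⟩
  rw [div_eq_div_iff hgy hc] at hy
  rw [← hy, mul_comm]

/-- Hilbert's theorem 90 for integers. -/
theorem exists_mul_galInt_eq {h : E ≤ E'} (hν : GalSystem h fun i : Fin p => ν ^ (i : ℕ))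
    {a c : 𝓞 E'} (hc : c ≠ 0) (hac : normInt h a = normInt h c) :
    ∃ d : 𝓞 E', d ≠ 0 ∧ a * galInt ν E' d = c * d := by
  let : Algebra E E' := (incl h).toAlgebra
  have : IsScalarTower ℚ E E' :=
    IsScalarTower.of_algebraMap_eq fun x => (map_ratCast (incl h) x).symm
  have : IsGalois E E' := IsGalois.tower_top_of_isGalois ℚ E E'
  have : FiniteDimensional E E' := FiniteDimensional.right ℚ E E'
  obtain ⟨f, hf⟩ := hν.exists_equiv
  let g : E' ≃ₐ[E] E' := f ⟨1, (Fact.out : p.Prime).one_lt⟩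
  have hg : ∀ y : E', ((g y : E') : QBar) = ν y := fun y => by
    rw [hf]
    exact congrArg (fun σ : QBar ≃ₐ[ℚ] QBar => σ y) (pow_one ν)
  have hgen : ∀ x : E' ≃ₐ[E] E', x ∈ Subgroup.zpowers g := by
    intro x
    obtain ⟨i, rfl⟩ := f.surjective x
    refine ⟨(i : ℕ), AlgEquiv.ext fun y => Subtype.ext ?_⟩
    rw [hf]
    change (((g ^ ((i : ℕ) : ℤ)) y : E') : QBar) = _
    rw [zpow_natCast]
    generalize (i : ℕ) = k
    induction k generalizing y with
    | zero => rfl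
    | succ k ih => rw [pow_succ, pow_succ, AlgEquiv.mul_apply, AlgEquiv.mul_apply, ih, hg]
  have hn : ∀ z : 𝓞 E', algebraMap (𝓞 E) E (normInt h z) = Algebra.norm E (z : E') := fun z =>
    Algebra.algebraMap_intNorm (A := 𝓞 E) (K := E) (L := E') z
  obtain ⟨y, hy0, hy⟩ := exists_mul_eq_of_norm_eq hgen (a := (a : E')) (c := (c : E'))
    (by exact_mod_cast hc) (by rw [← hn, ← hn, hac])
  have hy1 : IsAlgebraic ℤ y :=
    (IsFractionRing.isAlgebraic_iff ℤ ℚ E').mpr (Algebra.IsAlgebraic.isAlgebraic y)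
  -- Hilbert 90 only gives an element of the field; a rational integer multiple is integral and
  -- satisfies the same equation because `ν` fixes the integer.
  obtain ⟨n, hn0, hd⟩ := hy1.exists_integral_multiple
  have hn1 : (n : E') ≠ 0 := by exact_mod_cast hn0
  let d : 𝓞 E' := ⟨n • y, hd⟩
  have hd' : (d : E') = n * y := zsmul_eq_mul y n
  refine ⟨d, fun h0 => ?_, RingOfIntegers.ext ?_⟩
  · rw [h0] at hd'
    exact mul_ne_zero hn1 hy0 hd'.symm
  · have e : ((galInt ν E' d : 𝓞 E') : E') = n * g y := Subtype.ext (by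
      rw [coe_galInt, hd']
      change ν ((n : QBar) * y) = n * ((g y : E') : QBar)
      rw [map_mul, map_intCast, hg])
    change (a : E') * ((galInt ν E' d : 𝓞 E') : E') = c * (d : E')
    rw [e, hd']
    linear_combination (n : E') * hy

theorem span_natCast_ne_top {q : ℕ} (hq : q.Prime) : Ideal.span {(q : 𝓞 E)} ≠ ⊤ := by
  rw [Ne, Ideal.span_singleton_eq_top]
  intro hu
  have h1 : IsUnit (Algebra.norm ℤ (q : 𝓞 E)) := hu.map _
  have h2 : Algebra.norm ℤ (algebraMap ℤ (𝓞 E) q) = (q : ℤ) ^ finrank ℤ (𝓞 E) :=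
    Algebra.norm_algebraMap (S := 𝓞 E) (q : ℤ)
  rw [map_natCast] at h2
  rw [h2, isUnit_pow_iff (Module.finrank_pos (R := ℤ) (M := 𝓞 E)).ne'] at h1
  exact (Nat.prime_iff_prime_int.mp hq).not_isUnit h1

/-- Take `B` in the inverse class and `a` with `(a) + qB = B`. Then `(a) = B * J`, and cancelling
`B` gives `J + (q) = 1`. -/
theorem exists_coprime_representative (b : ClassGroup (𝓞 E)) {q : ℕ} (hq : q.Prime) :
    ∃ J : (Ideal (𝓞 E))⁰, ClassGroup.mk0 J = b ∧ IsCoprime J.1 (Ideal.span {(q : 𝓞 E)}) := by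
  obtain ⟨B, hB⟩ := ClassGroup.mk0_surjective b⁻¹
  have hB0 : B.1 ≠ 0 := nonZeroDivisors.coe_ne_zero B
  have hq0 : Ideal.span {(q : 𝓞 E)} ≠ 0 := by
    rw [Ne, Ideal.zero_eq_bot, Ideal.span_singleton_eq_bot]
    exact_mod_cast hq.ne_zero
  obtain ⟨a, ha⟩ := IsDedekindDomain.exists_sup_span_eq
    (Ideal.mul_le_left : B.1 * Ideal.span {(q : 𝓞 E)} ≤ B.1) (mul_ne_zero hB0 hq0)
  have haB : a ∈ B.1 := by
    rw [← ha]
    exact Ideal.mem_sup_right (Ideal.mem_span_singleton_self a)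
  obtain ⟨J, hJ⟩ := Ideal.dvd_span_singleton.mpr haB
  rw [hJ, ← Ideal.mul_sup] at ha
  have h1 : Ideal.span {(q : 𝓞 E)} ⊔ J = ⊤ := mul_left_cancel₀ hB0 (by rw [ha, Ideal.mul_top])
  have hJ0 : J ≠ 0 := by
    rintro rfl
    rw [Ideal.zero_eq_bot, sup_bot_eq] at h1
    exact span_natCast_ne_top hq h1
  refine ⟨⟨J, mem_nonZeroDivisors_of_ne_zero hJ0⟩, ?_, ?_⟩
  · rw [← inv_inj, ← hB, inv_eq_iff_mul_eq_one, ← map_mul, ClassGroup.mk0_eq_one_iff]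
    refine ⟨a, ?_⟩
    change J * B.1 = Ideal.span {a}
    rw [hJ, mul_comm]
  · rw [Ideal.isCoprime_iff_sup_eq, sup_comm, h1]

theorem exists_mem_sub_one_mem {I : Ideal (𝓞 E)} {q : ℕ} (hq : q.Prime)
    (hI : IsCoprime I (Ideal.span {(q : 𝓞 E)})) :
    ∃ x ∈ I, x ≠ 0 ∧ x - 1 ∈ Ideal.span {(q : 𝓞 E)} := by
  obtain ⟨x, hx, y, hy, hxy⟩ := Ideal.isCoprime_iff_exists.mp hI
  have h1 : x - 1 = -y := by linear_combination hxy
  refine ⟨x, hx, ?_, h1 ▸ neg_mem hy⟩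
  rintro rfl
  rw [zero_add] at hxy
  rw [hxy] at hy
  exact span_natCast_ne_top hq ((Ideal.eq_top_iff_one _).mpr hy)

/-- Two ideals prime to `q` in the same class differ by a fraction of elements prime to `q`. -/
theorem exists_principal_mul_eq {I J : (Ideal (𝓞 E))⁰}
    (hIJ : ClassGroup.mk0 I = ClassGroup.mk0 J) {q : ℕ} (hq : q.Prime)
    (hI : IsCoprime I.1 (Ideal.span {(q : 𝓞 E)})) (hJ : IsCoprime J.1 (Ideal.span {(q : 𝓞 E)})) :
    ∃ (x y : 𝓞 E) (hx : x ≠ 0) (hy : y ≠ 0), IsCoprime (Ideal.span {x}) (Ideal.span {(q : 𝓞 E)}) ∧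
      IsCoprime (Ideal.span {y}) (Ideal.span {(q : 𝓞 E)}) ∧
      principal x hx * I = principal y hy * J := by
  obtain ⟨x, hxJ, hx0, hx1⟩ := exists_mem_sub_one_mem hq hJ
  have hxq : IsCoprime (Ideal.span {x}) (Ideal.span {(q : 𝓞 E)}) := by
    rw [Ideal.isCoprime_iff_exists]
    exact ⟨x, Ideal.mem_span_singleton_self x, -(x - 1), neg_mem hx1, by ring⟩
  obtain ⟨B, hB⟩ := Ideal.dvd_span_singleton.mpr hxJ
  have hB0 : B ≠ 0 := by
    rintro rfl
    rw [mul_zero, Ideal.zero_eq_bot, Ideal.span_singleton_eq_bot] at hB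
    exact hx0 hB
  have hBq : IsCoprime B (Ideal.span {(q : 𝓞 E)}) := by
    rw [hB] at hxq
    exact hxq.of_mul_left_right
  let B' : (Ideal (𝓞 E))⁰ := ⟨B, mem_nonZeroDivisors_of_ne_zero hB0⟩
  have h1 : ClassGroup.mk0 (I * B') = 1 := by
    rw [map_mul, hIJ, ← map_mul, ClassGroup.mk0_eq_one_iff]
    exact ⟨x, hB.symm⟩
  rw [ClassGroup.mk0_eq_one_iff] at h1
  obtain ⟨y, hy⟩ := h1
  have hy' : I.1 * B = Ideal.span {y} := hy
  have hy0 : y ≠ 0 := by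
    rintro rfl
    refine mul_ne_zero (nonZeroDivisors.coe_ne_zero I) hB0 (hy'.trans ?_)
    simp
  refine ⟨x, y, hx0, hy0, hxq, hy' ▸ hI.mul_left hBq, Subtype.ext ?_⟩
  change Ideal.span {x} * I.1 = Ideal.span {y} * J.1
  rw [hB, ← hy']
  ring

/-- Kronecker's theorem. Every complex embedding of `E` is the restriction of an automorphism of
`ℚ̄` commuting with conjugation on `E`, so the hypothesis says that all absolute values of `x` are
1. -/
theorem exists_pow_eq_one_of_conjugation {x : 𝓞 E}
    (hconj : ∀ (σ : QBar ≃ₐ[ℚ] QBar) (x : E), σ (conjugation (x : QBar)) = conjugation (σ x))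
    (hx : x * galInt conjugation E x = 1) : ∃ n > 0, x ^ n = 1 := by
  have key : ∀ φ : E →+* ℂ, ‖φ (x : E)‖ = 1 := by
    intro φ
    let φ' : E →ₐ[ℚ] ℂ := φ.toRatAlgHom
    let g : E →ₐ[ℚ] E := φ'.restrictNormal E
    let σ : QBar ≃ₐ[ℚ] QBar := (AlgEquiv.ofBijective g g.bijective).liftNormal QBar
    have h2 : ∀ y : E, φ y = ((σ (y : QBar) : QBar) : ℂ) := fun y => by
      have h3 : σ (y : QBar) = ((g y : E) : QBar) :=
        AlgEquiv.liftNormal_commutes (AlgEquiv.ofBijective g g.bijective) QBar y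
      rw [h3]
      exact (AlgHom.restrictNormal_commutes φ' E y).symm
    have h4 := congrArg (fun z : 𝓞 E => φ (z : E)) hx
    simp only [map_mul, map_one] at h4
    rw [h2 (galInt conjugation E x : E), coe_galInt, hconj, coe_conjugation, ← h2,
      Complex.mul_conj, ← Complex.ofReal_one, Complex.ofReal_inj, Complex.normSq_eq_norm_sq] at h4
    exact (pow_eq_one_iff_of_nonneg (norm_nonneg _) two_ne_zero).mp h4
  obtain ⟨n, hn, h1⟩ := Embeddings.pow_eq_one_of_norm_eq_one E ℂ (x := (x : E)) x.isIntegral_coe key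
  exact ⟨n, hn, RingOfIntegers.ext h1⟩

theorem mem_of_fixed (x : QBar)
    (hx : ∀ σ : QBar ≃ₐ[ℚ] QBar, (∀ y : E, σ y = y) → σ x = x) : x ∈ E.toIntermediateField := by
  rw [← InfiniteGalois.fixedField_fixingSubgroup E.toIntermediateField,
    IntermediateField.mem_fixedField_iff]
  exact fun σ hσ => hx σ fun y => hσ y

end HilbertNinety

end IwasawaThaine

namespace IwasawaThaine

open Module

/-! ### Invariant ideals in fixed minus classes. -/

section InvariantIdeals

variable {E L : GaloisNF} {p q : ℕ} [Fact p.Prime] [Fact q.Prime] {ν : QBar ≃ₐ[ℚ] QBar}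

theorem isPrimitiveRoot_coe {E : GaloisNF} {z : 𝓞 E} {N : ℕ} :
    IsPrimitiveRoot ((z : E) : QBar) N ↔ IsPrimitiveRoot z N := by
  have h1 : Function.Injective
      (E.toIntermediateField.val.toRingHom.comp (algebraMap (𝓞 E) E)) :=
    (Subtype.val_injective).comp RingOfIntegers.coe_injective
  exact IsPrimitiveRoot.map_iff_of_injective (f := E.toIntermediateField.val.toRingHom.comp
    (algebraMap (𝓞 E) E)) h1

/-- A root of unity of `p`-power order of `E` that is a `p`-th power modulo the primes of `L` above
`q` is a `p`-th power. -/
theorem exists_pow_eq_of_congr (hpq : p ≠ q) {E₀ E₁ L₁ : GaloisNF} (hEL : E ≤ L) (hEE₁ : E ≤ E₁)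
    (hLL₁ : L ≤ L₁) (h₁ : E₁ ≤ L₁) (h₀ : E₀ ≤ E₁) (h₀L : E₀ ≤ L) (hL₁ : L₁ ≤ E₁ ⊔ cycloNF q)
    {ι : Type*} [Fintype ι] {τ : ι → (QBar ≃ₐ[ℚ] QBar)} (hτ : GalSystem h₁ τ)
    (hur : UnramifiedAt q E₁) {Q : Ideal (𝓞 E₀)} (hq : (q : 𝓞 E₀) ∈ Q) (hi : Inert h₀ Q)
    {n : ℕ} (hn : n ≠ 0) {z : 𝓞 E} (hz : IsPrimitiveRoot z (p ^ n)) {z₁ : 𝓞 E₁}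
    (hz₁ : IsPrimitiveRoot z₁ (p ^ (n + 1)))
    (hno : ∀ w : 𝓞 L, ¬ IsPrimitiveRoot w (p ^ (n + 1))) {μ : 𝓞 E} {k : ℕ} (hμ : μ ^ p ^ k = 1)
    (hcong : ∀ P : Ideal (𝓞 L), P.IsPrime → (q : 𝓞 L) ∈ P → ∃ Y, extInt hEL μ - Y ^ p ∈ P) :
    ∃ η : 𝓞 E, η ^ p = μ := by
  have hp : p.Prime := Fact.out
  have hext : ∀ {F F' : GaloisNF} (h : F ≤ F') {w : 𝓞 F} {N : ℕ}, IsPrimitiveRoot w N →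
      IsPrimitiveRoot (extInt h w) N := fun h w N hw => hw.map_of_injective (extInt_injective h)
  -- Otherwise a power of `μ` would be a primitive `p ^ (n + 1)`-th root of unity in `L`.
  have hμn : μ ^ p ^ n = 1 := by
    obtain ⟨j, hj, hj'⟩ := (Nat.dvd_prime_pow hp).mp (orderOf_dvd_of_pow_eq_one hμ)
    by_cases hjn : j ≤ n
    · rw [← orderOf_dvd_iff_pow_eq_one, hj']
      exact pow_dvd_pow p hjn
    · exfalso
      have h1 := IsPrimitiveRoot.orderOf μ
      rw [hj'] at h1
      refine hno _ (hext hEL (h1.pow (pow_pos hp.pos j) (a := p ^ (j - (n + 1))) ?_))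
      rw [← pow_add]
      congr 1
      omega
  have hpn : 0 < p ^ n := pow_pos hp.pos n
  have : NeZero (p ^ n) := ⟨hpn.ne'⟩
  obtain ⟨i, -, rfl⟩ := hz.eq_pow_of_pow_eq_one hμn
  by_cases hpi : p ∣ i
  · obtain ⟨k, rfl⟩ := hpi
    exact ⟨z ^ k, by rw [← pow_mul, mul_comm]⟩
  exfalso
  have hcop : i.Coprime (p ^ n) :=
    Nat.Coprime.pow_right n ((Nat.coprime_comm.mp ((Nat.Prime.coprime_iff_not_dvd hp).mpr hpi)))
  set μ := z ^ i with hμdef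
  have hμp : IsPrimitiveRoot μ (p ^ n) := hz.pow_of_coprime i hcop
  -- Now `μ` has exact order `p ^ n`, and its `p`-th root `η` has order `p ^ (n + 1)`; it lies in
  -- `E₁` but not in `L`.
  obtain ⟨η, hη, hηp⟩ : ∃ η : 𝓞 E₁, η ^ p = extInt hEE₁ μ ∧ IsPrimitiveRoot η (p ^ (n + 1)) := by
    have h1 : IsPrimitiveRoot (z₁ ^ p) (p ^ n) := hz₁.pow (pow_pos hp.pos _) (pow_succ' p n)
    have h2 := hext hEE₁ hμp
    obtain ⟨j, -, hj⟩ := h1.eq_pow_of_pow_eq_one h2.pow_eq_one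
    rw [← hj, h1.pow_iff_coprime hpn] at h2
    refine ⟨z₁ ^ j, by rw [← hj, ← pow_mul, ← pow_mul, mul_comm], hz₁.pow_of_coprime j ?_⟩
    exact Nat.Coprime.pow_right _ ((Nat.coprime_pow_right_iff (Nat.pos_of_ne_zero hn) j p).mp h2)
  obtain ⟨P₁, hP₁, hc⟩ := exists_prime_comap_extInt h₁ (Q.map (extInt h₀)) hi
  have hqP₁ : (q : 𝓞 L₁) ∈ P₁ := by
    have h2 : extInt h₁ (extInt h₀ q) ∈ P₁ := by
      rw [← Ideal.mem_comap, hc]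
      exact Ideal.mem_map_of_mem _ hq
    rwa [map_natCast, map_natCast] at h2
  obtain ⟨Y, hY⟩ := hcong (P₁.comap (extInt hLL₁)) (hP₁.comap _)
    (by rwa [Ideal.mem_comap, map_natCast])
  have hsq : ∀ x : 𝓞 E, extInt hLL₁ (extInt hEL x) = extInt h₁ (extInt hEE₁ x) := fun _ => rfl
  have hζ : IsPrimitiveRoot (extInt hLL₁ (extInt hEL (z ^ p ^ (n - 1)))) p :=
    hext _ (hext _ (hz.pow hpn (by rw [← pow_succ, Nat.sub_add_cancel (Nat.pos_of_ne_zero hn)])))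
  -- The `p`-th roots of unity lie in `E`, so the congruence `η ^ p ≡ Y ^ p` factors, and `η` is
  -- congruent to an element of `L` modulo `P₁`.
  obtain ⟨W, hW⟩ : ∃ W : 𝓞 L, extInt h₁ η - extInt hLL₁ W ∈ P₁ := by
    have h2 : extInt h₁ η ^ p - extInt hLL₁ Y ^ p ∈ P₁ := by
      rw [Ideal.mem_comap, map_sub, hsq, ← hη, map_pow, map_pow] at hY
      exact hY
    rw [hζ.pow_sub_pow_eq_prod_sub_mul _ _ hp.pos, Ideal.IsPrime.prod_mem_iff] at h2
    obtain ⟨ξ, hξ, h3⟩ := h2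
    rw [Polynomial.mem_nthRootsFinset hp.pos] at hξ
    have : NeZero p := ⟨hp.ne_zero⟩
    obtain ⟨k, -, rfl⟩ := hζ.eq_pow_of_pow_eq_one hξ
    refine ⟨extInt hEL (z ^ p ^ (n - 1)) ^ k * Y, ?_⟩
    rwa [map_mul, map_pow]
  have hηL : ((η : E₁) : QBar) ∉ L.toIntermediateField := fun hmem => by
    have h2 : IsIntegral ℤ (⟨((η : E₁) : QBar), hmem⟩ : L) := by
      have h3 : IsIntegral ℤ ((η : E₁) : QBar) :=
        (η.isIntegral_coe).map (E₁.toIntermediateField.val.restrictScalars ℤ)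
      exact (isIntegral_algHom_iff (L.toIntermediateField.val.restrictScalars ℤ)
        Subtype.val_injective).mp h3
    have h4 : IsPrimitiveRoot ((η : E₁) : QBar) (p ^ (n + 1)) := isPrimitiveRoot_coe.mpr hηp
    exact hno ⟨_, h2⟩ (isPrimitiveRoot_coe.mp h4)
  obtain ⟨σ, hσL, hσ⟩ : ∃ σ : QBar ≃ₐ[ℚ] QBar, (∀ y : L, σ y = y) ∧
      σ ((η : E₁) : QBar) ≠ ((η : E₁) : QBar) := by
    by_contra! hcon
    exact hηL (mem_of_fixed _ hcon)
  -- `P₁` lies above the inert prime generated by `Q` in `E₁` and is totally ramified over it, hence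
  -- unique; so `σ`, which fixes `E₀`, respects it.
  have hle : P₁ ≤ P₁.comap (galInt σ L₁ : 𝓞 L₁ →+* 𝓞 L₁) := by
    refine hτ.le_of_comap_le (hP₁.comap _) ?_ fun i x => ?_
    · rw [hc, Ideal.map_le_iff_le_comap]
      intro x hx
      rw [Ideal.mem_comap, Ideal.mem_comap, Ideal.mem_comap]
      have h2 : galInt σ L₁ (extInt h₁ (extInt h₀ x)) = extInt h₁ (extInt h₀ x) :=
        int_ext (by rw [coe_galInt]; exact hσL ⟨((x : E₀) : QBar), h₀L (x : E₀).2⟩)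
      change galInt σ L₁ (extInt h₁ (extInt h₀ x)) ∈ P₁
      rw [h2, ← Ideal.mem_comap, hc]
      exact Ideal.mem_map_of_mem _ hx
    · refine galInt_sub_mem hur h₁ hL₁ (hP₁.comap _) ?_ (hτ.fixes i) x
      rwa [Ideal.mem_comap, map_natCast]
  have h2 : galInt σ L₁ (extInt h₁ η) - extInt hLL₁ W ∈ P₁ := by
    have h3 : galInt σ L₁ (extInt h₁ η - extInt hLL₁ W) ∈ P₁ := hle hW
    have h4 : galInt σ L₁ (extInt hLL₁ W) = extInt hLL₁ W :=
      int_ext (by rw [coe_galInt]; exact hσL _)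
    rwa [map_sub, h4] at h3
  have h3 : galInt σ L₁ (extInt h₁ η) - extInt h₁ η ∈ P₁ := by
    have := P₁.sub_mem h2 hW
    rwa [sub_sub_sub_cancel_right] at this
  have hη1 : extInt h₁ η ^ p ^ (n + 1) = 1 := by rw [← map_pow, hηp.pow_eq_one, map_one]
  have hη2 : extInt h₁ η * extInt h₁ η ^ (p ^ (n + 1) - 1) = 1 := by
    rw [← pow_succ', Nat.sub_add_cancel (Nat.one_le_pow _ _ hp.pos), hη1]
  have hσμ : galInt σ L₁ (extInt h₁ η) ^ p = extInt h₁ η ^ p := by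
    rw [← map_pow, ← map_pow, hη]
    exact int_ext (by rw [coe_galInt]; exact hσL ⟨((μ : E) : QBar), hEL (μ : E).2⟩)
  -- `σ(η)/η` is a `p`-th root of unity different from 1 and congruent to 1 modulo `P₁`. This forces
  -- `p` into a prime above `q`.
  have h4 : (p : 𝓞 L₁) ∈ P₁ := by
    refine natCast_mem_of_sub_mem hp (w := 1)
      (z := galInt σ L₁ (extInt h₁ η) * extInt h₁ η ^ (p ^ (n + 1) - 1)) ?_ (one_pow _)
      (fun h5 => hσ ?_) ?_
    · rw [mul_pow, hσμ, ← mul_pow, hη2, one_pow]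
    · have h6 : galInt σ L₁ (extInt h₁ η) = extInt h₁ η := by
        linear_combination (extInt h₁ η) * h5 - galInt σ L₁ (extInt h₁ η) * hη2
      have := congrArg (fun w : 𝓞 L₁ => ((w : L₁) : QBar)) h6
      simp only [coe_galInt] at this
      exact this
    · rw [← hη2, ← sub_mul]
      exact P₁.mul_mem_right _ h3
  have h5 : IsCoprime (p : 𝓞 L₁) (q : 𝓞 L₁) := by
    have := ((Nat.coprime_primes hp Fact.out).mpr hpq).isCoprime.map (Int.castRingHom (𝓞 L₁))
    simpa using this
  obtain ⟨a, b, hab⟩ := h5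
  exact hP₁.ne_top ((Ideal.eq_top_iff_one _).mpr
    (hab ▸ P₁.add_mem (P₁.mul_mem_left _ h4) (P₁.mul_mem_left _ hqP₁)))


theorem ideal_mul_right_cancel {I J M : (Ideal (𝓞 E))⁰} (h : I * M = J * M) : I = J :=
  Subtype.ext (mul_right_cancel₀ (nonZeroDivisors.coe_ne_zero M) (congrArg Subtype.val h))

theorem galInt_ne_zero (σ : QBar ≃ₐ[ℚ] QBar) {x : 𝓞 E} (hx : x ≠ 0) : galInt σ E x ≠ 0 :=
  (map_ne_zero_iff _ (galInt σ E).injective).mpr hx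

theorem galIdeal_principal_eq (σ : QBar ≃ₐ[ℚ] QBar) {x : 𝓞 E} (hx : x ≠ 0) :
    galIdeal σ E (principal x hx) = principal _ (galInt_ne_zero σ hx) :=
  Subtype.ext (galIdeal_principal σ hx)

theorem normIdeal_principal_eq (h : E ≤ L) {x : 𝓞 L} (hx : x ≠ 0) :
    normIdeal h (principal x hx) = principal _ (normInt_ne_zero h hx) :=
  Subtype.ext (normIdeal_principal h hx)

theorem principal_mul {x y : 𝓞 E} (hx : x ≠ 0) (hy : y ≠ 0) :
    principal x hx * principal y hy = principal _ (mul_ne_zero hx hy) :=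
  Subtype.ext (Ideal.span_singleton_mul_span_singleton x y)

theorem mk0_principal_mul {x : 𝓞 E} (hx : x ≠ 0) (I : (Ideal (𝓞 E))⁰) :
    ClassGroup.mk0 (principal x hx * I) = ClassGroup.mk0 I := by
  have h1 : ClassGroup.mk0 (principal x hx) = 1 :=
    (ClassGroup.mk0_eq_one_iff (principal x hx).2).mpr ⟨x, rfl⟩
  rw [map_mul, h1, one_mul]

theorem isCoprime_galInt (σ : QBar ≃ₐ[ℚ] QBar) {I : Ideal (𝓞 E)}
    (hI : IsCoprime I (Ideal.span {(q : 𝓞 E)})) :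
    IsCoprime (I.map (galInt σ E)) (Ideal.span {(q : 𝓞 E)}) := by
  rw [Ideal.isCoprime_iff_sup_eq] at hI ⊢
  have h1 := congrArg (Ideal.map (galInt σ E)) hI
  rw [Ideal.map_sup, Ideal.map_span, Set.image_singleton, map_natCast, Ideal.map_top] at h1
  exact h1

theorem normInt_extInt (h : E ≤ L) {ι : Type*} [Fintype ι] {τ : ι → (QBar ≃ₐ[ℚ] QBar)}
    (hτ : GalSystem h τ) (x : 𝓞 E) : normInt h (extInt h x) = x ^ Fintype.card ι := by
  refine int_ext ?_
  rw [coe_normInt h hτ, coe_extInt]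
  simp_rw [hτ.fixes]
  rw [Finset.prod_const, Finset.card_univ]
  rfl

theorem normInt_galInt (h : E ≤ L) {ι : Type*} [Fintype ι] {τ : ι → (QBar ≃ₐ[ℚ] QBar)}
    (hτ : GalSystem h τ) {σ : QBar ≃ₐ[ℚ] QBar} (hσ : ∀ i (x : L), τ i (σ x) = σ (τ i x))
    (x : 𝓞 L) : normInt h (galInt σ L x) = galInt σ E (normInt h x) := by
  refine int_ext ?_
  rw [coe_normInt h hτ, coe_galInt, coe_galInt, coe_normInt h hτ, map_prod]
  exact Finset.prod_congr rfl fun i _ => hσ i _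

theorem galInt_conjugation_conjugation (x : 𝓞 E) :
    galInt conjugation E (galInt conjugation E x) = x :=
  int_ext (by
    rw [coe_galInt, coe_galInt]
    exact Subtype.ext (by rw [coe_conjugation, coe_conjugation, Complex.conj_conj]))

theorem exists_mul_eq_principal (J : (Ideal (𝓞 E))⁰) :
    ∃ (A : (Ideal (𝓞 E))⁰) (m : ℕ) (hm : (m : 𝓞 E) ≠ 0), A * J = principal (m : 𝓞 E) hm := by
  have hne : Ideal.absNorm J.1 ≠ 0 := Ideal.absNorm_ne_zero_iff_mem_nonZeroDivisors.mpr J.2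
  have hm : ((Ideal.absNorm J.1 : ℕ) : 𝓞 E) ≠ 0 := by exact_mod_cast hne
  obtain ⟨A, hA⟩ := Ideal.dvd_span_singleton.mpr (Ideal.absNorm_mem J.1)
  have hA0 : A ≠ 0 := by
    rintro rfl
    rw [mul_zero, Ideal.zero_eq_bot, Ideal.span_singleton_eq_bot] at hA
    exact hm hA
  exact ⟨⟨A, mem_nonZeroDivisors_of_ne_zero hA0⟩, _, hm,
    Subtype.ext ((mul_comm _ _).trans hA.symm)⟩

/-- `A` is an inverse of `J` up to a rational integer; `σ` fixes the integer, so the ratio of `σ(A)`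
to `A` is the inverse of that for `J`. -/
theorem exists_galIdeal_mul_eq (σ : QBar ≃ₐ[ℚ] QBar) {J : (Ideal (𝓞 E))⁰} {x y : 𝓞 E}
    (hx : x ≠ 0) (hy : y ≠ 0) (h : principal x hx * galIdeal σ E J = principal y hy * J) :
    ∃ A : (Ideal (𝓞 E))⁰, ClassGroup.mk0 A = (ClassGroup.mk0 J)⁻¹ ∧
      principal y hy * galIdeal σ E A = principal x hx * A := by
  obtain ⟨A, m, hm, hA⟩ := exists_mul_eq_principal J
  have hA' : galIdeal σ E A * galIdeal σ E J = principal (m : 𝓞 E) hm := by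
    rw [← map_mul, hA, galIdeal_principal_eq]
    exact Subtype.ext (by rw [coe_principal, coe_principal, map_natCast])
  refine ⟨A, ?_, ideal_mul_right_cancel (M := principal (m : 𝓞 E) hm) ?_⟩
  · rw [eq_inv_iff_mul_eq_one, ← map_mul, hA, ← mul_one (principal (m : 𝓞 E) hm),
      mk0_principal_mul, map_one]
  · calc principal y hy * galIdeal σ E A * principal (m : 𝓞 E) hm
        = principal y hy * J * (galIdeal σ E A * A) := by
          rw [← hA]
          ac_rfl
      _ = principal x hx * A * principal (m : 𝓞 E) hm := by
          rw [← h, ← hA']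
          ac_rfl

/-- For a minus class `b ^ 2 = b / b̄`. The ideal `I` is `J` times an inverse of its conjugate, so
the multiplier `y / x` of `J` becomes `(y / x) / conj (y / x)`. Keeping `x` and `y` prime to `q`
prepares the congruences modulo primes above `q`. -/
theorem exists_fraction_galIdeal {ν : QBar ≃ₐ[ℚ] QBar}
    (hconj : ∀ x : L, ν (conjugation (x : QBar)) = conjugation (ν x))
    {b : ClassGroup (𝓞 L)} (hb : galCl ν L b = b) (hb' : galCl conjugation L b = b⁻¹)
    (hq : q.Prime) :
    ∃ (J I : (Ideal (𝓞 L))⁰) (x y : 𝓞 L) (hx : x ≠ 0) (hy : y ≠ 0)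
      (ha : y * galInt conjugation L x ≠ 0) (hc : x * galInt conjugation L y ≠ 0),
      IsCoprime (Ideal.span {x * galInt conjugation L y}) (Ideal.span {(q : 𝓞 L)}) ∧
      principal x hx * galIdeal ν L J = principal y hy * J ∧
      ClassGroup.mk0 I = b ^ 2 ∧
      principal _ hc * galIdeal ν L I = principal _ ha * I := by
  obtain ⟨J, hJb, hJq⟩ := exists_coprime_representative b hq
  have hνJ : ClassGroup.mk0 (galIdeal ν L J) = ClassGroup.mk0 J := by rw [← galCl_mk0, hJb, hb]
  obtain ⟨x, y, hx, hy, hxq, hyq, hxy⟩ := exists_principal_mul_eq hνJ hq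
    (isCoprime_galInt ν hJq) hJq
  have hx' := galInt_ne_zero conjugation hx
  have hy' := galInt_ne_zero conjugation hy
  have hxy' : principal _ hx' * galIdeal ν L (galIdeal conjugation L J) =
      principal _ hy' * galIdeal conjugation L J := by
    have h1 := congrArg (galIdeal conjugation L) hxy
    rw [map_mul, map_mul, galIdeal_principal_eq, galIdeal_principal_eq,
      galIdeal_comm (fun w => (hconj w).symm)] at h1
    exact h1
  obtain ⟨A, hAb, hA⟩ := exists_galIdeal_mul_eq ν hx' hy' hxy'
  rw [← galCl_mk0, hJb, hb', inv_inv] at hAb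
  refine ⟨J, J * A, x, y, hx, hy, mul_ne_zero hy hx', mul_ne_zero hx hy', ?_, hxy, ?_, ?_⟩
  · rw [← Ideal.span_singleton_mul_span_singleton]
    refine hxq.mul_left ?_
    have h2 := isCoprime_galInt conjugation hyq
    rwa [Ideal.map_span, Set.image_singleton] at h2
  · rw [map_mul, hJb, hAb, pow_two]
  · rw [← principal_mul hx hy', ← principal_mul hy hx', map_mul]
    calc _ = (principal x hx * galIdeal ν L J) * (principal _ hy' * galIdeal ν L A) := by ac_rfl
      _ = _ := by
        rw [hxy, hA]
        ac_rfl

/-- `J` and its image under `ν` have the same norm, so the norms of `y` and `x` differ by a unit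
`ε₀`, and `ε = ε₀ / conj ε₀` works. -/
theorem exists_unit_normInt {h : E ≤ L} {ι : Type*} [Fintype ι] {τ : ι → (QBar ≃ₐ[ℚ] QBar)}
    (hτ : GalSystem h τ) (hconj : ∀ i (x : L), τ i (conjugation (x : QBar)) = conjugation (τ i x))
    {ν : QBar ≃ₐ[ℚ] QBar} (hν : ∀ x : E, ν x = x) {J : (Ideal (𝓞 L))⁰} {x y : 𝓞 L}
    (hx : x ≠ 0) (hy : y ≠ 0) (hJ : principal x hx * galIdeal ν L J = principal y hy * J) :
    ∃ ε : 𝓞 E, ε * galInt conjugation E ε = 1 ∧ normInt h (y * galInt conjugation L x) =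
      ε * normInt h (x * galInt conjugation L y) := by
  obtain ⟨ε₀, hε₀⟩ : Associated (normInt h x) (normInt h y) := by
    rw [← Ideal.span_singleton_eq_span_singleton]
    have h1 := congrArg (normIdeal h) hJ
    rw [map_mul, map_mul, normIdeal_galIdeal, galIdeal_eq_self hν, normIdeal_principal_eq,
      normIdeal_principal_eq] at h1
    exact congrArg Subtype.val (ideal_mul_right_cancel h1)
  have hNκ : ∀ w : 𝓞 L, normInt h (galInt conjugation L w) = galInt conjugation E (normInt h w) :=
    normInt_galInt h hτ fun i w => hconj i w
  have h1 : galInt conjugation E (ε₀⁻¹ : (𝓞 E)ˣ) * galInt conjugation E ε₀ = 1 := by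
    rw [← map_mul, Units.inv_mul, map_one]
  have h2 : (ε₀ : 𝓞 E) * (ε₀⁻¹ : (𝓞 E)ˣ) = 1 := Units.mul_inv _
  refine ⟨ε₀ * galInt conjugation E (ε₀⁻¹ : (𝓞 E)ˣ), ?_, ?_⟩
  · rw [map_mul, galInt_conjugation_conjugation]
    linear_combination galInt conjugation E (ε₀⁻¹ : (𝓞 E)ˣ) * galInt conjugation E ε₀ * h2 + h1
  · rw [map_mul, map_mul, hNκ, hNκ, ← hε₀, map_mul]
    linear_combination
      (-(normInt h x * ε₀ * galInt conjugation E (normInt h x))) * h1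

/-- When the Galois group acts trivially modulo `P`, norms become powers there, so `ε` is congruent
to a power of `a / c`. -/
theorem exists_sub_pow_mem {h : E ≤ L} {ι : Type*} [Fintype ι] {τ : ι → (QBar ≃ₐ[ℚ] QBar)}
    (hτ : GalSystem h τ) {P : Ideal (𝓞 L)} (htriv : ∀ i x, galInt (τ i) L x - x ∈ P)
    {a c : 𝓞 L} {ε : 𝓞 E} (hac : normInt h a = ε * normInt h c)
    (hc : IsCoprime (Ideal.span {c}) P) : ∃ Y, extInt h ε - Y ^ Fintype.card ι ∈ P := by
  obtain ⟨w, hw, v, hv, hwv⟩ := Ideal.isCoprime_iff_exists.mp hc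
  obtain ⟨c', rfl⟩ := Ideal.mem_span_singleton'.mp hw
  have hφ : ∀ x, Ideal.Quotient.mk P (extInt h (normInt h x)) =
      Ideal.Quotient.mk P x ^ Fintype.card ι := fun x => by
    rw [extInt_normInt h hτ, map_prod, ← Finset.card_univ, ← Finset.prod_const]
    exact Finset.prod_congr rfl fun i _ => Ideal.Quotient.eq.mpr (htriv i x)
  have h1 : Ideal.Quotient.mk P c' * Ideal.Quotient.mk P c = 1 := by
    rw [← map_mul, ← map_one (Ideal.Quotient.mk P), Ideal.Quotient.eq, ← hwv, sub_add_cancel_left]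
    exact neg_mem hv
  have h2 := congrArg (fun x => Ideal.Quotient.mk P (extInt h x)) hac
  simp only [map_mul] at h2
  rw [hφ, hφ] at h2
  refine ⟨c' * a, Ideal.Quotient.eq.mp ?_⟩
  rw [map_pow, map_mul, mul_pow, h2, mul_left_comm, ← mul_pow, h1, one_pow, mul_one]

theorem mul_mul_eq_of_mul_eq {M : Type*} [CommMonoid M] {a c d d' n i : M} (h1 : c * n = a * i)
    (h2 : a * d' = c * d) : d' * n * (c * a) = d * i * (c * a) := by
  calc d' * n * (c * a) = (c * n) * (a * d') := by ac_rfl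
    _ = d * i * (c * a) := by
      rw [h1, h2]
      ac_rfl

/-- A minus class fixed by `ν` comes from an invariant ideal, up to an exponent prime to `p`. -/
theorem exists_invariant_ideal (hp2 : Odd p) {h : E ≤ L}
    (hν : GalSystem h fun i : Fin p => ν ^ (i : ℕ))
    (hconj : ∀ (σ : QBar ≃ₐ[ℚ] QBar) (x : L), σ (conjugation (x : QBar)) = conjugation (σ x))
    (htriv : ∀ P : Ideal (𝓞 L), P.IsPrime → (q : 𝓞 L) ∈ P → ∀ (i : Fin p) (x : 𝓞 L),
      galInt (ν ^ (i : ℕ)) L x - x ∈ P)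
    (hroot : ∀ (μ : 𝓞 E) (k : ℕ), μ ^ p ^ k = 1 → (∀ P : Ideal (𝓞 L), P.IsPrime →
      (q : 𝓞 L) ∈ P → ∃ Y, extInt h μ - Y ^ p ∈ P) → ∃ η : 𝓞 E, η ^ p = μ)
    {b : ClassGroup (𝓞 L)} (hb : galCl ν L b = b) (hb' : galCl conjugation L b = b⁻¹) :
    ∃ (t : ℕ) (J : (Ideal (𝓞 L))⁰), t.Coprime p ∧ galIdeal ν L J = J ∧
      ClassGroup.mk0 J = b ^ t := by
  have hp : p.Prime := Fact.out
  have hνE : ∀ x : E, ν x = x := fun x => by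
    have := hν.fixes ⟨1, hp.one_lt⟩ x
    rwa [pow_one] at this
  obtain ⟨J, I, x, y, hx, hy, ha0, hc0, hcq, hJ, hIb, hI⟩ :=
    exists_fraction_galIdeal (hconj ν) hb hb' (Fact.out : q.Prime)
  obtain ⟨ε, hε, hac⟩ := exists_unit_normInt hν (fun i w => hconj _ w) hνE hx hy hJ
  generalize y * galInt conjugation L x = a at *
  generalize x * galInt conjugation L y = c at *
  obtain ⟨N, hN, hεN⟩ := exists_pow_eq_one_of_conjugation
    (fun σ x => hconj σ ⟨(x : QBar), h x.2⟩) hε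
  -- The exponent `u` removes the part of `ε` of order prime to `p`; being prime to `p` it is
  -- harmless for the class.
  obtain ⟨k, u, hu, rfl⟩ := Nat.exists_eq_pow_mul_and_not_dvd hN.ne' p hp.ne_one
  have hacu : normInt h (a ^ u) = ε ^ u * normInt h (c ^ u) := by
    rw [map_pow, map_pow, hac, mul_pow]
  obtain ⟨η, hη⟩ := hroot (ε ^ u) k (by rw [← pow_mul, mul_comm, hεN]) fun P hP hqP => by
    have h1 := exists_sub_pow_mem hν (htriv P hP hqP) hacu (by
      rw [← Ideal.span_singleton_pow]
      exact (hcq.of_isCoprime_of_dvd_right (Ideal.dvd_span_singleton.mpr hqP)).pow_left)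
    rwa [Fintype.card_fin] at h1
  have hηu : IsUnit η := IsUnit.of_pow_eq_one (n := p * (p ^ k * u))
    (by rw [pow_mul, hη, ← pow_mul, mul_comm, pow_mul, hεN, one_pow])
    (mul_ne_zero hp.ne_zero hN.ne')
  -- Dividing by `η` turns the multiplier `(a / c) ^ u` into an element of norm 1. The resulting `d`
  -- corrects `I ^ u` to an invariant ideal, since `η` is a unit.
  obtain ⟨d, hd0, hd⟩ := exists_mul_galInt_eq hν (a := a ^ u)
    (c := extInt h η * c ^ u) (mul_ne_zero (hηu.map (extInt h)).ne_zero (pow_ne_zero _ hc0))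
    (by rw [map_mul, hacu, normInt_extInt h hν, Fintype.card_fin, hη])
  refine ⟨2 * u, principal d hd0 * I ^ u, ?_, ?_, ?_⟩
  · exact Nat.Coprime.mul_left (Nat.coprime_two_left.mpr hp2)
      (Nat.coprime_comm.mp ((Nat.Prime.coprime_iff_not_dvd hp).mpr hu))
  · have h1 : principal c hc0 ^ u * galIdeal ν L I ^ u = principal a ha0 ^ u * I ^ u := by
      rw [← mul_pow, hI, mul_pow]
    have h2 : principal a ha0 ^ u * principal _ (galInt_ne_zero ν hd0) =
        principal c hc0 ^ u * principal d hd0 := by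
      refine Subtype.ext ?_
      change Ideal.span {a} ^ u * Ideal.span {galInt ν L d} = Ideal.span {c} ^ u * Ideal.span {d}
      rw [Ideal.span_singleton_pow, Ideal.span_singleton_pow,
        Ideal.span_singleton_mul_span_singleton, Ideal.span_singleton_mul_span_singleton, hd,
        mul_assoc, Ideal.span_singleton_mul_left_unit (hηu.map (extInt h))]
    rw [map_mul, map_pow, galIdeal_principal_eq]
    refine ideal_mul_right_cancel (M := principal c hc0 ^ u * principal a ha0 ^ u) ?_
    exact mul_mul_eq_of_mul_eq h1 h2
  · rw [mk0_principal_mul, map_pow, hIb, pow_mul]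

end InvariantIdeals

end IwasawaThaine

namespace IwasawaThaine

open Module

/-! ### Galois action, norm and lift on ideal classes. -/

section Classes

variable {E E' : GaloisNF}

theorem galCl_normCl (σ : QBar ≃ₐ[ℚ] QBar) (h : E ≤ E') (c : ClassGroup (𝓞 E')) :
    galCl σ E (normCl h c) = normCl h (galCl σ E' c) := by
  obtain ⟨I, rfl⟩ := ClassGroup.mk0_surjective c
  rw [normCl_mk0, galCl_mk0, galCl_mk0, normCl_mk0, normIdeal_galIdeal]

theorem galCl_liftCl (σ : QBar ≃ₐ[ℚ] QBar) (h : E ≤ E') (c : ClassGroup (𝓞 E)) :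
    galCl σ E' (liftCl h c) = liftCl h (galCl σ E c) := by
  obtain ⟨I, rfl⟩ := ClassGroup.mk0_surjective c
  rw [liftCl_mk0, galCl_mk0, galCl_mk0, liftCl_mk0, galIdeal_extIdeal]

theorem galCl_comm {σ τ : QBar ≃ₐ[ℚ] QBar} (h : ∀ x : E, σ (τ x) = τ (σ x))
    (c : ClassGroup (𝓞 E)) : galCl σ E (galCl τ E c) = galCl τ E (galCl σ E c) := by
  obtain ⟨I, rfl⟩ := ClassGroup.mk0_surjective c
  rw [galCl_mk0, galCl_mk0, galCl_mk0, galCl_mk0, galIdeal_comm h]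

theorem galCl_eq_self {σ : QBar ≃ₐ[ℚ] QBar} (h : ∀ x : E, σ x = x) (c : ClassGroup (𝓞 E)) :
    galCl σ E c = c := by
  obtain ⟨I, rfl⟩ := ClassGroup.mk0_surjective c
  rw [galCl_mk0, galIdeal_eq_self h]

theorem galCl_pow (σ : QBar ≃ₐ[ℚ] QBar) (i : ℕ) (c : ClassGroup (𝓞 E)) :
    galCl (σ ^ i) E c = (galCl σ E)^[i] c := by
  obtain ⟨I, rfl⟩ := ClassGroup.mk0_surjective c
  rw [galCl_mk0, galIdeal_pow]
  induction i with
  | zero => rfl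
  | succ i ih => rw [Function.iterate_succ_apply', Function.iterate_succ_apply', ← ih, galCl_mk0]

theorem galCl_conjugation_conjugation (c : ClassGroup (𝓞 E)) :
    galCl conjugation E (galCl conjugation E c) = c := by
  obtain ⟨I, rfl⟩ := ClassGroup.mk0_surjective c
  have h1 : galIdeal conjugation E (galIdeal conjugation E I) = I := by
    rw [← galIdeal_mul, galIdeal_eq_self fun x => ?_]
    rw [AlgEquiv.mul_apply]
    exact Subtype.ext (by rw [coe_conjugation, coe_conjugation, Complex.conj_conj])
  rw [galCl_mk0, galCl_mk0, h1]

theorem normCl_normCl {E'' : GaloisNF} (h : E ≤ E') (h' : E' ≤ E'') (c : ClassGroup (𝓞 E'')) :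
    normCl h (normCl h' c) = normCl (h.trans h') c := by
  obtain ⟨I, rfl⟩ := ClassGroup.mk0_surjective c
  rw [normCl_mk0, normCl_mk0, normCl_mk0, normIdeal_normIdeal]

theorem normCl_liftCl {E₁ E₂ L₁ L₂ : GaloisNF} (hE : E₁ ≤ E₂) (hL : L₁ ≤ L₂) (h₁ : E₁ ≤ L₁)
    (h₂ : E₂ ≤ L₂) {ι : Type*} [Fintype ι] {τ : ι → (QBar ≃ₐ[ℚ] QBar)} (hτ : GalSystem hE τ)
    (hτ' : GalSystem hL τ) (c : ClassGroup (𝓞 E₂)) :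
    normCl hL (liftCl h₂ c) = liftCl h₁ (normCl hE c) := by
  obtain ⟨I, rfl⟩ := ClassGroup.mk0_surjective c
  rw [normCl_mk0, liftCl_mk0, liftCl_mk0, normCl_mk0, normIdeal_extIdeal hE hL h₁ h₂ hτ hτ']

theorem liftCl_normCl (h : E ≤ E') {p : ℕ} {ν : QBar ≃ₐ[ℚ] QBar}
    (hν : GalSystem h fun i : Fin p => ν ^ (i : ℕ)) (c : ClassGroup (𝓞 E')) :
    liftCl h (normCl h c) = ∏ i ∈ Finset.range p, (galCl ν E')^[i] c := by
  obtain ⟨I, rfl⟩ := ClassGroup.mk0_surjective c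
  rw [normCl_mk0, liftCl_mk0, extIdeal_normIdeal_eq_prod h hν, map_prod,
    Finset.prod_range]
  exact Finset.prod_congr rfl fun i _ => by rw [← galCl_mk0, galCl_pow]

variable {p : ℕ} [Fact p.Prime]

theorem mem_minusPart {c : ClassGroup (𝓞 E)} :
    c ∈ minusPart p E ↔ (∃ k, c ^ p ^ k = 1) ∧ galCl conjugation E c = c⁻¹ := Iff.rfl

theorem map_mem_minusPart {f : ClassGroup (𝓞 E) →* ClassGroup (𝓞 E')}
    (hf : ∀ c, galCl conjugation E' (f c) = f (galCl conjugation E c)) {c : ClassGroup (𝓞 E)}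
    (hc : c ∈ minusPart p E) : f c ∈ minusPart p E' := by
  rw [mem_minusPart] at hc ⊢
  obtain ⟨⟨k, hk⟩, hc⟩ := hc
  exact ⟨⟨k, by rw [← map_pow, hk, map_one]⟩, by rw [hf, hc, map_inv]⟩

/-- Project `a` to the `p`-primary minus part: kill the prime-to-`p` part by an exponent `u` and
divide by the conjugate. The image is then `b ^ (2 * t * u)`, and this exponent is invertible modulo
the order of `b`. -/
theorem exists_minusPart_of_pow (hp : Odd p) {f : ClassGroup (𝓞 E) →* ClassGroup (𝓞 E')}
    (hf : ∀ c, galCl conjugation E' (f c) = f (galCl conjugation E c)) {b : ClassGroup (𝓞 E')}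
    (hb : b ∈ minusPart p E') {t : ℕ} (ht : t.Coprime p) {a : ClassGroup (𝓞 E)}
    (ha : f a = b ^ t) : ∃ c ∈ minusPart p E, f c = b := by
  have hpp : p.Prime := Fact.out
  obtain ⟨⟨k, hk⟩, hb⟩ := mem_minusPart.mp hb
  obtain ⟨s, u, hu, hcard⟩ := Nat.exists_eq_pow_mul_and_not_dvd
    (Nat.card_pos (α := ClassGroup (𝓞 E))).ne' p hpp.ne_one
  have ha1 : (a ^ u) ^ p ^ s = 1 := by rw [← pow_mul, mul_comm, ← hcard, pow_card_eq_one']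
  let w : ClassGroup (𝓞 E) := a ^ u / galCl conjugation E (a ^ u)
  have hw : w ∈ minusPart p E := by
    rw [mem_minusPart]
    refine ⟨⟨s, ?_⟩, ?_⟩
    · rw [div_pow, ← map_pow, ha1, map_one, div_one]
    · rw [map_div, galCl_conjugation_conjugation, inv_div]
  have hfw : f w = b ^ (2 * (t * u)) := by
    rw [map_div, ← hf, map_pow, ha, map_pow, map_pow, hb, inv_pow, inv_pow, div_inv_eq_mul,
      ← pow_mul, ← pow_add, two_mul]
  have hcop : (2 * (t * u)).Coprime (orderOf b) := by
    refine Nat.Coprime.of_dvd_right (orderOf_dvd_of_pow_eq_one hk) ?_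
    refine Nat.Coprime.pow_right _ (Nat.Coprime.mul_left (Nat.coprime_two_left.mpr hp)
      (Nat.Coprime.mul_left ht ?_))
    exact Nat.coprime_comm.mp ((Nat.Prime.coprime_iff_not_dvd hpp).mpr hu)
  obtain ⟨m, hm⟩ := exists_pow_eq_self_of_coprime hcop
  exact ⟨w ^ m, pow_mem hw m, by rw [map_pow, hfw, hm]⟩

end Classes

/-! ### Norms of invariant ideals are extended from below. -/

section Descent

theorem ideal_pow_injective {E : GaloisNF} {n : ℕ} (hn : n ≠ 0) :
    Function.Injective fun I : (Ideal (𝓞 E))⁰ => I ^ n := fun _ _ h =>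
  Subtype.ext (pow_left_injective hn (congrArg Subtype.val h))

theorem extIdeal_normIdeal_eq_pow {E L : GaloisNF} {p : ℕ} {h : E ≤ L}
    {ν : QBar ≃ₐ[ℚ] QBar} (hν : GalSystem h fun i : Fin p => ν ^ (i : ℕ))
    {J : (Ideal (𝓞 L))⁰} (hJ : galIdeal ν L J = J) : extIdeal h (normIdeal h J) = J ^ p := by
  have h2 : ∀ i : ℕ, galIdeal (ν ^ i) L J = J := fun i => by
    rw [galIdeal_pow]
    exact Function.iterate_fixed hJ i
  rw [extIdeal_normIdeal_eq_prod h hν]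
  simp_rw [h2]
  rw [Finset.prod_const, Finset.card_univ, Fintype.card_fin]

theorem exists_pow_mul_extIdeal_of_map_eq_pow {E₁ E₂ L₂ : GaloisNF} {p q : ℕ} (hp : p ≠ 0)
    [Fact q.Prime] (hE : E₁ ≤ E₂) (h₂ : E₂ ≤ L₂) (hL₂ : L₂ ≤ E₂ ⊔ cycloNF q)
    (hA : ∀ P : Ideal (𝓞 E₂), P.IsPrime → (q : 𝓞 E₂) ∈ P → ∃ P₁, P = Ideal.map (extInt hE) P₁)
    {J : (Ideal (𝓞 L₂))⁰} {c : (Ideal (𝓞 E₂))⁰} (h1 : extIdeal h₂ c = J ^ p) :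
    ∃ (d : (Ideal (𝓞 E₂))⁰) (r : (Ideal (𝓞 E₁))⁰), c = d ^ p * extIdeal hE r := by
  classical
  have h2 : c.1.map (extInt h₂) = J.1 ^ p := congrArg Subtype.val h1
  exact exists_eq_pow_mul_extIdeal hE c hA fun P hP hP0 hq =>
    dvd_count_of_map_eq_pow h₂ hL₂ hP hP0 hq (nonZeroDivisors.coe_ne_zero c) hp h2

theorem map_pow_eq_of_pow_eq {A₁ A₂ B₁ B₂ : Type*} [CommMonoid A₁] [CommMonoid A₂] [CommMonoid B₁]
    [CommMonoid B₂] (e₁ : A₁ →* B₁) (e₂ : A₂ →* B₂) (nA : A₂ →* A₁) (nB : B₂ →* B₁) {p k : ℕ}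
    {x s : B₂} {d t : A₂} {r : A₁} (h2 : e₂ t = s) (h3 : nB (e₂ d) = e₁ (nA d))
    (h4 : nB s = e₁ r ^ (p * k)) (h1 : x ^ p = e₂ (d ^ p * t)) :
    nB x ^ p = e₁ (nA d * r ^ k) ^ p := by
  rw [← map_pow, h1, map_mul, map_pow, map_mul, map_pow, h2, h3, h4, map_mul, map_pow, mul_pow,
    ← pow_mul, mul_comm k p]

/-- The norm raises the part `r`, which comes from `E₁`, to the degree `p * k`. So the norm of `J ^
p` is the `p`-th power of an extended ideal, and roots of ideals are unique. -/
theorem normIdeal_eq_extIdeal_of_pow {E₁ E₂ L₁ L₂ : GaloisNF} {p k : ℕ} (hp : p ≠ 0)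
    (hE : E₁ ≤ E₂) (hL : L₁ ≤ L₂) (h₁ : E₁ ≤ L₁) (h₂ : E₂ ≤ L₂)
    {ι : Type*} [Fintype ι] {τ : ι → (QBar ≃ₐ[ℚ] QBar)}
    (hτ : GalSystem hE τ) (hτ' : GalSystem hL τ) (hk : Fintype.card ι = p * k)
    {J : (Ideal (𝓞 L₂))⁰} {d : (Ideal (𝓞 E₂))⁰} {r : (Ideal (𝓞 E₁))⁰}
    (h1 : J ^ p = extIdeal h₂ (d ^ p * extIdeal hE r)) :
    normIdeal hL J = extIdeal h₁ (normIdeal hE d * r ^ k) := by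
  have h2 : extIdeal h₂ (extIdeal hE r) = extIdeal hL (extIdeal h₁ r) := by
    rw [extIdeal_extIdeal, extIdeal_extIdeal]
  have h4 : normIdeal hL (extIdeal hL (extIdeal h₁ r)) = extIdeal h₁ r ^ (p * k) := by
    rw [normIdeal_extIdeal_self hL hτ', hk]
  exact ideal_pow_injective hp (map_pow_eq_of_pow_eq (extIdeal h₁) (extIdeal h₂) (normIdeal hE)
    (normIdeal hL) h2 (normIdeal_extIdeal hE hL h₁ h₂ hτ hτ' d) h4 h1)

/-- The conjugates of `x` differ from it by `p`-th roots of unity in `E`, so the power of `x` to the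
degree lies in `E`, as does `x ^ p`. A degree prime to `p` would put `x` itself into `E`. -/
theorem dvd_card_of_notMem {E E' : GaloisNF} {h : E ≤ E'} {ι : Type*} [Fintype ι]
    {τ : ι → (QBar ≃ₐ[ℚ] QBar)} (hτ : GalSystem h τ) {p : ℕ} [Fact p.Prime]
    (hζ : ∀ ζ : QBar, ζ ^ p = 1 → ζ ∈ E.toIntermediateField) {x : 𝓞 E'} (hx0 : x ≠ 0)
    (hx : ((x : E') : QBar) ^ p ∈ E.toIntermediateField)
    (hx' : ((x : E') : QBar) ∉ E.toIntermediateField) : p ∣ Fintype.card ι := by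
  have hp : p.Prime := Fact.out
  by_contra hnd
  set X : QBar := ((x : E') : QBar) with hX
  have hX0 : X ≠ 0 := by
    intro h0
    exact hx0 (int_ext (by rw [← hX, h0]; rfl))
  have h1 : X ^ Fintype.card ι ∈ E.toIntermediateField := by
    have h2 : ∏ i, (τ i X / X) ∈ E.toIntermediateField := prod_mem fun i _ => hζ _ (by
      rw [div_pow, ← map_pow, hτ.fixes i ⟨_, hx⟩, div_self (pow_ne_zero _ hX0)])
    have h3 : (((normInt h x : 𝓞 E) : E) : QBar) ∈ E.toIntermediateField := Subtype.property _
    rw [coe_normInt h hτ] at h3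
    have h4 : X ^ Fintype.card ι = (∏ i, τ i X) / ∏ i, (τ i X / X) := by
      rw [Finset.prod_div_distrib, Finset.prod_const, Finset.card_univ, div_div_cancel₀]
      exact Finset.prod_ne_zero_iff.mpr fun i _ => (map_ne_zero _).mpr hX0
    rw [h4]
    exact div_mem h3 h2
  have h2 : IsCoprime (p : ℤ) (Fintype.card ι : ℤ) :=
    Nat.isCoprime_iff_coprime.mpr ((Nat.Prime.coprime_iff_not_dvd hp).mpr hnd)
  obtain ⟨u, v, huv⟩ := h2
  refine hx' ?_
  have h3 : X = (X ^ p) ^ u * (X ^ Fintype.card ι) ^ v := by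
    rw [← zpow_natCast X p, ← zpow_natCast X (Fintype.card ι), ← zpow_mul, ← zpow_mul,
      ← zpow_add₀ hX0, mul_comm (p : ℤ), mul_comm (Fintype.card ι : ℤ), huv, zpow_one]
  rw [h3]
  exact mul_mem (zpow_mem hx u) (zpow_mem h1 v)

end Descent

end IwasawaThaine

namespace IwasawaThaine

open Module

/-! ### Good levels, and lifting norms of fixed classes. -/

section ThaineShift

variable {p : ℕ} [Fact p.Prime] {K : GaloisNF} {m q : ℕ} [Fact q.Prime]
  {Q : Ideal (𝓞 (towerK p K m))} {ν : QBar ≃ₐ[ℚ] QBar}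

theorem InducesInertThaineShift.natCast_mem (hQ : InducesInertThaineShift p K m q Q) :
    (q : 𝓞 (towerK p K m)) ∈ Q := by
  have := hQ.above
  have h1 := (Ideal.mem_of_liesOver Q (Ideal.span {(q : ℤ)}) (q : ℤ)).mp
    (Ideal.mem_span_singleton_self _)
  simpa using h1

theorem InducesInertThaineShift.ne (hQ : InducesInertThaineShift p K m q Q) : p ≠ q := by
  rintro rfl
  have h1 := hQ.modEq
  rw [Nat.ModEq, Nat.mod_self, Nat.mod_eq_of_lt (Fact.out : p.Prime).one_lt] at h1
  exact zero_ne_one h1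

theorem InducesInertThaineShift.unramifiedAt (hQ : InducesInertThaineShift p K m q Q) {n : ℕ}
    (h : m ≤ n) : UnramifiedAt q (towerK p K n) :=
  unramifiedAt_of_inert (towerK_mono p K h) hQ.isPrime hQ.natCast_mem hQ.split (hQ.inert n h)

theorem fieldF_le_cycloNF : fieldF p q ≤ cycloNF q := by
  rw [coe_le, coe_cycloNF]
  exact coe_cycloSub_le q _

theorem towerL_le (n : ℕ) : towerL p K q n ≤ towerK p K n ⊔ cycloNF q :=
  sup_le_sup_left fieldF_le_cycloNF _

/-- The levels `n` at which `𝕂_n` contains `ζ_{p^n}` but not `ζ_{p^{n+1}}`. -/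
def IsGoodLevel (p : ℕ) [Fact p.Prime] (K : GaloisNF) (n : ℕ) : Prop :=
  n ≠ 0 ∧ ∃ ζ : QBar, IsPrimitiveRoot ζ (p ^ (n + 1)) ∧ ζ ∉ (towerK p K n).toIntermediateField

theorem exists_isGoodLevel (K : GaloisNF) (N : ℕ) : ∃ n ≥ N, IsGoodLevel p K n := by
  obtain ⟨n, hn, h⟩ := exists_good p K (N + 1)
  exact ⟨n, by omega, by omega, h⟩

theorem IsGoodLevel.notMem {n : ℕ} (hn : IsGoodLevel p K n) {ζ : QBar}
    (hζ : IsPrimitiveRoot ζ (p ^ (n + 1))) : ζ ∉ (towerK p K n).toIntermediateField := by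
  obtain ⟨-, ξ, hξ, hmem⟩ := hn
  intro h
  have : NeZero (p ^ (n + 1)) := ⟨pow_ne_zero _ (Fact.out : p.Prime).ne_zero⟩
  obtain ⟨i, -, rfl⟩ := hζ.eq_pow_of_pow_eq_one hξ.pow_eq_one
  exact hmem (pow_mem h i)

theorem mem_towerK_of_pow_eq_one (hp : Odd p)
    (hζ : ∀ ζ : QBar, ζ ^ p = 1 → ζ ∈ K.toIntermediateField) {n : ℕ} {x : QBar}
    (hx : x ^ p ^ n = 1) : x ∈ (towerK p K n).toIntermediateField :=
  cyclo_pow_le_towerK p hp K hζ n (mem_cyclo hx)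

/-- Roots of unity of `p`-power order lie in 𝕂_∞ and are fixed by `ν`; those in 𝕃_n therefore lie in
𝕂_n. -/
theorem IsGoodLevel.not_isPrimitiveRoot (hp : Odd p)
    (hζ : ∀ ζ : QBar, ζ ^ p = 1 → ζ ∈ K.toIntermediateField) (hq : q ≡ 1 [MOD p])
    (hνK : ∀ n, ∀ x ∈ (towerK p K n).toIntermediateField, ν x = x)
    (hνF : Subgroup.zpowers (ν.restrictNormal (fieldF p q)) = ⊤) {n : ℕ}
    (hn : IsGoodLevel p K n) (w : 𝓞 (towerL p K q n)) : ¬ IsPrimitiveRoot w (p ^ (n + 1)) := by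
  intro hw
  have hw' := isPrimitiveRoot_coe.mpr hw
  refine hn.notMem hw' (mem_of_fixed _ fun σ hσ => ?_)
  obtain ⟨i, hi⟩ := (galSystem_pow hq hνK hνF n).surj σ hσ
  rw [hi]
  exact pow_apply_of_mem_towerK hνK i (n + 1) (mem_towerK_of_pow_eq_one hp hζ hw'.pow_eq_one)

theorem exists_invariant_ideal_towerL (hp : Odd p) [IsCMField K]
    (hζ : ∀ ζ : QBar, ζ ^ p = 1 → ζ ∈ K.toIntermediateField)
    (hQ : InducesInertThaineShift p K m q Q)
    (hνK : ∀ n, ∀ x ∈ (towerK p K n).toIntermediateField, ν x = x)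
    (hνF : Subgroup.zpowers (ν.restrictNormal (fieldF p q)) = ⊤) {n : ℕ} (hmn : m ≤ n)
    (hn : IsGoodLevel p K n) {b : ClassGroup (𝓞 (towerL p K q n))}
    (hb : galCl ν (towerL p K q n) b = b)
    (hb' : galCl conjugation (towerL p K q n) b = b⁻¹) :
    ∃ (t : ℕ) (J : (Ideal (𝓞 (towerL p K q n)))⁰), t.Coprime p ∧
      galIdeal ν (towerL p K q n) J = J ∧ ClassGroup.mk0 J = b ^ t := by
  have : NeZero (p ^ n) := ⟨pow_ne_zero _ (Fact.out : p.Prime).ne_zero⟩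
  have : NeZero (p ^ (n + 1)) := ⟨pow_ne_zero _ (Fact.out : p.Prime).ne_zero⟩
  have hsys := galSystem_pow hQ.modEq hνK hνF
  refine exists_invariant_ideal (q := q) hp (hsys n)
    (fun σ x => conjugation_comm_towerL p K q σ n x) (fun P hP hqP i x => ?_)
    (fun μ k hμ hcong => ?_) hb hb'
  · exact galInt_sub_mem (hQ.unramifiedAt hmn) (towerK_le_towerL p K q n) (towerL_le n) hP hqP
      ((hsys n).fixes i) x
  · obtain ⟨z, hz⟩ := exists_isPrimitiveRoot_int (cyclo_pow_le_towerK p hp K hζ n)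
    obtain ⟨z₁, hz₁⟩ := exists_isPrimitiveRoot_int (cyclo_pow_le_towerK p hp K hζ (n + 1))
    exact exists_pow_eq_of_congr hQ.ne (towerK_le_towerL p K q n) (towerK_mono p K n.le_succ)
      (towerL_mono p K q n.le_succ) (towerK_le_towerL p K q (n + 1))
      (towerK_mono p K (hmn.trans n.le_succ))
      ((towerK_mono p K hmn).trans (towerK_le_towerL p K q n)) (towerL_le (n + 1)) (hsys (n + 1))
      (hQ.unramifiedAt (hmn.trans n.le_succ)) hQ.natCast_mem (hQ.inert _ (hmn.trans n.le_succ)) hn.1 hz hz₁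
      (hn.not_isPrimitiveRoot hp hζ hQ.modEq hνK hνF) hμ hcong

theorem IsGoodLevel.dvd_card (hp : Odd p)
    (hζ : ∀ ζ : QBar, ζ ^ p = 1 → ζ ∈ K.toIntermediateField) {i j : ℕ} (hi : IsGoodLevel p K i)
    (hij : i < j) {ι : Type*} [Fintype ι] {τ : ι → (QBar ≃ₐ[ℚ] QBar)}
    (hτ : GalSystem (towerK_mono p K hij.le) τ) : p ∣ Fintype.card ι := by
  have hpp : p.Prime := Fact.out
  have : NeZero (p ^ (i + 1)) := ⟨pow_ne_zero _ hpp.ne_zero⟩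
  have hle : cyclo (p ^ (i + 1)) ≤ (towerK p K j).toIntermediateField :=
    (cyclo_pow_le_towerK p hp K hζ (i + 1)).trans (coe_le.mp (towerK_mono p K hij))
  obtain ⟨z, hz⟩ := exists_isPrimitiveRoot_int hle
  have hz' := isPrimitiveRoot_coe.mpr hz
  have hKi : K ≤ towerK p K i := le_sup_left
  refine dvd_card_of_notMem hτ (fun ζ h => coe_le.mp hKi (hζ ζ h))
    (hz.ne_zero (NeZero.ne _)) (mem_towerK_of_pow_eq_one hp hζ ?_) (hi.notMem hz')
  rw [← pow_mul, ← pow_succ', hz'.pow_eq_one]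

/-- The norm of a class of `A⁻(𝕃_j)` fixed by `ν` is lifted from `A⁻(𝕂_i)`. -/
theorem exists_liftCl_eq_normCl (hp : Odd p) [IsCMField K]
    (hζ : ∀ ζ : QBar, ζ ^ p = 1 → ζ ∈ K.toIntermediateField)
    (hQ : InducesInertThaineShift p K m q Q)
    (hνK : ∀ n, ∀ x ∈ (towerK p K n).toIntermediateField, ν x = x)
    (hνF : Subgroup.zpowers (ν.restrictNormal (fieldF p q)) = ⊤) {i j : ℕ} (hmi : m ≤ i)
    (hi : IsGoodLevel p K i) (hj : IsGoodLevel p K j) (hij : i < j)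
    {b : ClassGroup (𝓞 (towerL p K q j))} (hb : b ∈ minusPart p (towerL p K q j))
    (hνb : galCl ν (towerL p K q j) b = b) :
    ∃ c ∈ minusPart p (towerK p K i), liftCl (towerK_le_towerL p K q i) c =
      normCl (towerL_mono p K q hij.le) b := by
  obtain ⟨t, J, ht, hJ, hJb⟩ := exists_invariant_ideal_towerL hp hζ hQ hνK hνF
    (hmi.trans hij.le) hj hνb hb.2
  obtain ⟨ι, _, τ, hτ, hτ'⟩ := exists_galSystem_tower hQ.modEq hνK hνF hij.le
  -- `ζ_{p^(i+1)}` is missing in 𝕂_i and present in 𝕂_j, so `p` divides the degree.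
  obtain ⟨k, hk⟩ := hi.dvd_card hp hζ hij hτ
  have hp0 : p ≠ 0 := (Fact.out : p.Prime).ne_zero
  have h1 := extIdeal_normIdeal_eq_pow (galSystem_pow hQ.modEq hνK hνF j) hJ
  -- Inertness is used here: every prime of 𝕂_j above `q` is extended from 𝕂_i.
  obtain ⟨d, r, hdr⟩ := exists_pow_mul_extIdeal_of_map_eq_pow (q := q) hp0
    (towerK_mono p K hij.le) (towerK_le_towerL p K q j) (towerL_le j)
    (fun P hP hqP => exists_eq_map_extInt (towerK_mono p K hmi) (towerK_mono p K hij.le)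
      hQ.natCast_mem (hQ.inert _ (hmi.trans hij.le)) hP hqP) h1
  rw [hdr] at h1
  have h2 := normIdeal_eq_extIdeal_of_pow hp0 (towerK_mono p K hij.le) (towerL_mono p K q hij.le)
    (towerK_le_towerL p K q i) (towerK_le_towerL p K q j) hτ hτ' hk h1.symm
  -- So far only the `t`-th power of the norm of `b` is lifted, and from a class that need not be in
  -- the minus part.
  refine exists_minusPart_of_pow hp (galCl_liftCl conjugation (towerK_le_towerL p K q i))
    (map_mem_minusPart (galCl_normCl conjugation _) hb) ht
    (a := ClassGroup.mk0 (normIdeal (towerK_mono p K hij.le) d * r ^ k)) ?_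
  rw [liftCl_mk0, ← h2, ← normCl_mk0, hJb, map_pow]

end ThaineShift

end IwasawaThaine

namespace IwasawaThaine

open Module

/-! ### A Dirichlet character with kernel cutting out 𝔽. -/

section Character

variable {p : ℕ} [Fact p.Prime] {q : ℕ} [Fact q.Prime] {ν : QBar ≃ₐ[ℚ] QBar}

theorem exists_algEquiv_apply_eq_pow {N : ℕ} [NeZero N] {ζ : QBar} (hζ : IsPrimitiveRoot ζ N)
    {k : ℕ} (hk : k.Coprime N) : ∃ σ : QBar ≃ₐ[ℚ] QBar, σ ζ = ζ ^ k := by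
  have h1 : minpoly ℚ (ζ ^ k) = minpoly ℚ ζ := by
    have h2 := hζ.minpoly_eq_pow_coprime hk
    rw [minpoly.isIntegrallyClosed_eq_field_fractions' ℚ (hζ.isIntegral (NeZero.pos N)),
      minpoly.isIntegrallyClosed_eq_field_fractions' ℚ ((hζ.isIntegral (NeZero.pos N)).pow k), h2]
  exact isConjRoot_iff_exists_algEquiv.mp h1

theorem autToPow_surjective {N : ℕ} [NeZero N] {ζ : QBar} (hζ : IsPrimitiveRoot ζ N) :
    Function.Surjective (hζ.autToPow ℚ) := by
  intro u
  obtain ⟨σ, hσ⟩ := exists_algEquiv_apply_eq_pow hζ (ZMod.val_coe_unit_coprime u)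
  refine ⟨σ, Units.ext ?_⟩
  have h1 := hζ.autToPow_spec ℚ σ
  rw [hσ] at h1
  have h2 := hζ.pow_inj (ZMod.val_lt _) (ZMod.val_lt _) h1
  exact ZMod.val_injective N h2

/-- The Dirichlet characters modulo `q` that cut out the field `𝔽`. -/
theorem exists_dirichletCharacter (hq : q ≡ 1 [MOD p])
    (hνF : Subgroup.zpowers (ν.restrictNormal (fieldF p q)) = ⊤) {ζ : QBar}
    (hζ : IsPrimitiveRoot ζ q) :
    ∃ θ : DirichletCharacter ℂ q, (∀ a, θ a = 0 ∨ θ a ^ p = 1) ∧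
      (∀ (σ : QBar ≃ₐ[ℚ] QBar) (k : ℕ), σ ζ = ζ ^ k →
        (θ k = 1 ↔ ∀ x ∈ (fieldF p q).toIntermediateField, σ x = x)) ∧
      ∃ a : ℤ, IsCoprime a q ∧ θ a ≠ 1 := by
  have hpp : p.Prime := Fact.out
  have hqp : q.Prime := Fact.out
  have : NeZero q := ⟨hqp.ne_zero⟩
  have : NeZero p := ⟨hpp.ne_zero⟩
  let f : (QBar ≃ₐ[ℚ] QBar) →* (ZMod q)ˣ := hζ.autToPow ℚ
  have hf : Function.Surjective f := autToPow_surjective hζ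
  let r : (QBar ≃ₐ[ℚ] QBar) →* Gal(fieldF p q/ℚ) := AlgEquiv.restrictNormalHom (fieldF p q)
  have hr : ∀ σ, r σ = 1 ↔ ∀ x ∈ (fieldF p q).toIntermediateField, σ x = x := by
    intro σ
    constructor
    · intro h x hx
      have h1 := coe_restrictNormal σ (fieldF p q) ⟨x, hx⟩
      have h2 : σ.restrictNormal (fieldF p q) = 1 := h
      rw [h2] at h1
      exact h1.symm
    · intro h
      exact AlgEquiv.ext fun x => Subtype.ext ((coe_restrictNormal σ (fieldF p q) x).trans
        (h x x.2))
  have hker : f.ker ≤ r.ker := by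
    intro σ hσ
    rw [MonoidHom.mem_ker] at hσ ⊢
    rw [hr]
    intro x hx
    have h1 : σ ζ = ζ := by
      have h2 := hζ.autToPow_spec ℚ σ
      have h3 : hζ.autToPow ℚ σ = 1 := hσ
      rw [h3, Units.val_one, ZMod.val_one'' hqp.ne_one, pow_one] at h2
      exact h2.symm
    refine apply_eq_of_mem_cyclo (τ := 1) (N := q) (fun y hy => ?_) x (coe_cycloSub_le q _ hx)
    obtain ⟨i, -, rfl⟩ := hζ.eq_pow_of_pow_eq_one hy
    rw [map_pow, h1, AlgEquiv.one_apply]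
  -- An automorphism fixing `ζ_q` fixes 𝔽, so restriction to 𝔽 factors through the cyclotomic
  -- character.
  let s : (ZMod q)ˣ →* Gal(fieldF p q/ℚ) := MonoidHom.liftOfSurjective f hf ⟨r, hker⟩
  have hs : ∀ σ, s (f σ) = r σ := fun σ =>
    MonoidHom.liftOfRightInverse_comp_apply _ _ _ ⟨r, hker⟩ σ
  have hcard : Nat.card Gal(fieldF p q/ℚ) = p := by
    rw [IsGalois.card_aut_eq_finrank]
    exact finrank_fieldF p q hq
  have : IsCyclic Gal(fieldF p q/ℚ) :=
    ⟨ν.restrictNormal (fieldF p q), fun x => Subgroup.mem_zpowers_iff.mp (by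
      rw [hνF]
      exact Subgroup.mem_top x)⟩
  let e : Gal(fieldF p q/ℚ) ≃* rootsOfUnity p ℂ := mulEquivOfCyclicCardEq (by
    rw [hcard, HasEnoughRootsOfUnity.natCard_rootsOfUnity])
  let φ : Gal(fieldF p q/ℚ) →* ℂˣ := (rootsOfUnity p ℂ).subtype.comp e.toMonoidHom
  have hφ : Function.Injective φ := Subtype.val_injective.comp e.injective
  let θ : DirichletCharacter ℂ q := MulChar.ofUnitHom (φ.comp s)
  have hθ : ∀ u : (ZMod q)ˣ, θ (u : ZMod q) = φ (s u) := fun u => MulChar.ofUnitHom_coe _ u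
  have hθ1 : ∀ u : (ZMod q)ˣ, θ (u : ZMod q) = 1 ↔ s u = 1 := fun u => by
    rw [hθ, Units.val_eq_one, map_eq_one_iff φ hφ]
  refine ⟨θ, fun a => ?_, fun σ k hσ => ?_, ?_⟩
  · by_cases ha : IsUnit a
    · obtain ⟨u, rfl⟩ := ha
      right
      have h1 : s u ^ p = 1 := by
        have h2 := pow_card_eq_one' (x := s u)
        rwa [hcard] at h2
      rw [hθ, ← Units.val_pow_eq_pow_val, ← map_pow, h1, map_one, Units.val_one]
    · exact Or.inl (θ.map_nonunit ha)
  · have h1 := hζ.autToPow_spec ℚ σ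
    rw [hσ] at h1
    have h2 : ((f σ : (ZMod q)ˣ) : ZMod q) = k := by
      rw [pow_eq_pow_mod k hζ.pow_eq_one] at h1
      have h3 := hζ.pow_inj (ZMod.val_lt _) (Nat.mod_lt k hqp.pos) h1
      have h4 := congrArg (Nat.cast (R := ZMod q)) h3
      rwa [ZMod.natCast_zmod_val, ZMod.natCast_mod] at h4
    rw [← h2, hθ1, hs, hr]
  · have hrs : Function.Surjective r := AlgEquiv.restrictNormalHom_surjective QBar
    obtain ⟨σ, hσ⟩ := hrs (ν.restrictNormal (fieldF p q))
    refine ⟨((f σ : (ZMod q)ˣ) : ZMod q).val, ?_, ?_⟩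
    · exact (ZMod.val_coe_unit_coprime (f σ)).isCoprime
    · rw [Int.cast_natCast, ZMod.natCast_zmod_val, Ne, hθ1, hs, hσ]
      intro h
      have := orderOf_restrictNormal_fieldF hq hνF
      rw [h, orderOf_one] at this
      exact hpp.one_lt.ne this

end Character

end IwasawaThaine

namespace IwasawaThaine

open Module

/-! ### Norms of integers modulo `q`. -/

section NormMod

variable {E : GaloisNF} {q : ℕ} [Fact q.Prime]

theorem natCast_prod_smul (β : 𝓞 E) :
    ((Algebra.norm ℤ β : ℤ) : 𝓞 E) = ∏ σ : Gal(E/ℚ), σ • β := by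
  refine RingOfIntegers.ext ?_
  have h1 := Algebra.norm_eq_prod_automorphisms ℚ (β : E)
  rw [← Algebra.coe_norm_int] at h1
  have h2 : algebraMap ℚ E ((Algebra.norm ℤ β : ℤ) : ℚ) = ((Algebra.norm ℤ β : ℤ) : E) :=
    map_intCast _ _
  rw [h2] at h1
  refine Eq.trans ?_ (h1.trans ?_)
  · exact map_intCast (algebraMap (𝓞 E) E) _
  · exact (map_prod (algebraMap (𝓞 E) E) (fun σ : Gal(E/ℚ) => σ • β) Finset.univ).symm

open scoped Classical Pointwise in
-- Choose `β` congruent to `b` modulo `P` and to 1 modulo its other conjugates. Modulo `P`, only the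
-- automorphisms in the decomposition group contribute to the norm. As `q` is unramified, this group
-- is the Galois group of the residue field, so the result is the norm of `b` from the residue
-- field; norms between finite fields are onto.
theorem exists_norm_eq (hE : UnramifiedAt q E) (u : ℤ) :
    ∃ β : 𝓞 E, ((Algebra.norm ℤ β : ℤ) : ZMod q) = u := by
  have hqp : q.Prime := Fact.out
  obtain ⟨P, hP, hqP⟩ := Ideal.exists_le_maximal _ (span_natCast_ne_top (E := E) hqp)
  rw [Ideal.span_singleton_le_iff_mem] at hqP
  have hPp := hP.isPrime
  have hlies := liesOver_of_natCast_mem hPp hqP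
  have hq0 : (Ideal.span {(q : ℤ)}).IsMaximal := PrincipalIdealRing.isMaximal_of_irreducible
    (Nat.prime_iff_prime_int.mp hqp).irreducible
  let : Field (ℤ ⧸ Ideal.span {(q : ℤ)}) := Ideal.Quotient.field _
  let : Field (𝓞 E ⧸ P) := Ideal.Quotient.field _
  have hP0 : P ≠ ⊥ := by
    rintro rfl
    rw [Ideal.mem_bot] at hqP
    exact hqp.ne_zero (by exact_mod_cast hqP)
  have hfin : Finite (𝓞 E ⧸ P) := Ideal.finiteQuotientOfFreeOfNeBot P hP0
  obtain ⟨g, hg⟩ := FiniteField.norm_surjective (ℤ ⧸ Ideal.span {(q : ℤ)}) (𝓞 E ⧸ P)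
    (Ideal.Quotient.mk _ u)
  obtain ⟨b, rfl⟩ := Ideal.Quotient.mk_surjective g
  let s : Finset (Ideal (𝓞 E)) := Finset.univ.image fun σ : Gal(E/ℚ) => σ⁻¹ • P
  obtain ⟨β, hβ⟩ := IsDedekindDomain.exists_forall_sub_mem_ideal (s := s) id (fun _ => 1)
    (fun I hI => by
      obtain ⟨σ, -, rfl⟩ := Finset.mem_image.mp hI
      refine Ideal.prime_of_isPrime (fun h => hP0 ?_)
        (inferInstanceAs (σ⁻¹ • P).IsPrime)
      have := congrArg (σ • ·) h
      simpa using this) (fun _ _ _ _ h => h) (fun i => if i.1 = P then b else 1)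
  have hβσ : ∀ σ : Gal(E/ℚ), Ideal.Quotient.mk P (σ • β) =
      if σ⁻¹ • P = P then Ideal.Quotient.mk P (σ • b) else 1 := fun σ => by
    have h1 := hβ (σ⁻¹ • P) (Finset.mem_image_of_mem _ (Finset.mem_univ σ))
    rw [pow_one, id_eq, Ideal.mem_inv_pointwise_smul_iff, smul_sub] at h1
    rw [← sub_eq_zero]
    split_ifs with h
    · rw [if_pos h] at h1
      rw [← map_sub]
      exact Ideal.Quotient.eq_zero_iff_mem.mpr h1
    · rw [if_neg h, smul_one] at h1
      rw [← map_one (Ideal.Quotient.mk P), ← map_sub]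
      exact Ideal.Quotient.eq_zero_iff_mem.mpr h1
  have hbij : Function.Bijective (Ideal.Quotient.stabilizerHom P (Ideal.span {(q : ℤ)})
      Gal(E/ℚ)) := by
    refine ⟨?_, Ideal.Quotient.stabilizerHom_surjective _ _ _⟩
    rw [← MonoidHom.ker_eq_bot_iff, Ideal.Quotient.ker_stabilizerHom]
    refine (Subgroup.eq_bot_iff_forall _).mpr fun σ hσ => Subtype.ext ?_
    have h1 : ∀ y : E, (σ : Gal(E/ℚ)).liftNormal QBar (y : QBar) = ((σ : Gal(E/ℚ)) y : E) :=
      fun y => AlgEquiv.liftNormal_commutes _ QBar y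
    refine AlgEquiv.ext fun y => Subtype.ext ?_
    rw [← h1]
    refine hE P hPp hqP _ (fun x => ?_) y
    have h2 : galInt ((σ : Gal(E/ℚ)).liftNormal QBar) E x = σ • x :=
      int_ext (by rw [coe_galInt, h1]; rfl)
    rw [h2]
    exact hσ x
  have hprod : Ideal.Quotient.mk P ((Algebra.norm ℤ β : ℤ) : 𝓞 E) = Ideal.Quotient.mk P (u : 𝓞 E) := by
    have h1 : algebraMap (ℤ ⧸ Ideal.span {(q : ℤ)}) (𝓞 E ⧸ P) (Ideal.Quotient.mk _ u) =
        Ideal.Quotient.mk P (u : 𝓞 E) := by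
      rw [eq_intCast (Ideal.Quotient.mk (Ideal.span {(q : ℤ)})) u]
      rw [map_intCast, map_intCast]
    rw [← h1, ← hg, Algebra.norm_eq_prod_automorphisms, natCast_prod_smul, map_prod,
      ← hbij.prod_comp]
    simp_rw [hβσ]
    rw [Finset.prod_ite, Finset.prod_const_one, mul_one]
    refine (Finset.prod_subtype (p := (· ∈ MulAction.stabilizer Gal(E/ℚ) P)) _ (fun σ => ?_)
      fun σ => Ideal.Quotient.mk P (σ • b)).trans (Finset.prod_congr (by congr) fun _ _ => rfl)
    rw [Finset.mem_filter, MulAction.mem_stabilizer_iff, inv_smul_eq_iff, eq_comm]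
    exact and_iff_right (Finset.mem_univ σ)
  refine ⟨β, ?_⟩
  rw [Ideal.Quotient.eq, ← Int.cast_sub] at hprod
  have h3 : Algebra.norm ℤ β - u ∈ Ideal.span {(q : ℤ)} := by
    rw [hlies.over, Ideal.under_def, Ideal.mem_comap]
    exact hprod
  rw [Ideal.mem_span_singleton] at h3
  rw [← sub_eq_zero, ← Int.cast_sub]
  exact (ZMod.intCast_zmod_eq_zero_iff_dvd _ _).mpr h3

end NormMod

end IwasawaThaine

namespace IwasawaThaine

open Module

/-! ### Frobenius elements and primes of residue degree one. -/

section Frobenius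

variable {E E' : GaloisNF} {p q : ℕ} [Fact p.Prime] [Fact q.Prime] {ν : QBar ≃ₐ[ℚ] QBar}

theorem exists_frobenius (h : E ≤ E') {P : Ideal (𝓞 E')} (hP : P.IsPrime) (hP0 : P ≠ ⊥) :
    ∃ σ : QBar ≃ₐ[ℚ] QBar, (∀ x : E, σ x = x) ∧
      ∀ x : 𝓞 E', galInt σ E' x - x ^ Ideal.absNorm (P.comap (extInt h)) ∈ P := by
  let : Algebra E E' := (incl h).toAlgebra
  have : IsScalarTower ℚ E E' :=
    IsScalarTower.of_algebraMap_eq fun x => (map_ratCast (incl h) x).symm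
  have : IsGalois E E' := IsGalois.tower_top_of_isGalois ℚ E E'
  have hfin : Finite (𝓞 E' ⧸ P) := Ideal.finiteQuotientOfFreeOfNeBot P hP0
  have hinv : Algebra.IsInvariant (𝓞 E) (𝓞 E') Gal(E'/E) := IsGaloisGroup.isInvariant
  obtain ⟨g, hg⟩ := IsArithFrobAt.exists_of_isInvariant (𝓞 E) Gal(E'/E) P
  have hl : ∀ y : E', (g.restrictScalars ℚ).liftNormal QBar (y : QBar) = (g y : E') :=
    fun y => AlgEquiv.liftNormal_commutes (g.restrictScalars ℚ) QBar y
  refine ⟨(g.restrictScalars ℚ).liftNormal QBar, fun x => ?_, fun x => ?_⟩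
  · have := hl (algebraMap E E' x)
    rw [AlgEquiv.commutes] at this
    exact this
  · have h1 : galInt ((g.restrictScalars ℚ).liftNormal QBar) E' x = g • x :=
      int_ext (by rw [coe_galInt, hl]; rfl)
    rw [h1]
    exact hg x

/-- The Frobenius of `E(ζ_q)/E` at a prime not above `q`. -/
theorem exists_frobenius_cyclo (h : E ≤ E') (hc : cycloNF q ≤ E') {P : Ideal (𝓞 E')}
    (hP : P.IsPrime) (hP0 : P ≠ ⊥) (hq : (q : 𝓞 E') ∉ P) {ζ : QBar} (hζ : IsPrimitiveRoot ζ q) :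
    ∃ σ : QBar ≃ₐ[ℚ] QBar, (∀ x : E, σ x = x) ∧
      σ ζ = ζ ^ Ideal.absNorm (P.comap (extInt h)) ∧
      ∀ x : 𝓞 E', galInt σ E' x - x ^ Ideal.absNorm (P.comap (extInt h)) ∈ P := by
  have hq1 : NeZero q := ⟨(Fact.out : q.Prime).ne_zero⟩
  obtain ⟨σ, hσE, hσ⟩ := exists_frobenius h hP hP0
  refine ⟨σ, hσE, ?_, hσ⟩
  obtain ⟨z, hz⟩ := exists_isPrimitiveRoot_int (E := E') (N := q)
    (coe_cycloNF.ge.trans (coe_le.mp hc))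
  obtain ⟨i, -, hi⟩ := (isPrimitiveRoot_coe.mpr hz).eq_pow_of_pow_eq_one hζ.pow_eq_one
  set N := Ideal.absNorm (P.comap (extInt h)) with hN
  have h1 : galInt σ E' z = z ^ N := by
    by_contra hne
    refine hq (natCast_mem_of_sub_mem Fact.out ?_ ?_ hne (hσ z))
    · rw [← map_pow, hz.pow_eq_one, map_one]
    · rw [← pow_mul, mul_comm, pow_mul, hz.pow_eq_one, one_pow]
  have h2 := congrArg (fun w : 𝓞 E' => ((w : E') : QBar)) h1
  simp only [coe_galInt] at h2
  have h3 : σ ((z : E') : QBar) = ((z : E') : QBar) ^ N := h2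
  rw [← hi, map_pow, h3, ← pow_mul, ← pow_mul, mul_comm]

/-- All elements are roots of `X ^ N - X`. -/
theorem card_le_of_forall_eq_pow {k : Type*} [CommRing k] [IsDomain k] [Finite k] {N : ℕ}
    (hN : 1 < N) (h : ∀ x : k, x = x ^ N) : Nat.card k ≤ N := by
  have := Fintype.ofFinite k
  classical
  have h1 : (Polynomial.X ^ N - Polynomial.X : Polynomial k) ≠ 0 :=
    fun h => by
      have := congrArg (Polynomial.coeff · N) h
      simp [Polynomial.coeff_X, hN.ne] at this
  have h0 : (Polynomial.X ^ N - Polynomial.X : Polynomial k).natDegree ≤ N := by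
    refine (Polynomial.natDegree_sub_le _ _).trans (max_le ?_ ?_)
    · exact Polynomial.natDegree_X_pow_le N
    · exact Polynomial.natDegree_X_le.trans hN.le
  rw [Nat.card_eq_fintype_card]
  refine le_trans ?_ ((Polynomial.card_roots' _).trans h0)
  refine le_trans ?_ (Multiset.toFinset_card_le _)
  refine Finset.card_le_card fun x _ => ?_
  rw [Multiset.mem_toFinset, Polynomial.mem_roots h1]
  simp only [Polynomial.IsRoot.def, Polynomial.eval_sub, Polynomial.eval_pow, Polynomial.eval_X]
  rw [← h x, sub_self]

theorem absNorm_le_of_pow_sub_mem {P : Ideal (𝓞 E)} (hP : P.IsPrime) (hP0 : P ≠ ⊥) {N : ℕ}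
    (hN : 1 < N) (h : ∀ x : 𝓞 E, x - x ^ N ∈ P) : Ideal.absNorm P ≤ N := by
  have hfin : Finite (𝓞 E ⧸ P) := Ideal.finiteQuotientOfFreeOfNeBot P hP0
  refine card_le_of_forall_eq_pow (k := 𝓞 E ⧸ P) hN fun x => ?_
  obtain ⟨y, rfl⟩ := Ideal.Quotient.mk_surjective x
  rw [← map_pow]
  exact Ideal.Quotient.eq.mpr (h y)

theorem comap_extInt_ne_bot (h : E ≤ E') {P : Ideal (𝓞 E')} (hP0 : P ≠ ⊥) :
    P.comap (extInt h) ≠ ⊥ := by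
  let : Algebra E E' := (incl h).toAlgebra
  exact Ideal.under_ne_bot (𝓞 E) hP0

theorem ne_bot_of_comap_extInt_ne_bot (h : E ≤ E') {P : Ideal (𝓞 E')}
    (hP0 : P.comap (extInt h) ≠ ⊥) : P ≠ ⊥ := by
  rintro rfl
  exact hP0 (Ideal.comap_bot_of_injective _ (extInt_injective h))

theorem natCast_absNorm_eq_zero {w : Ideal (𝓞 E)} (hw : w.IsPrime) (hw0 : w ≠ ⊥)
    (hq : (q : 𝓞 E) ∈ w) : ((Ideal.absNorm w : ℕ) : ZMod q) = 0 := by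
  have hl : w.LiesOver (Ideal.span {(q : ℤ)}) := liesOver_of_natCast_mem hw hq
  have hm : w.IsMaximal := hw.isMaximal hw0
  have := Ideal.pow_inertiaDeg q w
  rw [← this, Nat.cast_pow, ZMod.natCast_self, zero_pow]
  exact (Ideal.inertiaDeg_pos w ℤ).ne'

theorem one_lt_absNorm {w : Ideal (𝓞 E)} (hw : w.IsPrime) (hw0 : w ≠ ⊥) :
    1 < Ideal.absNorm w := by
  have h0 : Ideal.absNorm w ≠ 0 := fun h => hw0 (Ideal.absNorm_eq_zero_iff.mp h)
  have h1 : Ideal.absNorm w ≠ 1 := fun h => hw.ne_top (Ideal.absNorm_eq_one_iff.mp h)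
  lia

/-- The relative norm is `w` to the residue degree; comparing absolute norms, the degree is one. -/
theorem relNorm_eq_of_absNorm_le (h : E ≤ E') {w : Ideal (𝓞 E)} (hw : w.IsPrime) (hw0 : w ≠ ⊥)
    {P : Ideal (𝓞 E')} (hP : P.IsPrime) (hP0 : P ≠ ⊥) (hPw : P.comap (extInt h) = w)
    (hle : Ideal.absNorm P ≤ Ideal.absNorm w) :
    (let : Algebra E E' := (incl h).toAlgebra
    Ideal.relNorm (𝓞 E) P) = w := by
  let : Algebra E E' := (incl h).toAlgebra
  have hl : P.LiesOver w := ⟨hPw.symm⟩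
  have hm : w.IsMaximal := hw.isMaximal hw0
  have hM : P.IsMaximal := hP.isMaximal hP0
  have h1 : Ideal.relNorm (𝓞 E) P = w ^ P.inertiaDeg (𝓞 E) := Ideal.relNorm_eq_pow_of_isMaximal P w
  have h2 := Ideal.absNorm_relNorm (R := 𝓞 E) (S := 𝓞 E') P
  have hN := one_lt_absNorm hw hw0
  change Ideal.relNorm (𝓞 E) P = w
  rw [h1] at h2 ⊢
  rw [map_pow] at h2
  rw [← h2] at hle
  have h3 : P.inertiaDeg (𝓞 E) ≤ 1 := by
    rw [← Nat.pow_le_pow_iff_right hN, pow_one]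
    exact hle
  have h4 : 0 < P.inertiaDeg (𝓞 E) := Ideal.inertiaDeg_pos _ _
  rw [show P.inertiaDeg (𝓞 E) = 1 by lia, pow_one]

end Frobenius

end IwasawaThaine

namespace IwasawaThaine

open Module

/-! ### Surjectivity of the norm at finite level. -/

section NormSurjective

variable {E L M : GaloisNF} {p q : ℕ} [Fact p.Prime] [Fact q.Prime] {ν : QBar ≃ₐ[ℚ] QBar}
  {θ : DirichletCharacter ℂ q} {ζ : QBar}

/-- A character whose kernel fixes `𝔽` is trivial on norms from fields containing `𝔽`. -/
theorem apply_absNorm_eq_one (h : L ≤ M) (hc : cycloNF q ≤ M) (hF : fieldF p q ≤ L)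
    (hζ : IsPrimitiveRoot ζ q)
    (hθ : ∀ (σ : QBar ≃ₐ[ℚ] QBar) (k : ℕ), σ ζ = ζ ^ k →
      (θ k = 1 ↔ ∀ x ∈ (fieldF p q).toIntermediateField, σ x = x))
    {w : Ideal (𝓞 L)} (hw : w.IsPrime) (hw0 : w ≠ ⊥) (hq : (q : 𝓞 L) ∉ w) :
    θ (Ideal.absNorm w : ZMod q) = 1 := by
  obtain ⟨P, hP, hPc⟩ := exists_prime_comap_extInt h w hw
  have hP0 : P ≠ ⊥ := ne_bot_of_comap_extInt_ne_bot h (hPc.trans_ne hw0)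
  have hqP : (q : 𝓞 M) ∉ P := fun hmem => hq (by rwa [← hPc, Ideal.mem_comap, map_natCast])
  obtain ⟨σ, hσL, hσ, -⟩ := exists_frobenius_cyclo h hc hP hP0 hqP hζ
  rw [hPc] at hσ
  exact (hθ σ _ hσ).mpr fun x hx => hσL ⟨x, hF hx⟩

theorem apply_absNorm_eq_zero_or_one (h : L ≤ M) (hc : cycloNF q ≤ M) (hF : fieldF p q ≤ L)
    (hζ : IsPrimitiveRoot ζ q)
    (hθ : ∀ (σ : QBar ≃ₐ[ℚ] QBar) (k : ℕ), σ ζ = ζ ^ k →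
      (θ k = 1 ↔ ∀ x ∈ (fieldF p q).toIntermediateField, σ x = x))
    {w : Ideal (𝓞 L)} (hw : w.IsPrime) (hw0 : w ≠ ⊥) :
    θ (Ideal.absNorm w : ZMod q) = 0 ∨ θ (Ideal.absNorm w : ZMod q) = 1 := by
  by_cases hq : (q : 𝓞 L) ∈ w
  · left
    rw [natCast_absNorm_eq_zero hw hw0 hq]
    have : Nontrivial (ZMod q) := ZMod.nontrivial_iff.mpr (Fact.out : q.Prime).ne_one
    exact θ.map_nonunit not_isUnit_zero
  · exact Or.inr (apply_absNorm_eq_one h hc hF hζ hθ hw hw0 hq)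

/-- A prime whose Frobenius fixes `𝔽` is the norm of a prime of `E𝔽`. -/
theorem exists_relNorm_eq (h : E ≤ L) (h' : L ≤ M) (hc : cycloNF q ≤ M)
    (hL : L = E ⊔ fieldF p q) (hζ : IsPrimitiveRoot ζ q)
    (hθ : ∀ (σ : QBar ≃ₐ[ℚ] QBar) (k : ℕ), σ ζ = ζ ^ k →
      (θ k = 1 ↔ ∀ x ∈ (fieldF p q).toIntermediateField, σ x = x))
    {w : Ideal (𝓞 E)} (hw : w.IsPrime) (hw0 : w ≠ ⊥) (h1 : θ (Ideal.absNorm w : ZMod q) = 1) :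
    ∃ P : Ideal (𝓞 L), (let : Algebra E L := (incl h).toAlgebra
      Ideal.relNorm (𝓞 E) P) = w := by
  have hq : (q : 𝓞 E) ∉ w := fun hq => by
    rw [natCast_absNorm_eq_zero hw hw0 hq] at h1
    have : Nontrivial (ZMod q) := ZMod.nontrivial_iff.mpr (Fact.out : q.Prime).ne_one
    rw [θ.map_nonunit not_isUnit_zero] at h1
    exact zero_ne_one h1
  obtain ⟨P, hP, hPc⟩ := exists_prime_comap_extInt (h.trans h') w hw
  have hP0 : P ≠ ⊥ := ne_bot_of_comap_extInt_ne_bot _ (hPc.trans_ne hw0)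
  have hqP : (q : 𝓞 M) ∉ P := fun hmem => hq (by rwa [← hPc, Ideal.mem_comap, map_natCast])
  obtain ⟨σ, hσE, hσ, hσx⟩ := exists_frobenius_cyclo (h.trans h') hc hP hP0 hqP hζ
  rw [hPc] at hσ hσx
  have hσF := (hθ σ _ hσ).mp h1
  -- The Frobenius is trivial on `E` and, by the value of `θ`, on 𝔽. So it is trivial on `L`, and
  -- raising to the power `N w` is the identity on the residue field.
  have hσL : ∀ x : L, σ x = x := fun x =>
    apply_eq_of_mem_sup (τ := 1) (E := E.toIntermediateField)
      (E' := (fieldF p q).toIntermediateField) (fun y hy => hσE ⟨y, hy⟩) hσF x (hL.le x.2)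
  refine ⟨P.comap (extInt h'), relNorm_eq_of_absNorm_le h hw hw0 (hP.comap _)
    (comap_extInt_ne_bot h' hP0) ?_ ?_⟩
  · rw [← hPc, Ideal.comap_comap]
    rfl
  · refine absNorm_le_of_pow_sub_mem (hP.comap _) (comap_extInt_ne_bot h' hP0)
      (one_lt_absNorm hw hw0) fun x => ?_
    have h2 : galInt σ _ (extInt h' x) = extInt h' x :=
      int_ext (by rw [coe_galInt]; exact hσL x)
    have h3 := hσx (extInt h' x)
    rw [h2] at h3
    rwa [Ideal.mem_comap, map_sub, map_pow]

theorem exists_isCoprime_norm (hE : UnramifiedAt q E) {a : ℤ} (ha : IsCoprime a q)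
    (ha1 : θ a ≠ 1) : ∃ β : 𝓞 E, IsCoprime (Algebra.norm ℤ β) (q : ℤ) ∧
      θ ((Algebra.norm ℤ β : ℤ) : ZMod q) ≠ 1 := by
  obtain ⟨β, hβ⟩ := exists_norm_eq hE a
  refine ⟨β, ?_, by rwa [hβ]⟩
  rw [isCoprime_comm, ← ZMod.coe_int_isUnit_iff_isCoprime] at ha ⊢
  rwa [hβ]

/-- The hypotheses of the analytic criterion, with `L(ζ_q)` as an auxiliary field in which Frobenius
elements are read off from their action on `ζ_q`. -/
theorem normCl_surjective (hp : Odd p) (hE : UnramifiedAt q E) (h : E ≤ L)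
    (hL : L = E ⊔ fieldF p q) (hq : q ≡ 1 [MOD p])
    (hνF : Subgroup.zpowers (ν.restrictNormal (fieldF p q)) = ⊤)
    (hν : GalSystem h fun i : Fin p => ν ^ (i : ℕ)) : Function.Surjective (normCl h) := by
  have hq1 : NeZero q := ⟨(Fact.out : q.Prime).ne_zero⟩
  obtain ⟨ζ, hζ⟩ := exists_isPrimitiveRoot q
  obtain ⟨θ, hθ, hθF, a, haq, ha1⟩ := exists_dirichletCharacter hq hνF hζ
  have hLM : L ≤ L ⊔ cycloNF q := le_sup_left
  have hcM : cycloNF q ≤ L ⊔ cycloNF q := le_sup_right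
  have hFL : fieldF p q ≤ L := le_sup_right.trans hL.ge
  let : Algebra E L := (incl h).toAlgebra
  refine NumberField.classGroupNorm_surjective (Fact.out : p.Prime) hp
    (hν.card_eq.trans_le (Fintype.card_fin p).le) (Fact.out : q.Prime) hθ
    (fun w => apply_absNorm_eq_zero_or_one hLM hcM hFL hζ hθF w.isPrime w.ne_bot)
    (fun w hw => exists_relNorm_eq h hLM hcM hL hζ hθF w.isPrime w.ne_bot hw)
    (exists_isCoprime_norm hE haq ha1)

end NormSurjective

end IwasawaThaine

namespace IwasawaThaine

open Module

/-! ### Projective limits of classes. -/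

section Limits

theorem extIdeal_self {E : GaloisNF} (I : (Ideal (𝓞 E))⁰) : extIdeal le_rfl I = I := by
  have h : extInt (le_refl E) = RingHom.id _ := RingHom.ext fun x => int_ext rfl
  refine Subtype.ext ?_
  rw [coe_extIdeal, h, Ideal.map_id]

theorem normCl_self {E : GaloisNF} (c : ClassGroup (𝓞 E)) : normCl le_rfl c = c := by
  obtain ⟨I, rfl⟩ := ClassGroup.mk0_surjective c
  have hsys : GalSystem (le_refl E) fun _ : Unit => (1 : QBar ≃ₐ[ℚ] QBar) :=
    ⟨fun _ _ => rfl, fun _ _ _ => rfl, fun σ hσ => ⟨(), fun x => hσ x⟩⟩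
  have h := extIdeal_normIdeal_eq_prod le_rfl hsys I
  rw [extIdeal_self, Finset.univ_unique, Finset.prod_singleton,
    galIdeal_eq_self fun _ => rfl] at h
  rw [normCl_mk0, h]

open CategoryTheory in
/-- A projective system of nonempty sets of classes has a norm coherent sequence. -/
theorem exists_norm_coherent {E : ℕ → GaloisNF} (hE : Monotone E)
    (S : ∀ n, Set (ClassGroup (𝓞 (E n)))) (hne : ∀ n, (S n).Nonempty)
    (hS : ∀ i j (h : i ≤ j), ∀ c ∈ S j, normCl (hE h) c ∈ S i) :
    ∃ a : ∀ n, ClassGroup (𝓞 (E n)), (∀ n, a n ∈ S n) ∧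
      ∀ i j (h : i ≤ j), normCl (hE h) (a j) = a i := by
  let ρ : ∀ i j, i ≤ j → S j → S i := fun i j h c => ⟨normCl (hE h) c.1, hS i j h c.1 c.2⟩
  have hρ : ∀ i c, ρ i i le_rfl c = c := fun i c => Subtype.ext (normCl_self c.1)
  have hρ' : ∀ i j k (h : i ≤ j) (h' : j ≤ k) c, ρ i k (h.trans h') c = ρ i j h (ρ j k h' c) :=
    fun i j k h h' c => Subtype.ext (normCl_normCl (hE h) (hE h') c.1).symm
  let F : ℕᵒᵖ ⥤ Type :=
    { obj := fun n => S n.unop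
      map := fun {j i} f => TypeCat.ofHom (ρ i.unop j.unop (leOfHom f.unop))
      map_id := fun n => TypeCat.homEquiv.injective (funext fun c => hρ n.unop c)
      map_comp := fun {k j i} f g => TypeCat.homEquiv.injective
        (funext fun c => hρ' i.unop j.unop k.unop (leOfHom g.unop) (leOfHom f.unop) c) }
  have h1 : ∀ n : ℕᵒᵖ, Finite (F.obj n) := fun n => inferInstanceAs (Finite (S n.unop))
  have h2 : ∀ n : ℕᵒᵖ, Nonempty (F.obj n) := fun n => (hne n.unop).to_subtype
  obtain ⟨u, hu⟩ := nonempty_sections_of_finite_inverse_system F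
  refine ⟨fun n => (u (Opposite.op n) : S n).1, fun n => (u (Opposite.op n) : S n).2,
    fun i j h => ?_⟩
  exact congrArg Subtype.val (hu (homOfLE h).op)

theorem algNorm_galSeq_apply (p : ℕ) {E : ℕ → GaloisNF} (σ : QBar ≃ₐ[ℚ] QBar)
    (b : ∀ n, ClassGroup (𝓞 (E n))) (n : ℕ) :
    algNorm p (galSeq σ E) b n = ∏ i ∈ Finset.range p, (galCl σ (E n))^[i] (b n) := by
  have h : ∀ i, ((galSeq σ E)^[i] b) n = (galCl σ (E n))^[i] (b n) := fun i => by
    induction i with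
    | zero => rfl
    | succ i ih =>
      rw [Function.iterate_succ_apply', Function.iterate_succ_apply', ← ih]
      rfl
  change (∏ i ∈ Finset.range p, (galSeq σ E)^[i] b) n = _
  rw [Finset.prod_apply]
  exact Finset.prod_congr rfl fun i _ => h i

variable {p : ℕ} [Fact p.Prime] {E : ℕ → GaloisNF} {hE : Monotone E}

theorem mem_limMinus {a : ∀ n, ClassGroup (𝓞 (E n))} : a ∈ limMinus p E hE ↔
    (∀ n, a n ∈ minusPart p (E n)) ∧ ∀ i j (h : i ≤ j), normCl (hE h) (a j) = a i := Iff.rfl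

theorem galSeq_mem_limMinus {σ : QBar ≃ₐ[ℚ] QBar}
    (hσ : ∀ n, ∀ x : E n, σ (conjugation (x : QBar)) = conjugation (σ x))
    {a : ∀ n, ClassGroup (𝓞 (E n))} (ha : a ∈ limMinus p E hE) :
    galSeq σ E a ∈ limMinus p E hE := by
  rw [mem_limMinus] at ha ⊢
  refine ⟨fun n => map_mem_minusPart (fun c => (galCl_comm (hσ n) c).symm) (ha.1 n),
    fun i j h => ?_⟩
  change normCl _ (galCl σ (E j) (a j)) = galCl σ (E i) (a i)
  rw [← galCl_normCl, ha.2 i j h]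

theorem galSeq_galSeq_of_mul_eq_one {σ τ : QBar ≃ₐ[ℚ] QBar} (h : σ * τ = 1)
    (a : ∀ n, ClassGroup (𝓞 (E n))) : galSeq σ E (galSeq τ E a) = a := by
  funext n
  change galCl σ (E n) (galCl τ (E n) (a n)) = a n
  obtain ⟨I, hI⟩ := ClassGroup.mk0_surjective (a n)
  rw [← hI, galCl_mk0, galCl_mk0, ← galIdeal_mul, h, galIdeal_eq_self fun _ => rfl]

theorem map_galSeq_limMinus
    (hσ : ∀ (σ : QBar ≃ₐ[ℚ] QBar) n, ∀ x : E n, σ (conjugation (x : QBar)) = conjugation (σ x))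
    (σ : QBar ≃ₐ[ℚ] QBar) : (limMinus p E hE).map (galSeq σ E) = limMinus p E hE := by
  refine le_antisymm ?_ fun a ha => ?_
  · rintro _ ⟨a, ha, rfl⟩
    exact galSeq_mem_limMinus (hσ σ) ha
  · exact ⟨galSeq σ⁻¹ E a, galSeq_mem_limMinus (hσ σ⁻¹) ha,
      galSeq_galSeq_of_mul_eq_one (mul_inv_cancel σ) a⟩

theorem mem_kerS {M : Type*} [CommGroup M] {ν : M →* M} {C : Subgroup M} {x : M} :
    x ∈ kerS ν C ↔ x ∈ C ∧ ν x = x := by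
  have : sMap ν x = ν x / x := rfl
  rw [kerS, Subgroup.mem_inf, MonoidHom.mem_ker, this, div_eq_one]

end Limits

/-! ### Fixed sequences and norms in the limit. -/

section ThaineShift

variable {p : ℕ} [Fact p.Prime] {K : GaloisNF} {m q : ℕ} [Fact q.Prime]
  {Q : Ideal (𝓞 (towerK p K m))} {ν : QBar ≃ₐ[ℚ] QBar}

theorem liftSeq_mem_kerS (hq : q ≡ 1 [MOD p])
    (hνK : ∀ n, ∀ x ∈ (towerK p K n).toIntermediateField, ν x = x)
    (hνF : Subgroup.zpowers (ν.restrictNormal (fieldF p q)) = ⊤)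
    {c : ∀ n, ClassGroup (𝓞 (towerK p K n))}
    (hc : c ∈ limMinus p (towerK p K) (towerK_mono p K)) :
    liftSeq (towerK_le_towerL p K q) c ∈
      kerS (galSeq ν (towerL p K q)) (limMinus p (towerL p K q) (towerL_mono p K q)) := by
  rw [mem_limMinus] at hc
  rw [mem_kerS, mem_limMinus]
  refine ⟨⟨fun n => map_mem_minusPart (fun c => galCl_liftCl _ _ c) (hc.1 n), fun i j h => ?_⟩,
    funext fun n => ?_⟩
  · obtain ⟨ι, hι, τ, hτ, hτ'⟩ := exists_galSystem_tower hq hνK hνF h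
    change normCl _ (liftCl _ (c j)) = liftCl _ (c i)
    rw [normCl_liftCl (towerK_mono p K h) _ (towerK_le_towerL p K q i) _ hτ hτ', hc.2 i j h]
  · change galCl ν _ (liftCl _ (c n)) = liftCl _ (c n)
    rw [galCl_liftCl, galCl_eq_self fun x => hνK n x x.2]

/-- Above a level `n` take good levels `i < j` with `i ≥ m`. The class `a i` is the norm of the
fixed class `a j`, hence lifted from 𝕂_i, and the norm carries this down to `n`. So the finite sets
of solutions are nonempty at every level, and compactness gives a coherent choice. -/
theorem exists_liftSeq_eq [IsCMField K] (hp : Odd p)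
    (hζ : ∀ ζ : QBar, ζ ^ p = 1 → ζ ∈ K.toIntermediateField)
    (hQ : InducesInertThaineShift p K m q Q)
    (hνK : ∀ n, ∀ x ∈ (towerK p K n).toIntermediateField, ν x = x)
    (hνF : Subgroup.zpowers (ν.restrictNormal (fieldF p q)) = ⊤)
    {a : ∀ n, ClassGroup (𝓞 (towerL p K q n))}
    (ha : a ∈ limMinus p (towerL p K q) (towerL_mono p K q))
    (hνa : galSeq ν (towerL p K q) a = a) :
    ∃ c ∈ limMinus p (towerK p K) (towerK_mono p K),
      liftSeq (towerK_le_towerL p K q) c = a := by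
  rw [mem_limMinus] at ha
  have hnorm : ∀ i j (h : i ≤ j), ∀ c : ClassGroup (𝓞 (towerK p K j)),
      c ∈ minusPart p (towerK p K j) ∧ liftCl (towerK_le_towerL p K q j) c = a j →
      normCl (towerK_mono p K h) c ∈ minusPart p (towerK p K i) ∧
        liftCl (towerK_le_towerL p K q i) (normCl (towerK_mono p K h) c) = a i := by
    rintro i j h c ⟨hc, hca⟩
    obtain ⟨ι, hι, τ, hτ, hτ'⟩ := exists_galSystem_tower hQ.modEq hνK hνF h
    refine ⟨map_mem_minusPart (fun c => galCl_normCl _ _ c) hc, ?_⟩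
    rw [← normCl_liftCl (towerK_mono p K h) (towerL_mono p K q h) _ (towerK_le_towerL p K q j)
      hτ hτ', hca, ha.2 i j h]
  have hne : ∀ n, {c | c ∈ minusPart p (towerK p K n) ∧
      liftCl (towerK_le_towerL p K q n) c = a n}.Nonempty := fun n => by
    obtain ⟨i, hni, hi⟩ := exists_isGoodLevel (p := p) K (max n m)
    obtain ⟨j, hij, hj⟩ := exists_isGoodLevel (p := p) K (i + 1)
    obtain ⟨c, hc, hca⟩ := exists_liftCl_eq_normCl hp hζ hQ hνK hνF
      ((le_max_right n m).trans hni) hi hj hij (ha.1 j) (congrFun hνa j)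
    exact ⟨_, hnorm n i ((le_max_left n m).trans hni) c ⟨hc, hca.trans (ha.2 i j ((i.le_succ).trans hij))⟩⟩
  obtain ⟨c, hc, hc'⟩ := exists_norm_coherent (towerK_mono p K)
    (fun n => {c | c ∈ minusPart p (towerK p K n) ∧ liftCl (towerK_le_towerL p K q n) c = a n}) hne hnorm
  exact ⟨c, mem_limMinus.mpr ⟨fun n => (hc n).1, hc'⟩, funext fun n => (hc n).2⟩

theorem kerS_galSeq_limMinus [IsCMField K] (hp : Odd p)
    (hζ : ∀ ζ : QBar, ζ ^ p = 1 → ζ ∈ K.toIntermediateField)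
    (hQ : InducesInertThaineShift p K m q Q)
    (hνK : ∀ n, ∀ x ∈ (towerK p K n).toIntermediateField, ν x = x)
    (hνF : Subgroup.zpowers (ν.restrictNormal (fieldF p q)) = ⊤) :
    kerS (galSeq ν (towerL p K q)) (limMinus p (towerL p K q) (towerL_mono p K q)) =
      (limMinus p (towerK p K) (towerK_mono p K)).map (liftSeq (towerK_le_towerL p K q)) := by
  refine le_antisymm (fun a ha => ?_) ?_
  · rw [mem_kerS] at ha
    exact exists_liftSeq_eq hp hζ hQ hνK hνF ha.1 ha.2
  · rintro _ ⟨c, hc, rfl⟩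
    exact liftSeq_mem_kerS hQ.modEq hνK hνF hc

/-- Norm coherent sequences over `𝕂` are norms of norm coherent sequences over `𝕃`. -/
theorem exists_normCl_eq (hp : Odd p)
    (hQ : InducesInertThaineShift p K m q Q)
    (hνK : ∀ n, ∀ x ∈ (towerK p K n).toIntermediateField, ν x = x)
    (hνF : Subgroup.zpowers (ν.restrictNormal (fieldF p q)) = ⊤)
    {c : ∀ n, ClassGroup (𝓞 (towerK p K n))}
    (hc : c ∈ limMinus p (towerK p K) (towerK_mono p K)) :
    ∃ b ∈ limMinus p (towerL p K q) (towerL_mono p K q),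
      ∀ n, normCl (towerK_le_towerL p K q n) (b n) = c n := by
  rw [mem_limMinus] at hc
  have hnorm : ∀ i j (h : i ≤ j), ∀ b : ClassGroup (𝓞 (towerL p K q j)),
      b ∈ minusPart p (towerL p K q j) ∧ normCl (towerK_le_towerL p K q j) b = c j →
      normCl (towerL_mono p K q h) b ∈ minusPart p (towerL p K q i) ∧
        normCl (towerK_le_towerL p K q i) (normCl (towerL_mono p K q h) b) = c i := by
    rintro i j h b ⟨hb, hbc⟩
    refine ⟨map_mem_minusPart (fun b => galCl_normCl _ _ b) hb, ?_⟩
    rw [← hc.2 i j h, ← hbc, normCl_normCl, normCl_normCl]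
  have hne : ∀ n, {b | b ∈ minusPart p (towerL p K q n) ∧
      normCl (towerK_le_towerL p K q n) b = c n}.Nonempty := fun n => by
    obtain ⟨b₀, hb₀⟩ := normCl_surjective hp (hQ.unramifiedAt (le_max_right n m))
      (towerK_le_towerL p K q (max n m)) rfl hQ.modEq hνF
      (galSystem_pow hQ.modEq hνK hνF (max n m)) (c (max n m))
    obtain ⟨b, hb, hbc⟩ := exists_minusPart_of_pow hp (fun b => galCl_normCl _ _ b)
      (hc.1 (max n m)) (Nat.coprime_one_left p) (hb₀.trans (pow_one _).symm)
    exact ⟨_, hnorm n (max n m) (le_max_left n m) b ⟨hb, hbc⟩⟩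
  obtain ⟨b, hb, hb'⟩ := exists_norm_coherent (towerL_mono p K q)
    (fun n => {b | b ∈ minusPart p (towerL p K q n) ∧
      normCl (towerK_le_towerL p K q n) b = c n}) hne hnorm
  exact ⟨b, mem_limMinus.mpr ⟨fun n => (hb n).1, hb'⟩, fun n => (hb n).2⟩

theorem subsingleton_tateH0 [IsCMField K] (hp : Odd p)
    (hζ : ∀ ζ : QBar, ζ ^ p = 1 → ζ ∈ K.toIntermediateField)
    (hQ : InducesInertThaineShift p K m q Q)
    (hνK : ∀ n, ∀ x ∈ (towerK p K n).toIntermediateField, ν x = x)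
    (hνF : Subgroup.zpowers (ν.restrictNormal (fieldF p q)) = ⊤) :
    Subsingleton (TateH0 p (galSeq ν (towerL p K q))
      (limMinus p (towerL p K q) (towerL_mono p K q))) := by
  rw [QuotientGroup.subsingleton_iff, Subgroup.subgroupOf_eq_top]
  intro a ha
  rw [mem_kerS] at ha
  obtain ⟨c, hc, rfl⟩ := exists_liftSeq_eq hp hζ hQ hνK hνF ha.1 ha.2
  obtain ⟨b, hb, hbc⟩ := exists_normCl_eq hp hQ hνK hνF hc
  refine ⟨b, hb, funext fun n => ?_⟩
  rw [algNorm_galSeq_apply, ← liftCl_normCl _ (galSystem_pow hQ.modEq hνK hνF n), hbc]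
  rfl

end ThaineShift

end IwasawaThaine

open IwasawaThaine in
theorem mainTheorem4 (p : ℕ) [Fact p.Prime] (hp : Odd p)
    (K : GaloisNF) [NumberField.IsCMField K]
    (hζ : ∀ ζ : QBar, ζ ^ p = 1 → ζ ∈ K.toIntermediateField)
    (m q : ℕ) [Fact q.Prime] (Q : Ideal (NumberField.RingOfIntegers (towerK p K m)))
    (hQ : InducesInertThaineShift p K m q Q)
    (ν : QBar ≃ₐ[ℚ] QBar)
    (hνK : ∀ n, ∀ x ∈ (towerK p K n).toIntermediateField, ν x = x)
    (hνF : Subgroup.zpowers (ν.restrictNormal (fieldF p q)) = ⊤) :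
    (limMinus p (towerL p K q) (towerL_mono p K q)).map (galSeq ν (towerL p K q)) =
        limMinus p (towerL p K q) (towerL_mono p K q) ∧
      kerS (galSeq ν (towerL p K q)) (limMinus p (towerL p K q) (towerL_mono p K q)) =
        (limMinus p (towerK p K) (towerK_mono p K)).map (liftSeq (towerK_le_towerL p K q)) ∧
      Subsingleton (TateH0 p (galSeq ν (towerL p K q))
        (limMinus p (towerL p K q) (towerL_mono p K q))) :=
  ⟨map_galSeq_limMinus (fun τ n x => conjugation_comm_towerL p K q τ n x) ν,
    kerS_galSeq_limMinus hp hζ hQ hνK hνF, subsingleton_tateH0 hp hζ hQ hνK hνF⟩
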